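/- Let $\varepsilon>0$ and let $\alpha_1,\alpha_2,\alpha_3,\beta\in\mathbb{C}^{4\times4}$ be Dirac matrices: Hermitian, pairwise anti-commuting, with $\alpha_j^2=\beta^2=1$. For $\phi\in H^1(\mathbb{R}^3,\mathbb{R})$ let $$D_\phi=-\mathrm{i}\varepsilon\sum_{j=1}^3\alpha_j\partial_{x_j}+\beta(1+\phi)$$ on $L^2(\mathbb{R}^3,\mathbb{C}^4)$. This operator is self-adjoint with domain $H^1(\mathbb{R}^3,\mathbb{C}^4)$, and its absolute value $|D_\phi|$ (the nonnegative self-adjoint operator with $|D_\phi|^2=D_\phi^*D_\phi$) restricts to a bounded operator from $H^2(\mathbb{R}^3,\mathbb{C}^4)$ to $L^2(\mathbb{R}^3,\mathbb{C}^4)$. (i) For every $\phi\in H^1(\mathbb{R}^3,\mathbb{R})$ the map $s\mapsto|D_{s\phi}|$, from $\mathbb{R}$ to the bounded operators $\mathscr{L}(H^2,L^2)$ with the norm topology, is four times continuously differentiable near $s=0$. The operator $$-|D_\phi|+\sum_{j=0}^4\frac1{j!}\frac{\mathrm{d}^j}{\mathrm{d}s^j}\Big|_{s=0}|D_{s\phi}|,$$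 defined on $H^2$, extends to a trace class operator on $L^2(\mathbb{R}^3,\mathbb{C}^4)$ with real trace. Hence the regularised vacuum energy $$\mathcal{E}_{\mathrm{vac}}(\phi)=\frac12\operatorname{Tr}\Big(-|D_\phi|+\sum_{j=0}^4\frac1{j!}\frac{\mathrm{d}^j}{\mathrm{d}s^j}\Big|_{s=0}|D_{s\phi}|\Big)\in\mathbb{R}$$ is well defined. (ii) $\mathcal{E}_{\mathrm{vac}}$ is continuous on $H^1(\mathbb{R}^3,\mathbb{R})$. (iii) For every $\phi\in H^1(\mathbb{R}^3,\mathbb{R})$ and every real $\omega\neq0$ the operator $D_\phi^2+\omega^2$ has a bounded inverse and $s\mapsto D_{s\phi}^2(D_{s\phi}^2+\omega^2)^{-1}$ is four times continuously differentiable near $s=0$ in operator norm on $L^2$; the integral below converges as a Bochner integral in operator norm, its value is a trace class operator, and $$\mathcal{E}_{\mathrm{vac}}(\phi)=-\frac1{2\pi}\operatorname{Tr}\Big(\int_{\mathbb{R}}\frac{D_\phi^2}{D_\phi^2+\omega^2}-\sum_{j=0}^4\frac1{j!}\frac{\mathrm{d}^j}{\mathrm{d}s^j}\Big|_{s=0}\frac{D_{s\phi}^2}{D_{s\phi}^2+\omega^2}\,\mathrm{d}\omega\Big).$$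 (iv) The set $U=\{\phi\in H^1(\mathbb{R}^3,\mathbb{R}):0\notin\sigma(D_\phi)\}$ is open in $H^1(\mathbb{R}^3,\mathbb{R})$, and $\mathcal{E}_{\mathrm{vac}}$ is smooth ($C^\infty$ in the Fréchet sense) on $U$. -/

import Mathlib

open MeasureTheory Filter Topology
open scoped InnerProductSpace

noncomputable section

namespace DiracVacuum

/-! ### Trace class operators and the trace -/

section Trace

variable {H : Type} [NormedAddCommGroup H] [InnerProductSpace ℂ H] [CompleteSpace H]

/-- A bounded operator `K` is trace class if `∑ ⟨e_i, |K| e_i⟩ < ∞` for every Hilbert basis `(e_i)`,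
where `|K| = (K* K)^{1/2}`. -/
def IsTraceClass (K : H →L[ℂ] H) : Prop :=
  ∀ (ι : Type) (b : HilbertBasis ι ℂ H), Summable fun i => (⟪b i, CFC.abs K (b i)⟫_ℂ).re

variable (H) in
/-- The index set of the Hilbert basis `stdBasis H`. -/
def basisIndex : Set H := (exists_hilbertBasis ℂ H).choose

variable (H) in
/-- A Hilbert basis of `H`, chosen once and for all. -/
def stdBasis : HilbertBasis (basisIndex H) ℂ H := (exists_hilbertBasis ℂ H).choose_spec.choose

/-- The trace `∑ ⟨e_i, K e_i⟩` of a trace class operator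
(for such operators it does not depend on the Hilbert basis). -/
def trace (K : H →L[ℂ] H) : ℂ := ∑' i, ⟪stdBasis H i, K (stdBasis H i)⟫_ℂ

end Trace

/-! ### Unbounded operators -/

section Unbounded

variable {H : Type} [NormedAddCommGroup H] [InnerProductSpace ℂ H] [CompleteSpace H]

/-- The composition `S T` of unbounded operators, with its natural domain
`{x ∈ dom T : T x ∈ dom S}`. -/
def pcomp (S T : H →ₗ.[ℂ] H) : H →ₗ.[ℂ] H where
  domain :=
    { carrier := {x | ∃ h : x ∈ T.domain, T ⟨x, h⟩ ∈ S.domain}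
      zero_mem' := ⟨T.domain.zero_mem, by
        have : T ⟨0, T.domain.zero_mem⟩ = 0 := T.map_zero
        rw [this]; exact S.domain.zero_mem⟩
      add_mem' := by
        rintro x y ⟨hx, hx'⟩ ⟨hy, hy'⟩
        refine ⟨T.domain.add_mem hx hy, ?_⟩
        have : T ⟨x + y, T.domain.add_mem hx hy⟩ = T ⟨x, hx⟩ + T ⟨y, hy⟩ :=
          T.map_add ⟨x, hx⟩ ⟨y, hy⟩
        rw [this]; exact S.domain.add_mem hx' hy'
      smul_mem' := by
        rintro c x ⟨hx, hx'⟩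
        refine ⟨T.domain.smul_mem c hx, ?_⟩
        have : T ⟨c • x, T.domain.smul_mem c hx⟩ = c • T ⟨x, hx⟩ := T.map_smul c ⟨x, hx⟩
        rw [this]; exact S.domain.smul_mem c hx' }
  toFun :=
    { toFun := fun x => S ⟨T ⟨x, x.2.choose⟩, x.2.choose_spec⟩
      map_add' := by
        intro x y
        rw [← S.map_add]
        congr 1
        apply Subtype.ext
        exact T.map_add ⟨x, x.2.choose⟩ ⟨y, y.2.choose⟩
      map_smul' := by
        intro c x
        rw [RingHom.id_apply, ← S.map_smul]
        congr 1
        apply Subtype.ext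
        exact T.map_smul c ⟨x, x.2.choose⟩ }

/-- `T + z`, with the domain of `T`. -/
def addConst (T : H →ₗ.[ℂ] H) (z : ℂ) : H →ₗ.[ℂ] H := (z • (LinearMap.id : H →ₗ[ℂ] H)) +ᵥ T

/-- The bounded operator `S` is the inverse of `T : dom T → H`. -/
def IsBoundedInverse (S : H →L[ℂ] H) (T : H →ₗ.[ℂ] H) : Prop :=
  (∀ y, ∃ h : S y ∈ T.domain, T ⟨S y, h⟩ = y) ∧ ∀ x : T.domain, S (T x) = x

open Classical in
/-- The bounded inverse of `T` (and `0` if there is none). -/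
def boundedInverse (T : H →ₗ.[ℂ] H) : H →L[ℂ] H :=
  if h : ∃ S, IsBoundedInverse S T then h.choose else 0

/-- The spectrum: all `z` for which `T - z` has no bounded inverse. -/
def pspectrum (T : H →ₗ.[ℂ] H) : Set ℂ := {z | ¬ ∃ S, IsBoundedInverse S (addConst T (-z))}

/-- `A = |T|`: the nonnegative self-adjoint operator with `A² = T* T`. -/
def IsAbs (A T : H →ₗ.[ℂ] H) : Prop :=
  IsSelfAdjoint A ∧ (∀ x : A.domain, 0 ≤ (⟪(x : H), A x⟫_ℂ).re) ∧
    pcomp A A = pcomp (LinearPMap.adjoint T) T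

open Classical in
/-- The absolute value `|T|` (and `0` if there is none). -/
def absOp (T : H →ₗ.[ℂ] H) : H →ₗ.[ℂ] H :=
  if h : ∃ A, IsAbs A T then h.choose else 0

end Unbounded

/-! ### Sobolev spaces over `ℝ³` -/

/-- Three-dimensional Euclidean space. -/
abbrev R3 : Type := EuclideanSpace ℝ (Fin 3)

/-- Spinors. -/
abbrev C4 : Type := EuclideanSpace ℂ (Fin 4)

/-- `L²(ℝ³, F)`. -/
abbrev L2 (F : Type) [NormedAddCommGroup F] : Type := Lp F 2 (volume : Measure R3)

/-- `g` is the weak partial derivative `∂_j u`. -/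
def HasWeakDeriv {F : Type} [NormedAddCommGroup F] [NormedSpace ℝ F]
    (j : Fin 3) (u g : L2 F) : Prop :=
  ∀ η : R3 → ℝ, ContDiff ℝ (⊤ : ℕ∞) η → HasCompactSupport η →
    ∫ x, fderiv ℝ η x (EuclideanSpace.single j 1) • u x = - ∫ x, η x • g x

section WeakDeriv

variable {F : Type} [NormedAddCommGroup F] [NormedSpace ℝ F]

lemma integrable_test_smul {η : R3 → ℝ} (hη : Continuous η) (hc : HasCompactSupport η) (u : L2 F) :
    Integrable fun x => η x • u x :=
  ((Lp.memLp u).locallyIntegrable (by norm_num)).integrable_smul_left_of_hasCompactSupport hη hc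

lemma continuous_test_deriv {η : R3 → ℝ} (hη : ContDiff ℝ (⊤ : ℕ∞) η) (j : Fin 3) :
    Continuous fun x => fderiv ℝ η x (EuclideanSpace.single j 1) :=
  (hη.continuous_fderiv (by simp)).clm_apply continuous_const

lemma hasCompactSupport_test_deriv {η : R3 → ℝ} (hc : HasCompactSupport η) (j : Fin 3) :
    HasCompactSupport fun x => fderiv ℝ η x (EuclideanSpace.single j 1) :=
  hc.fderiv_apply (𝕜 := ℝ) _

lemma HasWeakDeriv.zero (j : Fin 3) : HasWeakDeriv j (0 : L2 F) 0 := by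
  intro η _ _
  have h : ∀ f : R3 → ℝ, ∫ x, f x • (0 : L2 F) x = 0 := fun f => by
    rw [integral_eq_zero_of_ae]
    filter_upwards [Lp.coeFn_zero F 2 (volume : Measure R3)] with x hx
    rw [hx]; exact smul_zero _
  rw [h, h, neg_zero]

lemma HasWeakDeriv.add {j : Fin 3} {u v g h : L2 F} (hu : HasWeakDeriv j u g)
    (hv : HasWeakDeriv j v h) : HasWeakDeriv j (u + v) (g + h) := by
  intro η hη hc
  have key : ∀ (f : R3 → ℝ), Continuous f → HasCompactSupport f → ∀ a b : L2 F,
      ∫ x, f x • (a + b) x = (∫ x, f x • a x) + ∫ x, f x • b x := by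
    intro f hf hfc a b
    rw [← integral_add (integrable_test_smul hf hfc a) (integrable_test_smul hf hfc b)]
    apply integral_congr_ae
    filter_upwards [Lp.coeFn_add a b] with x hx
    rw [hx, Pi.add_apply, smul_add]
  rw [key _ (continuous_test_deriv hη j) (hasCompactSupport_test_deriv hc j),
    key _ hη.continuous hc, hu η hη hc, hv η hη hc, neg_add]

lemma HasWeakDeriv.smul {𝕜 : Type} [RCLike 𝕜] [NormedSpace 𝕜 F] [SMulCommClass ℝ 𝕜 F]
    {j : Fin 3} {u g : L2 F} (c : 𝕜)
    (hu : HasWeakDeriv j u g) : HasWeakDeriv j (c • u) (c • g) := by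
  intro η hη hc
  have key : ∀ (f : R3 → ℝ) (a : L2 F), ∫ x, f x • (c • a) x = c • ∫ x, f x • a x := by
    intro f a
    rw [← integral_smul]
    apply integral_congr_ae
    filter_upwards [Lp.coeFn_smul c a] with x hx
    rw [hx, Pi.smul_apply, smul_comm]
  rw [key, key, hu η hη hc, smul_neg]

/-- Weak derivatives are unique. -/
lemma HasWeakDeriv.unique [CompleteSpace F] {j : Fin 3} {u g h : L2 F} (hg : HasWeakDeriv j u g)
    (hh : HasWeakDeriv j u h) : g = h := by
  apply Lp.ext
  apply ae_eq_of_integral_contDiff_smul_eq ((Lp.memLp g).locallyIntegrable (by norm_num))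
    ((Lp.memLp h).locallyIntegrable (by norm_num))
  intro η hη hc
  have := (hg η hη hc).symm.trans (hh η hη hc)
  exact neg_injective this

end WeakDeriv

/-- The Sobolev space `H¹(ℝ³, ℝ)` as a closed subspace of a Hilbert space, with its Hilbert norm
`(‖φ‖² + ∑_j ‖∂_j φ‖²)^{1/2}`; an element is stored as the tuple of `φ` (index `none`)
and its weak derivatives `∂_j φ` (index `some j`), all in `L²`. -/
def H1space : Submodule ℝ (PiLp 2 fun _ : Option (Fin 3) => L2 ℝ) where
  carrier := {w | ∀ j, HasWeakDeriv j (w none) (w (some j))}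
  zero_mem' := fun j => HasWeakDeriv.zero j
  add_mem' := fun ha hb j => (ha j).add (hb j)
  smul_mem' := fun c _ ha j => (ha j).smul c

/-- The normed space `H¹(ℝ³, ℝ)`. -/
abbrev H1 : Type := H1space

/-- The function underlying an element of `H¹(ℝ³, ℝ)`. -/
def H1.fn (φ : H1) : L2 ℝ := (φ : PiLp 2 fun _ : Option (Fin 3) => L2 ℝ) none

/-- The Sobolev space `H²(ℝ³, ℂ⁴)` with its Hilbert norm; an element is stored as the tuple of `u`
(index `inl ()`), its first weak derivatives `∂_j u` (index `inr (inl j)`) and its second weak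
derivatives `∂_j ∂_k u` (index `inr (inr (j, k))`), all in `L²`. -/
def H2space : Submodule ℂ (PiLp 2 fun _ : Unit ⊕ (Fin 3 ⊕ Fin 3 × Fin 3) => L2 C4) where
  carrier := {w | (∀ j, HasWeakDeriv j (w (.inl ())) (w (.inr (.inl j)))) ∧
    ∀ j k, HasWeakDeriv j (w (.inr (.inl k))) (w (.inr (.inr (j, k))))}
  zero_mem' := ⟨fun j => HasWeakDeriv.zero j, fun j _ => HasWeakDeriv.zero j⟩
  add_mem' := fun ha hb => ⟨fun j => (ha.1 j).add (hb.1 j), fun j k => (ha.2 j k).add (hb.2 j k)⟩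
  smul_mem' := fun c _ ha => ⟨fun j => (ha.1 j).smul c, fun j k => (ha.2 j k).smul c⟩

/-- The normed space `H²(ℝ³, ℂ⁴)`. -/
abbrev H2 : Type := H2space

/-- The function underlying an element of `H²(ℝ³, ℂ⁴)`. -/
def H2.fn (u : H2) : L2 C4 :=
  (u : PiLp 2 fun _ : Unit ⊕ (Fin 3 ⊕ Fin 3 × Fin 3) => L2 C4) (.inl ())

/-- The subspace `H¹(ℝ³, ℂ⁴)` of `L²(ℝ³, ℂ⁴)`, as a set. -/
def spinorH1 : Set (L2 C4) := {u | ∀ j, ∃ g, HasWeakDeriv j u g}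

/-! ### The Dirac operator -/

/-- `α₁, α₂, α₃, β` are Dirac matrices: Hermitian, anti-commuting and with square one. -/
structure IsDiracMatrices (α : Fin 3 → Matrix (Fin 4) (Fin 4) ℂ)
    (β : Matrix (Fin 4) (Fin 4) ℂ) : Prop where
  hermitian_α : ∀ j, (α j).IsHermitian
  hermitian_β : β.IsHermitian
  sq_α : ∀ j, α j * α j = 1
  sq_β : β * β = 1
  anticomm_αα : ∀ j k, j ≠ k → α j * α k = -(α k * α j)
  anticomm_αβ : ∀ j, α j * β = -(β * α j)

/-- The action of a matrix on spinors. -/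
abbrev act (M : Matrix (Fin 4) (Fin 4) ℂ) : C4 →L[ℂ] C4 := Matrix.toEuclideanCLM (𝕜 := ℂ) M

section Dirac

variable (α : Fin 3 → Matrix (Fin 4) (Fin 4) ℂ) (β : Matrix (Fin 4) (Fin 4) ℂ) (ε : ℝ)

/-- The graph of the Dirac operator `D_φ = -iε ∑_j α_j ∂_j + β (1 + φ)`: all pairs `(u, D_φ u)` with
`u ∈ H¹(ℝ³, ℂ⁴)` and `D_φ u ∈ L²(ℝ³, ℂ⁴)`. -/
def diracGraph (φ : H1) : Submodule ℂ (L2 C4 × L2 C4) where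
  carrier := {p | ∃ g : Fin 3 → L2 C4, (∀ j, HasWeakDeriv j p.1 (g j)) ∧
    ∀ᵐ x, p.2 x = -(Complex.I * ε) • ∑ j, act (α j) (g j x)
      + ((1 + φ.fn x : ℝ) : ℂ) • act β (p.1 x)}
  zero_mem' := by
    refine ⟨fun _ => 0, fun j => HasWeakDeriv.zero j, ?_⟩
    filter_upwards with x
    simp
  add_mem' := by
    rintro ⟨u, v⟩ ⟨u', v'⟩ ⟨g, hg, hv⟩ ⟨g', hg', hv'⟩
    refine ⟨fun j => g j + g' j, fun j => (hg j).add (hg' j), ?_⟩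
    have hs : ∀ᵐ x, ∀ j, (g j + g' j : L2 C4) x = g j x + g' j x :=
      ae_all_iff.2 fun j => Lp.coeFn_add (g j) (g' j)
    filter_upwards [hv, hv', hs, Lp.coeFn_add u u', Lp.coeFn_add v v'] with x h1 h2 h3 h4 h5
    dsimp only [Prod.mk_add_mk] at *
    simp only [h5, h4, h3, Pi.add_apply, h1, h2, map_add, Finset.sum_add_distrib, smul_add]
    abel
  smul_mem' := by
    rintro c ⟨u, v⟩ ⟨g, hg, hv⟩
    refine ⟨fun j => c • g j, fun j => (hg j).smul c, ?_⟩
    have hs : ∀ᵐ x, ∀ j, (c • g j : L2 C4) x = c • g j x :=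
      ae_all_iff.2 fun j => Lp.coeFn_smul c (g j)
    filter_upwards [hv, hs, Lp.coeFn_smul c u, Lp.coeFn_smul c v] with x h1 h3 h4 h5
    dsimp only [Prod.smul_mk] at *
    simp only [h5, h4, h3, Pi.smul_apply, h1, map_smul, ← Finset.smul_sum, smul_add]
    rw [smul_comm c, smul_comm c]

/-- The graph is that of a function. -/
lemma diracGraph_eq_zero (φ : H1) :
    ∀ p ∈ diracGraph α β ε φ, p.1 = 0 → p.2 = 0 := by
  rintro ⟨u, v⟩ ⟨g, hg, hv⟩ h0
  dsimp only at *
  subst h0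
  have hg0 : ∀ j, g j = 0 := fun j => (hg j).unique (HasWeakDeriv.zero j)
  apply Lp.ext
  filter_upwards [hv] with x h1
  simp [h1, hg0]

/-- The Dirac operator `D_φ = -iε ∑_j α_j ∂_j + β (1 + φ)` on `L²(ℝ³, ℂ⁴)`. -/
def dirac (φ : H1) : L2 C4 →ₗ.[ℂ] L2 C4 := (diracGraph α β ε φ).toLinearPMap

/-! ### The vacuum energy -/

/-- `B` is the restriction of the unbounded operator `A` to `H²(ℝ³, ℂ⁴)`, as a bounded operator
from `H²` to `L²`. -/
def IsRestrictionToH2 (B : H2 →L[ℂ] L2 C4) (A : L2 C4 →ₗ.[ℂ] L2 C4) : Prop :=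
  ∀ u : H2, ∃ h : u.fn ∈ A.domain, A ⟨u.fn, h⟩ = B u

open Classical in
/-- `|D_φ|` as an element of `𝓛(H², L²)` (and `0` if there is none). -/
def absDirac (φ : H1) : H2 →L[ℂ] L2 C4 :=
  if h : ∃ B, IsRestrictionToH2 B (absOp (dirac α β ε φ)) then h.choose else 0

/-- `-|D_φ| + ∑_{j ≤ 4} (1/j!) (d/ds)^j |D_{sφ}|` at `s = 0`, the derivatives being taken in the norm
topology of `𝓛(H², L²)`. -/
def vacuumH2 (φ : H1) : H2 →L[ℂ] L2 C4 :=
  -absDirac α β ε φ + ∑ j ∈ Finset.range 5,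
    (1 / (j.factorial : ℝ)) • iteratedDeriv j (fun s : ℝ => absDirac α β ε (s • φ)) 0

/-- The bounded operator `K` on `L²` extends `B : H² → L²`. -/
def IsExtension (K : L2 C4 →L[ℂ] L2 C4) (B : H2 →L[ℂ] L2 C4) : Prop :=
  ∀ u : H2, K u.fn = B u

open Classical in
/-- The bounded extension to `L²` of `vacuumH2` (and `0` if there is none). -/
def vacuumOp (φ : H1) : L2 C4 →L[ℂ] L2 C4 :=
  if h : ∃ K, IsExtension K (vacuumH2 α β ε φ) then h.choose else 0

/-- The regularised vacuum energy
`½ Tr (-|D_φ| + ∑_{j ≤ 4} (1/j!) (d/ds)^j |D_{sφ}|)`, a real number. -/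
def vacuumEnergy (φ : H1) : ℝ := 1 / 2 * (trace (vacuumOp α β ε φ)).re

/-- The bounded operator `D_φ² / (D_φ² + ω²) = 1 - ω² (D_φ² + ω²)⁻¹` for real `ω ≠ 0`. -/
def quotientOp (φ : H1) (ω : ℝ) : L2 C4 →L[ℂ] L2 C4 :=
  1 - ((ω ^ 2 : ℝ) : ℂ) •
    boundedInverse (addConst (pcomp (dirac α β ε φ) (dirac α β ε φ)) ((ω ^ 2 : ℝ) : ℂ))

/-- `D_φ² / (D_φ² + ω²) - ∑_{j ≤ 4} (1/j!) (d/ds)^j D_{sφ}² / (D_{sφ}² + ω²)` at `s = 0`, the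
derivatives being taken in the operator norm. -/
def vacuumIntegrand (φ : H1) (ω : ℝ) : L2 C4 →L[ℂ] L2 C4 :=
  quotientOp α β ε φ ω - ∑ j ∈ Finset.range 5,
    (1 / (j.factorial : ℝ)) • iteratedDeriv j (fun s : ℝ => quotientOp α β ε (s • φ) ω) 0

/-- The set of all `φ ∈ H¹(ℝ³, ℝ)` with `0 ∉ σ(D_φ)`. -/
def gapSet : Set H1 := {φ | (0 : ℂ) ∉ pspectrum (dirac α β ε φ)}

end Dirac

end DiracVacuum

end

open DiracVacuum

/-! Since the Dirac matrices anti-commute, D_φ² = D_0² + W with D_0² = 1 − ε²Δ and W = 2φ + φ² − iε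
Σ_j ∂_jφ α_jβ. The embedding H¹ ⊂ L⁴ puts W in L², so A_ω = W (D_0² + ω²)⁻¹ is Hilbert–Schmidt with
norm O((1 + ω²)^{-1/4}) (`hsBound_A`). Put R_ω = (D_0² + ω²)⁻¹ and N_ω = (1 + A_ω)⁻¹. Then (D_φ² +
ω²)⁻¹ = R_ω N_ω. For large |ω| this follows from a Neumann series, which also yields
self-adjointness of D_φ; self-adjointness then extends it to every ω ≠ 0 (`isUnit_of_ne_zero`).

The absolute value enters through an integral formula for √(S(1 − S)), where S = (D_φ² + 1)⁻¹. It
gives |D_φ| R_0 = π⁻¹ ∫ (1 − ω² R_ω N_ω) R_0 dω (`absR_eq_integral`), and this describes |D_φ| on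
H², the range of R_0. Replacing φ by sφ turns A into sA₁ + s²A₂. The Taylor coefficients of N obey a
two-term recursion, and the remainder after order four is a sum of words of degree 5 and 6 in A₁,
A₂, times N. Such a word has at least three letters (`FreeData.invRem_eq`). Two of them make the
product trace class, and all three together decay like (1 + ω²)^{-3/4}, which is integrable
(`FreeData.trBound_form`). The word A₂A₂ of degree four has only the bound O(|ω|⁻¹); this is why the
terms up to order four are subtracted. The vacuum operator is therefore −π⁻¹ times an integral with
finite trace norm.

Near ω = 0 the operator N_ω may be unbounded if 0 ∈ σ(D_φ). But ω²‖R_ω N_ω‖ ≤ 1 leads to ω²‖N_ω‖ ≤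
C(1 + ω²) with C locally uniform in φ (`sq_mul_norm_N_le`), and dominated convergence gives
continuity of the energy. If 0 ∉ σ(D_φ), then 1 + A_ω is invertible at ω = 0 as well, so 1 + A is a
unit in the Banach algebra of bounded continuous operator functions of ω
(`isUnit_one_add_of_tendsto_zero`). Inversion is smooth there and the trace is a bounded trilinear
form (`FreeData.TrL`), which gives smoothness. -/

set_option linter.unusedSectionVars false

noncomputable section

namespace DiracVacuum

open SchwartzMap TemperedDistribution FourierTransform LineDeriv
open scoped SchwartzMap

/-! ### Weak derivatives and the Fourier transform -/

section FourierWeak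

variable {F : Type} [NormedAddCommGroup F] [InnerProductSpace ℂ F] [CompleteSpace F]

/-- The `j`-th standard basis vector of `ℝ³`. -/
abbrev basisVec (j : Fin 3) : R3 := EuclideanSpace.single j 1

lemma integrable_schwartz_smul (f : 𝓢(R3, ℂ)) (u : L2 F) : Integrable fun x => f x • u x :=
  memLp_one_iff_integrable.1 ((Lp.memLp u).smul (f.memLp 2 volume))

/-- Only real test functions enter `HasWeakDeriv`, but the Fourier transform needs complex ones.
Both sides are complex linear in the test function, so real and imaginary parts can be treated
separately. -/
lemma HasWeakDeriv.complex {j : Fin 3} {u g : L2 F} (h : HasWeakDeriv j u g) (f : 𝓢(R3, ℂ))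
    (hf : HasCompactSupport f) :
    ∫ x, fderiv ℝ f x (basisVec j) • u x = - ∫ x, f x • g x := by
  have hre : ContDiff ℝ (⊤ : ℕ∞) (fun x => (f x).re) := 
    Complex.reCLM.contDiff.comp (f.smooth ⊤)
  have him : ContDiff ℝ (⊤ : ℕ∞) (fun x => (f x).im) := 
    Complex.imCLM.contDiff.comp (f.smooth ⊤)
  have cre : HasCompactSupport (fun x => (f x).re) := hf.comp_left (g := Complex.re) rfl
  have cim : HasCompactSupport (fun x => (f x).im) := hf.comp_left (g := Complex.im) rfl
  have h1 := h _ hre cre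
  have h2 := h _ him cim
  have dre : ∀ x, fderiv ℝ (fun x => (f x).re) x (basisVec j) = (fderiv ℝ f x (basisVec j)).re := by
    intro x
    have := Complex.reCLM.hasFDerivAt.comp x (f.differentiable x).hasFDerivAt
    exact congrArg (fun L => L (basisVec j)) this.fderiv
  have dim : ∀ x, fderiv ℝ (fun x => (f x).im) x (basisVec j) = (fderiv ℝ f x (basisVec j)).im := by
    intro x
    have := Complex.imCLM.hasFDerivAt.comp x (f.differentiable x).hasFDerivAt
    exact congrArg (fun L => L (basisVec j)) this.fderiv
  have i1 := integrable_test_smul (continuous_test_deriv hre j) (hasCompactSupport_test_deriv cre j) u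
  have i2 := integrable_test_smul (continuous_test_deriv him j) (hasCompactSupport_test_deriv cim j) u
  have i3 := integrable_test_smul hre.continuous cre g
  have i4 := integrable_test_smul him.continuous cim g
  have split : ∀ (z : ℂ) (v : F), z • v = z.re • v + Complex.I • (z.im • v) := by
    intro z v
    conv_lhs => rw [← Complex.re_add_im z]
    rw [add_smul, mul_comm, mul_smul]
    simp
  calc ∫ x, fderiv ℝ f x (basisVec j) • u x
      = ∫ x, (fderiv ℝ (fun x => (f x).re) x (basisVec j) • u x
        + Complex.I • (fderiv ℝ (fun x => (f x).im) x (basisVec j) • u x)) := by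
        refine integral_congr_ae (.of_forall fun x => ?_)
        simp only [dre, dim]; exact split _ _
    _ = - ∫ x, f x • g x := by
        have i2' := i2.smul Complex.I
        have i4' := i4.smul Complex.I
        refine (integral_add i1 i2').trans ?_
        simp only [Pi.smul_apply]
        rw [integral_smul, h1, h2, smul_neg, ← neg_add, ← integral_smul]
        refine congrArg Neg.neg ((integral_add i3 i4').symm.trans ?_)
        refine integral_congr_ae (.of_forall fun x => ?_)
        exact (split _ _).symm

/-- Multiplication by χ(x/(n+1)) makes a Schwartz function compactly supported. The extra term,
where the derivative falls on the cut-off, carries a factor 1/(n+1) and vanishes in the limit by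
dominated convergence. -/
lemma HasWeakDeriv.schwartz {j : Fin 3} {u g : L2 F} (h : HasWeakDeriv j u g) (f : 𝓢(R3, ℂ)) :
    ∫ x, fderiv ℝ f x (basisVec j) • u x = - ∫ x, f x • g x := by
  let χ : ContDiffBump (0 : R3) := ⟨1, 2, one_pos, one_lt_two⟩
  have χs : ContDiff ℝ (⊤ : ℕ∞) χ := χ.contDiff
  have χd : Differentiable ℝ χ := χs.differentiable (by simp)
  obtain ⟨M, hM⟩ : ∃ M, ∀ x, ‖fderiv ℝ χ x (basisVec j)‖ ≤ M :=
    ((χ.hasCompactSupport.fderiv_apply (𝕜 := ℝ) _).exists_bound_of_continuous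
      ((χs.continuous_fderiv (by simp)).clm_apply continuous_const))
  let c : ℕ → ℝ := fun n => ((n : ℝ) + 1)⁻¹
  have hc0 : Tendsto c atTop (𝓝 0) := tendsto_inv_atTop_zero.comp
    (tendsto_natCast_atTop_atTop.atTop_add tendsto_const_nhds)
  have cpos : ∀ n, 0 < c n := fun n => by positivity
  have cle : ∀ n, c n ≤ 1 := fun n => inv_le_one_of_one_le₀ (by simp)
  let F' : ℕ → R3 → ℂ := fun n x => (χ (c n • x) : ℂ) * f x
  have smF : ∀ n, ContDiff ℝ (⊤ : ℕ∞) (F' n) := fun n =>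
    (Complex.ofRealCLM.contDiff.comp (χs.comp (contDiff_const_smul _))).mul (f.smooth ⊤)
  have csF : ∀ n, HasCompactSupport (F' n) := fun n => by
    have h0 : HasCompactSupport (fun x => χ (c n • x)) :=
      χ.hasCompactSupport.comp_smul (cpos n).ne'
    exact (h0.comp_left (g := fun r : ℝ => (r : ℂ)) (by simp)).mul_right
  have dF : ∀ n x, fderiv ℝ (F' n) x (basisVec j) = (χ (c n • x) : ℂ) * fderiv ℝ f x (basisVec j)
      + ((c n * fderiv ℝ χ (c n • x) (basisVec j) : ℝ) : ℂ) * f x := by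
    intro n x
    have h1 : HasFDerivAt (fun y : R3 => c n • y) (c n • ContinuousLinearMap.id ℝ R3) x :=
      (c n • ContinuousLinearMap.id ℝ R3).hasFDerivAt
    have h2 := (Complex.ofRealCLM.hasFDerivAt (x := χ (c n • x))).comp x
      ((χd (c n • x)).hasFDerivAt.comp x h1)
    have h3 := h2.mul (f.differentiable x).hasFDerivAt
    have h4 := congrArg (fun L => L (basisVec j)) h3.fderiv
    refine h4.trans ?_
    simp
    ring
  have key : ∀ n, ∫ x, fderiv ℝ (F' n) x (basisVec j) • u x = - ∫ x, F' n x • g x := fun n =>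
    h.complex ((csF n).toSchwartzMap (smF n)) (csF n)
  have χ1 : ∀ x : R3, Tendsto (fun n => χ (c n • x)) atTop (𝓝 1) := by
    intro x
    have h1 : Tendsto (fun n => c n • x) atTop (𝓝 (0 : R3)) := by
      simpa using hc0.smul_const x
    have h2 := (χs.continuous.tendsto (0 : R3)).comp h1
    rwa [χ.one_of_mem_closedBall (by simp [χ])] at h2
  have χb : ∀ x, |χ x| ≤ 1 := fun x => by rw [abs_of_nonneg χ.nonneg]; exact χ.le_one
  have L1 : Tendsto (fun n => ∫ x, fderiv ℝ (F' n) x (basisVec j) • u x) atTop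
      (𝓝 (∫ x, fderiv ℝ f x (basisVec j) • u x)) := by
    have hd : ∀ x, fderiv ℝ f x (basisVec j) = (∂_{basisVec j} f) x := fun x =>
      (lineDerivOp_apply_eq_fderiv _ _ _).symm
    refine tendsto_integral_of_dominated_convergence
      (fun x => ‖(∂_{basisVec j} f) x • u x‖ + M * ‖f x • u x‖) ?_ ?_ ?_ ?_
    · exact fun n => (((smF n).continuous_fderiv (by simp)).clm_apply
        continuous_const).aestronglyMeasurable.smul (Lp.aestronglyMeasurable u)
    · exact (integrable_schwartz_smul _ u).norm.add ((integrable_schwartz_smul f u).norm.const_mul M)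
    · refine fun n => .of_forall fun x => ?_
      rw [dF, add_smul, ← hd]
      refine (norm_add_le _ _).trans (add_le_add ?_ ?_)
      · rw [mul_smul, norm_smul, Complex.norm_real, Real.norm_eq_abs]
        exact mul_le_of_le_one_left (norm_nonneg _) (χb _)
      · rw [mul_smul, norm_smul, Complex.norm_real, norm_mul]
        refine mul_le_mul_of_nonneg_right ?_ (norm_nonneg _)
        calc ‖c n‖ * _ ≤ 1 * M := mul_le_mul (by rw [Real.norm_of_nonneg (cpos n).le]; exact cle n)
              (hM _) (norm_nonneg _) zero_le_one
          _ = M := one_mul M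
    · refine .of_forall fun x => ?_
      simp only [dF]
      have h1 : Tendsto (fun n => ((χ (c n • x) : ℝ) : ℂ)) atTop (𝓝 ((1 : ℝ) : ℂ)) :=
        (Complex.continuous_ofReal.tendsto _).comp (χ1 x)
      have h2 : Tendsto (fun n => ((c n * fderiv ℝ χ (c n • x) (basisVec j) : ℝ) : ℂ)) atTop
          (𝓝 ((0 : ℝ) : ℂ)) := by
        refine (Complex.continuous_ofReal.tendsto _).comp ?_
        exact hc0.zero_mul_isBoundedUnder_le ⟨M, by simpa using ⟨0, fun n _ => hM _⟩⟩
      have := ((h1.mul_const (fderiv ℝ f x (basisVec j))).add (h2.mul_const (f x))).smul_const (u x)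
      simpa using this
  have L2' : Tendsto (fun n => -∫ x, F' n x • g x) atTop (𝓝 (-∫ x, f x • g x)) := by
    refine (tendsto_integral_of_dominated_convergence (fun x => ‖f x • g x‖) ?_ ?_ ?_ ?_).neg
    · exact fun n => (smF n).continuous.aestronglyMeasurable.smul (Lp.aestronglyMeasurable g)
    · exact (integrable_schwartz_smul f g).norm
    · refine fun n => .of_forall fun x => ?_
      rw [mul_smul, norm_smul, Complex.norm_real, Real.norm_eq_abs]
      exact mul_le_of_le_one_left (norm_nonneg _) (χb _)
    · refine .of_forall fun x => ?_
      have h1 : Tendsto (fun n => ((χ (c n • x) : ℝ) : ℂ)) atTop (𝓝 ((1 : ℝ) : ℂ)) :=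
        (Complex.continuous_ofReal.tendsto _).comp (χ1 x)
      simpa using (h1.mul_const (f x)).smul_const (g x)
  simp only [key] at L1
  exact tendsto_nhds_unique L1 L2'

/-- Weak derivatives are distributional derivatives. -/
lemma hasWeakDeriv_iff_tempered (j : Fin 3) (u g : L2 F) :
    HasWeakDeriv j u g ↔ ∂_{basisVec j} (u : 𝓢'(R3, F)) = (g : 𝓢'(R3, F)) := by
  constructor
  · intro h
    ext f
    rw [TemperedDistribution.lineDerivOp_apply_apply, Lp.toTemperedDistribution_apply,
      Lp.toTemperedDistribution_apply, ← neg_neg (∫ x, f x • g x), ← h.schwartz f, ← integral_neg]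
    simp [lineDerivOp_apply_eq_fderiv]
  · intro h η hη hc
    have hs : ContDiff ℝ (⊤ : ℕ∞) (fun x => (η x : ℂ)) := Complex.ofRealCLM.contDiff.comp hη
    have hcc : HasCompactSupport (fun x => (η x : ℂ)) :=
      hc.comp_left (g := fun r : ℝ => (r : ℂ)) (by simp)
    have := DFunLike.congr_fun h (hcc.toSchwartzMap hs)
    rw [TemperedDistribution.lineDerivOp_apply_apply, Lp.toTemperedDistribution_apply,
      Lp.toTemperedDistribution_apply] at this
    have hd : ∀ x, fderiv ℝ (fun x => (η x : ℂ)) x (basisVec j)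
        = ((fderiv ℝ η x (basisVec j) : ℝ) : ℂ) := by
      intro x
      have := Complex.ofRealCLM.hasFDerivAt.comp x ((hη.differentiable (by simp)) x).hasFDerivAt
      exact congrArg (fun L => L (basisVec j)) this.fderiv
    have e1 : ∀ x, (-∂_{basisVec j} (hcc.toSchwartzMap hs)) x
        = -((fderiv ℝ η x (basisVec j) : ℝ) : ℂ) := by
      intro x
      rw [← hd]
      simp [lineDerivOp_apply_eq_fderiv]
      rfl
    have e2 : ∀ x, (hcc.toSchwartzMap hs) x = (η x : ℂ) := fun x => rfl
    simp only [e1, e2, neg_smul, integral_neg, Complex.coe_smul] at this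
    rw [← this, neg_neg]

/-- On the Fourier side the weak derivative is multiplication by `2πi ξ_j`. -/
lemma hasWeakDeriv_iff_fourier (j : Fin 3) (u g : L2 F) :
    HasWeakDeriv j u g ↔
      ∀ᵐ ξ, (𝓕 g : L2 F) ξ = (2 * Real.pi * Complex.I * (ξ j : ℂ)) • (𝓕 u : L2 F) ξ := by
  have hgr : (fun ξ : R3 => ((inner ℝ ξ (basisVec j) : ℝ) : ℂ)).HasTemperateGrowth := by fun_prop
  have hin : ∀ ξ : R3, inner ℝ ξ (basisVec j) = ξ j := fun ξ => by
    simp [basisVec, EuclideanSpace.inner_single_right]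
  have h1 : HasWeakDeriv j u g ↔ ∀ f : 𝓢(R3, ℂ),
      ∫ ξ, f ξ • ((2 * Real.pi * Complex.I * (ξ j : ℂ)) • (𝓕 u : L2 F) ξ)
        = ∫ ξ, f ξ • (𝓕 g : L2 F) ξ := by
    rw [hasWeakDeriv_iff_tempered]
    have : (∂_{basisVec j} (u : 𝓢'(R3, F)) = (g : 𝓢'(R3, F))) ↔
        𝓕 (∂_{basisVec j} (u : 𝓢'(R3, F))) = 𝓕 (g : 𝓢'(R3, F)) :=
      ⟨fun h => by rw [h], fun h => by
        have := congrArg 𝓕⁻ h; simpa [FourierPair.fourierInv_fourier_eq] using this⟩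
    rw [this, TemperedDistribution.fourier_lineDerivOp_eq, Lp.fourier_toTemperedDistribution_eq,
      Lp.fourier_toTemperedDistribution_eq]
    rw [DFunLike.ext_iff]
    refine forall_congr' fun f => ?_
    have e : ((2 * Real.pi * Complex.I) • smulLeftCLM F
        (fun ξ : R3 => ((inner ℝ ξ (basisVec j) : ℝ) : ℂ))
        ((𝓕 u : L2 F) : 𝓢'(R3, F))) f
        = ∫ ξ, f ξ • ((2 * Real.pi * Complex.I * (ξ j : ℂ)) • (𝓕 u : L2 F) ξ) := by
      change (2 * Real.pi * Complex.I) • (smulLeftCLM F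
        (fun ξ : R3 => ((inner ℝ ξ (basisVec j) : ℝ) : ℂ))
        ((𝓕 u : L2 F) : 𝓢'(R3, F)) f) = _
      rw [TemperedDistribution.smulLeftCLM_apply_apply, Lp.toTemperedDistribution_apply,
        ← integral_smul]
      refine integral_congr_ae (.of_forall fun ξ => ?_)
      beta_reduce
      rw [SchwartzMap.smulLeftCLM_apply_apply hgr]
      simp only [hin, smul_smul, smul_eq_mul]
      congr 1
      ring
    rw [e, Lp.toTemperedDistribution_apply]
  rw [h1]
  constructor
  · intro h
    have hcont : Continuous fun ξ : R3 => (2 * Real.pi * Complex.I * (ξ j : ℂ)) := by fun_prop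
    refine ae_eq_of_integral_contDiff_smul_eq
      ((Lp.memLp (𝓕 g : L2 F)).locallyIntegrable (by norm_num))
      ?_
      fun η hη hc => ?_
    · rw [← locallyIntegrableOn_univ]
      exact (((Lp.memLp (𝓕 u : L2 F)).locallyIntegrable (by norm_num)).locallyIntegrableOn _).continuousOn_smul
        isClosed_univ.isLocallyClosed hcont.continuousOn
    have hs : ContDiff ℝ (⊤ : ℕ∞) (fun x => (η x : ℂ)) := Complex.ofRealCLM.contDiff.comp hη
    have hcc : HasCompactSupport (fun x => (η x : ℂ)) :=
      hc.comp_left (g := fun r : ℝ => (r : ℂ)) (by simp)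
    have := h (hcc.toSchwartzMap hs)
    have e2 : ∀ x, (hcc.toSchwartzMap hs) x = (η x : ℂ) := fun x => rfl
    simp only [e2, Complex.coe_smul] at this
    exact this.symm
  · intro h f
    refine integral_congr_ae ?_
    filter_upwards [h] with ξ hξ
    rw [hξ]

end FourierWeak

end DiracVacuum
end

noncomputable section

namespace DiracVacuum

open SchwartzMap TemperedDistribution FourierTransform
open scoped SchwartzMap BoundedContinuousFunction ENNReal

/-! ### Fourier multipliers -/

section Multipliers

variable {F : Type} [NormedAddCommGroup F] [InnerProductSpace ℂ F] [CompleteSpace F]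

/-- Multiplication by a bounded continuous function. -/
def mulOp (m : R3 →ᵇ ℂ) : L2 F →L[ℂ] L2 F :=
  (ContinuousLinearMap.lsmul ℂ ℂ : ℂ →L[ℂ] F →L[ℂ] F).holderL volume ∞ 2 2
    ((m.memLp_top (μ := volume)).toLp m)

lemma mulOp_ae (m : R3 →ᵇ ℂ) (u : L2 F) : ∀ᵐ x, mulOp m u x = m x • u x := by
  have h1 := (ContinuousLinearMap.lsmul ℂ ℂ : ℂ →L[ℂ] F →L[ℂ] F).coeFn_holder (r := 2)
    ((m.memLp_top (μ := volume)).toLp m) u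
  filter_upwards [h1, (m.memLp_top (μ := (volume : Measure R3))).coeFn_toLp] with x hx hm
  refine hx.trans ?_
  rw [hm]
  rfl

lemma norm_mulOp_apply_le (m : R3 →ᵇ ℂ) (u : L2 F) : ‖mulOp m u‖ ≤ ‖m‖ * ‖u‖ := by
  refine Lp.norm_le_mul_norm_of_ae_le_mul ?_
  filter_upwards [mulOp_ae m u] with x hx
  rw [hx, norm_smul]
  exact mul_le_mul_of_nonneg_right (m.norm_coe_le_norm x) (norm_nonneg _)

/-- The Fourier multiplier with a bounded continuous symbol. -/
def fmul (m : R3 →ᵇ ℂ) : L2 F →L[ℂ] L2 F :=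
  ((Lp.fourierTransformₗᵢ R3 F).symm.toContinuousLinearEquiv : L2 F →L[ℂ] L2 F) ∘L mulOp m ∘L
    ((Lp.fourierTransformₗᵢ R3 F).toContinuousLinearEquiv : L2 F →L[ℂ] L2 F)

lemma fmul_apply (m : R3 →ᵇ ℂ) (u : L2 F) : fmul m u = 𝓕⁻ (mulOp m (𝓕 u)) := rfl

lemma fourier_fmul (m : R3 →ᵇ ℂ) (u : L2 F) : 𝓕 (fmul m u) = mulOp m (𝓕 u) := by
  rw [fmul_apply, FourierInvPair.fourier_fourierInv_eq]

lemma fourier_fmul_ae (m : R3 →ᵇ ℂ) (u : L2 F) :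
    ∀ᵐ ξ, (𝓕 (fmul m u) : L2 F) ξ = m ξ • (𝓕 u : L2 F) ξ := by
  rw [fourier_fmul]
  exact mulOp_ae m _

lemma fourier_injective {u v : L2 F} (h : (𝓕 u : L2 F) = 𝓕 v) : u = v :=
  (Lp.fourierTransformₗᵢ R3 F).injective h

lemma eq_fmul {m : R3 →ᵇ ℂ} {u v : L2 F}
    (h : ∀ᵐ ξ, (𝓕 v : L2 F) ξ = m ξ • (𝓕 u : L2 F) ξ) : v = fmul m u := by
  refine fourier_injective (Lp.ext ?_)
  filter_upwards [h, fourier_fmul_ae m u] with ξ h1 h2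
  rw [h1, h2]

lemma fourier_add_ae (u v : L2 F) :
    ∀ᵐ ξ, (𝓕 (u + v) : L2 F) ξ = (𝓕 u : L2 F) ξ + (𝓕 v : L2 F) ξ := by
  rw [FourierTransform.fourier_add]
  exact Lp.coeFn_add _ _

lemma fourier_smul_ae (c : ℂ) (u : L2 F) :
    ∀ᵐ ξ, (𝓕 (c • u) : L2 F) ξ = c • (𝓕 u : L2 F) ξ := by
  rw [FourierTransform.fourier_smul]
  exact Lp.coeFn_smul _ _

lemma fmul_mul (m n : R3 →ᵇ ℂ) : (fmul (m * n) : L2 F →L[ℂ] L2 F) = fmul m * fmul n := by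
  ext1 u
  refine (eq_fmul ?_).symm
  filter_upwards [fourier_fmul_ae m (fmul n u), fourier_fmul_ae n u] with ξ h1 h2
  rw [mul_apply_eq_comp, h1, h2, smul_smul]
  rfl

lemma fmul_add (m n : R3 →ᵇ ℂ) : (fmul (m + n) : L2 F →L[ℂ] L2 F) = fmul m + fmul n := by
  ext1 u
  refine (eq_fmul ?_).symm
  filter_upwards [fourier_add_ae (fmul m u) (fmul n u), fourier_fmul_ae m u,
    fourier_fmul_ae n u] with ξ h1 h2 h3
  rw [add_apply, h1, h2, h3, ← add_smul]
  rfl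

lemma fmul_smul (c : ℂ) (m : R3 →ᵇ ℂ) : (fmul (c • m) : L2 F →L[ℂ] L2 F) = c • fmul m := by
  ext1 u
  refine (eq_fmul ?_).symm
  filter_upwards [fourier_smul_ae c (fmul m u), fourier_fmul_ae m u] with ξ h1 h2
  rw [smul_apply, h1, h2, smul_smul]
  rfl

lemma norm_fmul_le (m : R3 →ᵇ ℂ) : ‖(fmul m : L2 F →L[ℂ] L2 F)‖ ≤ ‖m‖ := by
  refine ContinuousLinearMap.opNorm_le_bound _ (norm_nonneg _) fun u => ?_
  rw [← Lp.norm_fourier_eq, fourier_fmul]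
  exact (norm_mulOp_apply_le m _).trans_eq (by rw [Lp.norm_fourier_eq])

lemma inner_fmul_left (m : R3 →ᵇ ℂ) (u v : L2 F) : ⟪fmul m u, v⟫_ℂ = ⟪u, fmul (star m) v⟫_ℂ := by
  rw [← Lp.inner_fourier_eq, ← Lp.inner_fourier_eq u, fourier_fmul, fourier_fmul, L2.inner_def,
    L2.inner_def]
  refine integral_congr_ae ?_
  filter_upwards [mulOp_ae m (𝓕 u), mulOp_ae (star m) (𝓕 v)] with ξ h1 h2
  rw [h1, h2, inner_smul_left, inner_smul_right]
  rfl

/-- Multiplication of the symbol by `2πi ξ_j` gives the weak derivative. -/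
lemma hasWeakDeriv_fmul {j : Fin 3} {m n : R3 →ᵇ ℂ}
    (h : ∀ ξ, n ξ = 2 * Real.pi * Complex.I * (ξ j : ℂ) * m ξ) (u : L2 F) :
    HasWeakDeriv j (fmul m u) (fmul n u) := by
  rw [hasWeakDeriv_iff_fourier]
  filter_upwards [fourier_fmul_ae m u, fourier_fmul_ae n u] with ξ h1 h2
  rw [h1, h2, smul_smul, h]

/-- For `h ∈ L¹ ∩ L²` the `L²` inverse Fourier transform is given by the Fourier integral. -/
lemma fourierInv_ae_eq_integral (h : L2 F) (hi : Integrable h) :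
    ∀ᵐ x, (𝓕⁻ h : L2 F) x = 𝓕⁻ (h : R3 → F) x := by
  have hc : Continuous (𝓕⁻ (h : R3 → F)) := by
    rw [Real.fourierInv_eq_fourier_comp_neg]
    exact VectorFourier.fourierIntegral_continuous Real.continuous_fourierChar
      (innerSL ℝ).continuous₂ hi.comp_neg
  refine ae_eq_of_integral_contDiff_smul_eq
    ((Lp.memLp (𝓕⁻ h : L2 F)).locallyIntegrable (by norm_num))
    hc.locallyIntegrable fun η hη hcs => ?_
  have hs : ContDiff ℝ (⊤ : ℕ∞) (fun x => (η x : ℂ)) := Complex.ofRealCLM.contDiff.comp hη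
  have hcc : HasCompactSupport (fun x => (η x : ℂ)) :=
    hcs.comp_left (g := fun r : ℝ => (r : ℂ)) (by simp)
  let f : 𝓢(R3, ℂ) := hcc.toSchwartzMap hs
  have e2 : ∀ x, f x = (η x : ℂ) := fun x => rfl
  have h1 := DFunLike.congr_fun (Lp.fourierInv_toTemperedDistribution_eq h) f
  rw [TemperedDistribution.fourierInv_apply, Lp.toTemperedDistribution_apply,
    Lp.toTemperedDistribution_apply] at h1
  -- Self-duality of the Fourier integral. The bilinear form is `-innerₗ R3`, whose sign turns the
  -- forward integral into the inverse one.
  have h2 : ∫ x, (𝓕⁻ f : 𝓢(R3, ℂ)) x • h x = ∫ x, f x • 𝓕⁻ (h : R3 → F) x := by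
    have := VectorFourier.integral_fourierIntegral_smul_eq_flip (L := -innerₗ R3)
      (μ := volume) (ν := volume) Real.continuous_fourierChar
      (continuous_inner (𝕜 := ℝ) (E := R3)).neg (f.integrable (μ := volume)) hi
    have e3 : ∀ x, (𝓕⁻ f : 𝓢(R3, ℂ)) x = VectorFourier.fourierIntegral Real.fourierChar volume
        (-innerₗ R3) f x := fun x => by
      rw [SchwartzMap.fourierInv_coe]
      rfl
    have e4 : ∀ x, 𝓕⁻ (h : R3 → F) x = VectorFourier.fourierIntegral Real.fourierChar volume
        (-innerₗ R3).flip h x := fun x => by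
      simp [Real.fourierInv_eq, VectorFourier.fourierIntegral, real_inner_comm]
    simp only [e3, e4]
    exact this
  rw [h2] at h1
  simp only [e2, Complex.coe_smul] at h1
  exact h1.symm

end Multipliers
end DiracVacuum
end

noncomputable section

namespace DiracVacuum

open FourierTransform
open scoped BoundedContinuousFunction ENNReal

/-! ### Point evaluation of Fourier multipliers with square integrable symbol -/

section Evaluation

/-- `ℳ(ℂ⁴)` as bounded operators. -/
abbrev M4 : Type := C4 →L[ℂ] C4

lemma integrable_symbol_smul (m : L2 ℂ) (w : L2 C4) : Integrable fun ξ => m ξ • w ξ :=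
  memLp_one_iff_integrable.1 ((Lp.memLp w).smul (Lp.memLp m))

/-- The value `∫ e^{2πi⟨x,ξ⟩} m(ξ) û(ξ) dξ` at `x` of the Fourier multiplier `m` applied to `u`. -/
def evFun (m : L2 ℂ) (u : L2 C4) (x : R3) : C4 :=
  𝓕⁻ (fun ξ => m ξ • (𝓕 u : L2 C4) ξ) x

lemma continuous_evFun (m : L2 ℂ) (u : L2 C4) : Continuous (evFun m u) := by
  unfold evFun
  rw [Real.fourierInv_eq_fourier_comp_neg]
  exact VectorFourier.fourierIntegral_continuous Real.continuous_fourierChar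
    (innerSL ℝ).continuous₂ (integrable_symbol_smul m _).comp_neg

/-- The representing vector of the `k`-th component of the point evaluation at `x`. -/
def evVecFun (m : L2 ℂ) (x : R3) (k : Fin 4) (ξ : R3) : C4 :=
  (starRingEnd ℂ) ((Real.fourierChar (inner ℝ ξ x) : ℂ) * m ξ) • EuclideanSpace.single k (1 : ℂ)

lemma norm_evVecFun (m : L2 ℂ) (x : R3) (k : Fin 4) (ξ : R3) : ‖evVecFun m x k ξ‖ = ‖m ξ‖ := by
  rw [evVecFun, norm_smul, RCLike.norm_conj, norm_mul, Circle.norm_coe]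
  simp

lemma memLp_evVecFun (m : L2 ℂ) (x : R3) (k : Fin 4) : MemLp (evVecFun m x k) 2 volume := by
  refine (Lp.memLp m).congr_norm ?_ (.of_forall fun ξ => (norm_evVecFun m x k ξ).symm)
  have h1 : Continuous fun ξ : R3 => (Real.fourierChar (inner ℝ ξ x) : ℂ) :=
    continuous_subtype_val.comp (Real.continuous_fourierChar.comp (by fun_prop))
  have h2 := h1.aestronglyMeasurable.mul (Lp.aestronglyMeasurable m)
  exact (Complex.continuous_conj.comp_aestronglyMeasurable h2).smul aestronglyMeasurable_const

lemma norm_evVec (m : L2 ℂ) (x : R3) (k : Fin 4) : ‖(memLp_evVecFun m x k).toLp‖ = ‖m‖ := by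
  rw [Lp.norm_toLp, Lp.norm_def, eLpNorm_congr_norm_ae (g := m)]
  exact .of_forall (norm_evVecFun m x k)

lemma integrable_char_smul (m : L2 ℂ) (u : L2 C4) (x : R3) :
    Integrable fun ξ : R3 => (Real.fourierChar (inner ℝ ξ x)) • m ξ • (𝓕 u : L2 C4) ξ := by
  have h0 := integrable_symbol_smul m (𝓕 u)
  rw [← integrable_norm_iff]
  · simpa using h0.norm
  · exact (Real.continuous_fourierChar.comp (by fun_prop)).aestronglyMeasurable.smul h0.1

/-- Each component of the point evaluation is an inner product with a vector of norm ‖m‖, whatever x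
is (`norm_evVec`). Bessel's inequality thus applies with a bound uniform in x. -/
lemma evFun_apply (m : L2 ℂ) (u : L2 C4) (x : R3) (k : Fin 4) :
    evFun m u x k = ⟪(memLp_evVecFun m x k).toLp, (𝓕 u : L2 C4)⟫_ℂ := by
  have h1 := Real.fourierInv_eq (fun ξ => m ξ • (𝓕 u : L2 C4) ξ) x
  have hi := integrable_char_smul m u x
  have h2 := (EuclideanSpace.proj k : C4 →L[ℂ] ℂ).integral_comp_comm hi
  rw [evFun, h1]
  refine h2.symm.trans ?_
  rw [L2.inner_def]
  refine integral_congr_ae ?_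
  filter_upwards [(memLp_evVecFun m x k).coeFn_toLp] with ξ hξ
  rw [hξ, evVecFun, inner_smul_left, EuclideanSpace.inner_single_left, Complex.conj_conj]
  simp [Circle.smul_def, mul_assoc]

/-- Bessel's inequality for each of the four spinor components, applied to the orthonormal family of
Fourier transforms; hence the factor 4. -/
lemma sum_sq_norm_evFun_le (m : L2 ℂ) (x : R3) {ι : Type} {e : ι → L2 C4}
    (he : Orthonormal ℂ e) (s : Finset ι) : ∑ i ∈ s, ‖evFun m (e i) x‖ ^ 2 ≤ 4 * ‖m‖ ^ 2 := by
  have he' : Orthonormal ℂ fun i => (𝓕 (e i) : L2 C4) :=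
    he.comp_linearIsometry (Lp.fourierTransformₗᵢ R3 C4).toLinearIsometry
  simp only [EuclideanSpace.norm_sq_eq, evFun_apply]
  rw [Finset.sum_comm]
  calc ∑ k : Fin 4, ∑ i ∈ s, ‖⟪(memLp_evVecFun m x k).toLp, (𝓕 (e i) : L2 C4)⟫_ℂ‖ ^ 2
      ≤ ∑ k : Fin 4, ‖m‖ ^ 2 := by
        refine Finset.sum_le_sum fun k _ => ?_
        rw [← norm_evVec m x k]
        refine le_trans (Finset.sum_le_sum fun i _ => ?_)
          (he'.sum_inner_products_le (s := s) (memLp_evVecFun m x k).toLp)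
        rw [norm_inner_symm]
    _ = 4 * ‖m‖ ^ 2 := by simp

lemma norm_evFun_le (m : L2 ℂ) (u : L2 C4) (x : R3) : ‖evFun m u x‖ ≤ 2 * ‖m‖ * ‖u‖ := by
  refine le_of_sq_le_sq ?_ (by positivity)
  rw [EuclideanSpace.norm_sq_eq]
  calc ∑ k : Fin 4, ‖evFun m u x k‖ ^ 2 ≤ ∑ k : Fin 4, (‖m‖ * ‖u‖) ^ 2 := by
        refine Finset.sum_le_sum fun k _ => pow_le_pow_left₀ (norm_nonneg _) ?_ 2
        rw [evFun_apply]
        refine (norm_inner_le_norm _ _).trans_eq ?_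
        rw [norm_evVec, Lp.norm_fourier_eq]
    _ = (2 * ‖m‖ * ‖u‖) ^ 2 := by simp; ring

lemma evFun_eq_integral (m : L2 ℂ) (u : L2 C4) (x : R3) :
    evFun m u x = ∫ ξ, (Real.fourierChar (inner ℝ ξ x)) • m ξ • (𝓕 u : L2 C4) ξ :=
  Real.fourierInv_eq _ x

lemma evFun_add_left (m n : L2 ℂ) (u : L2 C4) (x : R3) :
    evFun (m + n) u x = evFun m u x + evFun n u x := by
  simp only [evFun_eq_integral]
  rw [← integral_add (integrable_char_smul m u x) (integrable_char_smul n u x)]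
  refine integral_congr_ae ?_
  filter_upwards [Lp.coeFn_add m n] with ξ h
  rw [h, Pi.add_apply, add_smul, smul_add]

lemma evFun_smul_left (c : ℂ) (m : L2 ℂ) (u : L2 C4) (x : R3) :
    evFun (c • m) u x = c • evFun m u x := by
  simp only [evFun_eq_integral]
  rw [← integral_smul]
  refine integral_congr_ae ?_
  filter_upwards [Lp.coeFn_smul c m] with ξ h
  rw [h, Pi.smul_apply, smul_assoc, smul_comm]

lemma evFun_add_right (m : L2 ℂ) (u v : L2 C4) (x : R3) :
    evFun m (u + v) x = evFun m u x + evFun m v x := by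
  ext k
  rw [PiLp.add_apply]
  simp only [evFun_apply]
  rw [FourierTransform.fourier_add, inner_add_right]

lemma evFun_smul_right (c : ℂ) (m : L2 ℂ) (u : L2 C4) (x : R3) :
    evFun m (c • u) x = c • evFun m u x := by
  ext k
  rw [PiLp.smul_apply]
  simp only [evFun_apply]
  rw [FourierTransform.fourier_smul, inner_smul_right, smul_eq_mul]

lemma memLp_top_evFun (m : L2 ℂ) (u : L2 C4) : MemLp (evFun m u) ∞ volume :=
  memLp_top_of_bound (continuous_evFun m u).aestronglyMeasurable _
    (.of_forall (norm_evFun_le m u))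

/-- Point evaluation as a bilinear map into `L^∞`. -/
def evL : L2 ℂ →L[ℂ] L2 C4 →L[ℂ] Lp C4 ∞ (volume : Measure R3) :=
  LinearMap.mkContinuous₂ (LinearMap.mk₂ ℂ (fun m u => (memLp_top_evFun m u).toLp)
    (fun m n u => by
      rw [← MemLp.toLp_add]; congr 1; ext1 x; exact evFun_add_left m n u x)
    (fun c m u => by
      rw [← MemLp.toLp_const_smul]; congr 1; ext1 x; exact evFun_smul_left c m u x)
    (fun m u v => by
      rw [← MemLp.toLp_add]; congr 1; ext1 x; exact evFun_add_right m u v x)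
    (fun c m u => by
      rw [← MemLp.toLp_const_smul]; congr 1; ext1 x; exact evFun_smul_right c m u x)) 2
    (fun m u => by
      rw [LinearMap.mk₂_apply, Lp.norm_toLp, eLpNorm_exponent_top]
      refine ENNReal.toReal_le_of_le_ofReal (by positivity) ?_
      exact eLpNormEssSup_le_of_ae_bound (.of_forall (norm_evFun_le m u)))

lemma evL_ae (m : L2 ℂ) (u : L2 C4) : ∀ᵐ x, evL m u x = evFun m u x :=
  (memLp_top_evFun m u).coeFn_toLp

/-- The operator `W(x) m(-i∇)` for `W ∈ L²` and `m ∈ L²`. -/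
def potOp : L2 M4 →L[ℂ] L2 ℂ →L[ℂ] (L2 C4 →L[ℂ] L2 C4) :=
  (ContinuousLinearMap.compL ℂ (L2 C4) (Lp C4 ∞ (volume : Measure R3)) (L2 C4)).bilinearComp
    ((ContinuousLinearMap.id ℂ M4).holderL volume 2 ∞ 2) evL

lemma potOp_ae (W : L2 M4) (m : L2 ℂ) (u : L2 C4) :
    ∀ᵐ x, potOp W m u x = W x (evFun m u x) := by
  have h := (ContinuousLinearMap.id ℂ M4).coeFn_holder (r := 2) W (evL m u)
  filter_upwards [h, evL_ae m u] with x h1 h2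
  refine h1.trans ?_
  rw [h2]
  rfl

/-- The point evaluation of the multiplier is the multiplier. -/
lemma fmul_ae_evFun (m : R3 →ᵇ ℂ) (hm : MemLp m 2 volume) (u : L2 C4) :
    ∀ᵐ x, fmul m u x = evFun hm.toLp u x := by
  have h0 : ∀ᵐ ξ, mulOp m (𝓕 u : L2 C4) ξ = (hm.toLp : L2 ℂ) ξ • (𝓕 u : L2 C4) ξ := by
    filter_upwards [mulOp_ae m (𝓕 u : L2 C4), hm.coeFn_toLp] with ξ h1 h2
    rw [h1, h2]
  have hi : Integrable (mulOp m (𝓕 u : L2 C4)) :=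
    (integrable_symbol_smul hm.toLp (𝓕 u)).congr (h0.mono fun ξ h => h.symm)
  filter_upwards [fourierInv_ae_eq_integral _ hi] with x hx
  rw [fmul_apply, hx, evFun_eq_integral, Real.fourierInv_eq]
  refine integral_congr_ae ?_
  filter_upwards [h0] with ξ h
  rw [h]

/-- The Kato–Seiler–Simon estimate for the Hilbert–Schmidt norm. -/
lemma sum_sq_norm_potOp_le (W : L2 M4) (m : L2 ℂ) {ι : Type} {e : ι → L2 C4}
    (he : Orthonormal ℂ e) (s : Finset ι) :
    ∑ i ∈ s, ‖potOp W m (e i)‖ ^ 2 ≤ (2 * ‖W‖ * ‖m‖) ^ 2 := by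
  have hsq : ∀ {G : Type} [NormedAddCommGroup G] (f : L2 G), ‖f‖ ^ 2 = ∫ x, ‖f x‖ ^ 2 := by
    intro G _ f
    rw [Lp.norm_def, (Lp.memLp f).eLpNorm_eq_integral_rpow_norm (by norm_num) (by norm_num)]
    rw [ENNReal.toReal_ofReal (by positivity), ← Real.rpow_natCast, ← Real.rpow_mul (by positivity)]
    simp
  have hint : ∀ {G : Type} [NormedAddCommGroup G] (f : L2 G), Integrable fun x => ‖f x‖ ^ 2 :=
    fun f => (memLp_two_iff_integrable_sq_norm (Lp.aestronglyMeasurable f)).1 (Lp.memLp f)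
  calc ∑ i ∈ s, ‖potOp W m (e i)‖ ^ 2 = ∫ x, ∑ i ∈ s, ‖potOp W m (e i) x‖ ^ 2 := by
        rw [integral_finsetSum _ fun i _ => hint _]
        exact Finset.sum_congr rfl fun i _ => hsq _
    -- At fixed x the norm of W x comes out and the sum over the orthonormal family is controlled by
    -- Bessel; only then is the result integrated in x.
    _ ≤ ∫ x, 4 * ‖m‖ ^ 2 * ‖W x‖ ^ 2 := by
        refine integral_mono_ae (integrable_finsetSum _ fun i _ => hint _)
          ((hint W).const_mul _) ?_
        have : ∀ᵐ x, ∀ i ∈ s, potOp W m (e i) x = W x (evFun m (e i) x) :=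
          (ae_ball_iff s.countable_toSet).2 fun i _ => potOp_ae W m (e i)
        filter_upwards [this] with x hx
        calc ∑ i ∈ s, ‖potOp W m (e i) x‖ ^ 2
            ≤ ∑ i ∈ s, ‖W x‖ ^ 2 * ‖evFun m (e i) x‖ ^ 2 := by
              refine Finset.sum_le_sum fun i hi => ?_
              rw [hx i hi, ← mul_pow]
              exact pow_le_pow_left₀ (norm_nonneg _) ((W x).le_opNorm _) 2
          _ ≤ 4 * ‖m‖ ^ 2 * ‖W x‖ ^ 2 := by
              rw [← Finset.mul_sum, mul_comm]
              exact mul_le_mul_of_nonneg_right (sum_sq_norm_evFun_le m x he s) (by positivity)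
    _ = (2 * ‖W‖ * ‖m‖) ^ 2 := by
        rw [integral_const_mul, ← hsq W]; ring

end Evaluation
end DiracVacuum
end

noncomputable section

namespace DiracVacuum

/-! ### Hilbert–Schmidt and trace norm bounds -/

section TraceNorm

variable {H : Type} [NormedAddCommGroup H] [InnerProductSpace ℂ H] [CompleteSpace H]

lemma _root_.HilbertBasis.hasSum_sq_norm_inner {ι : Type} (b : HilbertBasis ι ℂ H) (x : H) :
    HasSum (fun i => ‖⟪b i, x⟫_ℂ‖ ^ 2) (‖x‖ ^ 2) := by
  have h := (b.hasSum_inner_mul_inner x x).mapL Complex.reCLM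
  have e1 : Complex.reCLM ⟪x, x⟫_ℂ = ‖x‖ ^ 2 := inner_self_eq_norm_sq (𝕜 := ℂ) x
  rw [e1] at h
  refine h.congr_fun fun i => ?_
  rw [← inner_conj_symm x (b i)]
  rw [Complex.reCLM_apply, mul_comm, Complex.mul_conj, Complex.ofReal_re, Complex.normSq_eq_norm_sq]

/-- The Hilbert–Schmidt norm of `X` is at most `c`. -/
def HSBound (X : H →L[ℂ] H) (c : ℝ) : Prop :=
  0 ≤ c ∧ ∀ (ι : Type) (b : HilbertBasis ι ℂ H) (s : Finset ι), ∑ i ∈ s, ‖X (b i)‖ ^ 2 ≤ c ^ 2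

/-- Expand ‖X* b_i‖² by Parseval in the same basis and exchange the sums: by Bessel the inner sum
over i is at most ‖X b_j‖². -/
lemma HSBound.adjoint {X : H →L[ℂ] H} {c : ℝ} (h : HSBound X c) : HSBound (ContinuousLinearMap.adjoint X) c := by
  refine ⟨h.1, fun ι b s => ?_⟩
  have h1 : HasSum (fun j => ∑ i ∈ s, ‖⟪b j, ContinuousLinearMap.adjoint X (b i)⟫_ℂ‖ ^ 2)
      (∑ i ∈ s, ‖ContinuousLinearMap.adjoint X (b i)‖ ^ 2) :=
    hasSum_sum fun i _ => b.hasSum_sq_norm_inner _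
  refine hasSum_le_of_sum_le h1 fun t => le_trans (Finset.sum_le_sum fun j _ => ?_) (h.2 ι b t)
  refine le_trans (Finset.sum_le_sum fun i _ => ?_)
    (b.orthonormal.sum_inner_products_le (s := s) (X (b j)))
  rw [ContinuousLinearMap.adjoint_inner_right, norm_inner_symm]

lemma HSBound.mul_left {X : H →L[ℂ] H} {c : ℝ} (h : HSBound X c) (V : H →L[ℂ] H) :
    HSBound (V * X) (‖V‖ * c) := by
  refine ⟨mul_nonneg (norm_nonneg _) h.1, fun ι b s => ?_⟩
  calc ∑ i ∈ s, ‖(V * X) (b i)‖ ^ 2 ≤ ∑ i ∈ s, ‖V‖ ^ 2 * ‖X (b i)‖ ^ 2 := by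
        refine Finset.sum_le_sum fun i _ => ?_
        rw [← mul_pow]
        exact pow_le_pow_left₀ (norm_nonneg _) (V.le_opNorm _) 2
    _ ≤ (‖V‖ * c) ^ 2 := by
        rw [← Finset.mul_sum, mul_pow]
        exact mul_le_mul_of_nonneg_left (h.2 ι b s) (by positivity)

lemma HSBound.mul_right {X : H →L[ℂ] H} {c : ℝ} (h : HSBound X c) (V : H →L[ℂ] H) :
    HSBound (X * V) (c * ‖V‖) := by
  have h1 := (h.adjoint.mul_left (star V)).adjoint
  have h2 : ContinuousLinearMap.adjoint (star V * ContinuousLinearMap.adjoint X) = X * V := by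
    change star (star V * star X) = X * V
    simp
  rw [h2, norm_star, mul_comm] at h1
  exact h1

/-- The trace norm of `K` is at most `c`. -/
def TrBound (K : H →L[ℂ] H) (c : ℝ) : Prop :=
  ∀ (ι : Type) (b : HilbertBasis ι ℂ H) (s : Finset ι) (V V' : H →L[ℂ] H), ‖V‖ ≤ 1 → ‖V'‖ ≤ 1 →
    ∑ i ∈ s, ‖⟪b i, V (K (V' (b i)))⟫_ℂ‖ ≤ c

/-- Cauchy–Schwarz, after V X has been moved to the other side as an adjoint. The contractions V and
V' in `TrBound` are absorbed by the Hilbert–Schmidt factors. They make the bound stable under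
multiplication and allow `TrBound.isTraceClass` to insert an approximate polar factor. -/
lemma HSBound.mul {X Y : H →L[ℂ] H} {c d : ℝ} (hX : HSBound X c) (hY : HSBound Y d) :
    TrBound (X * Y) (c * d) := by
  intro ι b s V V' hV hV'
  have h1 := (hX.mul_left V).adjoint.2 ι b s
  have h2 := (hY.mul_right V').2 ι b s
  have e1 : (‖V‖ * c) ^ 2 ≤ c ^ 2 := pow_le_pow_left₀ (mul_nonneg (norm_nonneg _) hX.1)
    (mul_le_of_le_one_left hX.1 hV) 2
  have e2 : (d * ‖V'‖) ^ 2 ≤ d ^ 2 := pow_le_pow_left₀ (mul_nonneg hY.1 (norm_nonneg _))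
    (mul_le_of_le_one_right hY.1 hV') 2
  calc ∑ i ∈ s, ‖⟪b i, V ((X * Y) (V' (b i)))⟫_ℂ‖
      ≤ ∑ i ∈ s, ‖ContinuousLinearMap.adjoint (V * X) (b i)‖ * ‖(Y * V') (b i)‖ := by
        refine Finset.sum_le_sum fun i _ => ?_
        have : ⟪b i, V ((X * Y) (V' (b i)))⟫_ℂ
            = ⟪ContinuousLinearMap.adjoint (V * X) (b i), (Y * V') (b i)⟫_ℂ := by
          rw [ContinuousLinearMap.adjoint_inner_left]; rfl
        rw [this]
        exact norm_inner_le_norm _ _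
    _ ≤ √(∑ i ∈ s, ‖ContinuousLinearMap.adjoint (V * X) (b i)‖ ^ 2)
          * √(∑ i ∈ s, ‖(Y * V') (b i)‖ ^ 2) := Real.sum_mul_le_sqrt_mul_sqrt _ _ _
    _ ≤ c * d := by
        refine mul_le_mul ?_ ?_ (Real.sqrt_nonneg _) hX.1
        · exact Real.sqrt_le_iff.2 ⟨hX.1, h1.trans e1⟩
        · exact Real.sqrt_le_iff.2 ⟨hY.1, h2.trans e2⟩

lemma TrBound.mono {K : H →L[ℂ] H} {c d : ℝ} (h : TrBound K c) (hcd : c ≤ d) : TrBound K d :=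
  fun ι b s V V' hV hV' => (h ι b s V V' hV hV').trans hcd

lemma TrBound.zero : TrBound (0 : H →L[ℂ] H) 0 := fun ι b s V V' _ _ => by simp

lemma TrBound.add {K L : H →L[ℂ] H} {c d : ℝ} (hK : TrBound K c) (hL : TrBound L d) :
    TrBound (K + L) (c + d) := by
  intro ι b s V V' hV hV'
  refine le_trans ?_ (add_le_add (hK ι b s V V' hV hV') (hL ι b s V V' hV hV'))
  rw [← Finset.sum_add_distrib]
  refine Finset.sum_le_sum fun i _ => ?_
  rw [add_apply, map_add, inner_add_right]
  exact norm_add_le _ _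

lemma TrBound.smul {K : H →L[ℂ] H} {c : ℝ} (hK : TrBound K c) (z : ℂ) :
    TrBound (z • K) (‖z‖ * c) := by
  intro ι b s V V' hV hV'
  refine le_trans (le_of_eq ?_) (mul_le_mul_of_nonneg_left (hK ι b s V V' hV hV') (norm_nonneg z))
  rw [Finset.mul_sum]
  refine Finset.sum_congr rfl fun i _ => ?_
  rw [smul_apply, map_smul, inner_smul_right, norm_mul]

lemma TrBound.mul_left {K : H →L[ℂ] H} {c : ℝ} (hK : TrBound K c) (B : H →L[ℂ] H) :
    TrBound (B * K) (‖B‖ * c) := by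
  rcases eq_or_ne B 0 with rfl | hB
  · simpa using TrBound.zero
  have hB' : ‖B‖ ≠ 0 := norm_ne_zero_iff.2 hB
  have key : TrBound (((‖B‖⁻¹ : ℝ) : ℂ) • (B * K)) c := by
    intro ι b s V V' hV hV'
    refine hK ι b s (V * (((‖B‖⁻¹ : ℝ) : ℂ) • B)) V' ?_ hV'
    refine (norm_mul_le _ _).trans (mul_le_one₀ hV (norm_nonneg _) ?_)
    rw [norm_smul, Complex.norm_real, norm_inv, norm_norm, inv_mul_cancel₀ hB']
  have := key.smul (‖B‖ : ℂ)
  rwa [smul_smul, ← Complex.ofReal_mul, mul_inv_cancel₀ hB', Complex.ofReal_one, one_smul,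
    Complex.norm_real, norm_norm] at this

lemma TrBound.mul_right {K : H →L[ℂ] H} {c : ℝ} (hK : TrBound K c) (B : H →L[ℂ] H) :
    TrBound (K * B) (c * ‖B‖) := by
  rcases eq_or_ne B 0 with rfl | hB
  · simpa using TrBound.zero
  have hB' : ‖B‖ ≠ 0 := norm_ne_zero_iff.2 hB
  have key : TrBound (((‖B‖⁻¹ : ℝ) : ℂ) • (K * B)) c := by
    intro ι b s V V' hV hV'
    have := hK ι b s V ((((‖B‖⁻¹ : ℝ) : ℂ) • B) * V') hV ?_
    · simpa using this
    refine (norm_mul_le _ _).trans (mul_le_one₀ ?_ (norm_nonneg _) hV')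
    rw [norm_smul, Complex.norm_real, norm_inv, norm_norm, inv_mul_cancel₀ hB']
  have := key.smul (‖B‖ : ℂ)
  rwa [smul_smul, ← Complex.ofReal_mul, mul_inv_cancel₀ hB', Complex.ofReal_one, one_smul,
    Complex.norm_real, norm_norm, mul_comm] at this

/-- A Bochner integral in operator norm commutes with each bounded functional K ↦ ⟨b_i, V K V' b_i⟩,
so the triangle inequality carries trace bounds through the integral. Convergence in trace norm is
not needed. -/
lemma TrBound.integral {X : Type} [MeasurableSpace X] {μ : Measure X} {G : X → H →L[ℂ] H}
    (hG : Integrable G μ) {g : X → ℝ} (hg : Integrable g μ) (h : ∀ᵐ ω ∂μ, TrBound (G ω) (g ω)) :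
    TrBound (∫ ω, G ω ∂μ) (∫ ω, g ω ∂μ) := by
  intro ι b s V V' hV hV'
  let ℓ : ι → (H →L[ℂ] H) →L[ℂ] ℂ := fun i =>
    innerSL ℂ (b i) ∘L V ∘L ContinuousLinearMap.apply ℂ H (V' (b i))
  have e : ∀ i K, ⟪b i, V (K (V' (b i)))⟫_ℂ = ℓ i K := fun i K => rfl
  simp only [e]
  calc ∑ i ∈ s, ‖ℓ i (∫ ω, G ω ∂μ)‖ ≤ ∑ i ∈ s, ∫ ω, ‖ℓ i (G ω)‖ ∂μ := by
        refine Finset.sum_le_sum fun i _ => ?_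
        rw [← (ℓ i).integral_comp_comm hG]
        exact norm_integral_le_integral_norm _
    _ = ∫ ω, ∑ i ∈ s, ‖ℓ i (G ω)‖ ∂μ :=
        (integral_finsetSum _ fun i _ => ((ℓ i).integrable_comp hG).norm).symm
    _ ≤ ∫ ω, g ω ∂μ := by
        refine integral_mono_ae
          (integrable_finsetSum _ fun i _ => ((ℓ i).integrable_comp hG).norm) hg ?_
        filter_upwards [h] with ω hω
        exact hω ι b s V V' hV hV'

lemma TrBound.summable_norm {K : H →L[ℂ] H} {c : ℝ} (h : TrBound K c) :
    Summable fun i => ‖⟪stdBasis H i, K (stdBasis H i)⟫_ℂ‖ :=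
  summable_of_sum_le (c := c) (fun _ => norm_nonneg _)
    fun s => h _ (stdBasis H) s 1 1 ContinuousLinearMap.norm_id_le ContinuousLinearMap.norm_id_le

lemma TrBound.norm_trace_le {K : H →L[ℂ] H} {c : ℝ} (h : TrBound K c) : ‖trace K‖ ≤ c := by
  refine (norm_tsum_le_tsum_norm h.summable_norm).trans ?_
  exact h.summable_norm.tsum_le_of_sum_le
    fun s => h _ (stdBasis H) s 1 1 ContinuousLinearMap.norm_id_le ContinuousLinearMap.norm_id_le

lemma TrBound.trace_add {K L : H →L[ℂ] H} {c d : ℝ} (hK : TrBound K c) (hL : TrBound L d) :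
    trace (K + L) = trace K + trace L := by
  rw [trace, trace, trace, ← hK.summable_norm.of_norm.tsum_add hL.summable_norm.of_norm]
  simp

lemma trace_smul (K : H →L[ℂ] H) (z : ℂ) : trace (z • K) = z * trace K := by
  rw [trace, trace, ← tsum_mul_left]
  simp

lemma TrBound.trace_im_eq_zero {K : H →L[ℂ] H} {c : ℝ} (hK : TrBound K c) (hs : IsSelfAdjoint K) :
    (trace K).im = 0 := by
  rw [trace, Complex.im_tsum hK.summable_norm.of_norm]
  refine (tsum_congr fun i => ?_).trans tsum_zero
  rw [← Complex.conj_eq_iff_im, inner_conj_symm]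
  exact ((ContinuousLinearMap.isSelfAdjoint_iff_isSymmetric.1 hs) _ _)

/-- The resolvent `S = (a + δ)⁻¹` of a nonnegative element `a` regularises its inverse. -/
lemma exists_regularized_inverse (a : H →L[ℂ] H) (ha : 0 ≤ a) {δ : ℝ} (hδ : 0 < δ) :
    ∃ S : H →L[ℂ] H, star S = S ∧ ‖S * (a * a) * S‖ ≤ 1 ∧ ‖a - S * (a * a)‖ ≤ δ := by
  have hsa : IsSelfAdjoint a := ha.isSelfAdjoint
  have hspec : ∀ x ∈ spectrum ℝ a, 0 ≤ x := fun x hx => spectrum_nonneg_of_nonneg ha hx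
  have c1 : ContinuousOn (fun x : ℝ => (x + δ)⁻¹) (spectrum ℝ a) :=
    ContinuousOn.inv₀ (by fun_prop) fun x hx => by have := hspec x hx; positivity
  have c2 : ContinuousOn (fun x : ℝ => x) (spectrum ℝ a) := continuousOn_id
  have c3 : ContinuousOn (fun x : ℝ => x * x) (spectrum ℝ a) := c2.mul c2
  have c4 : ContinuousOn (fun x : ℝ => (x + δ)⁻¹ * (x * x)) (spectrum ℝ a) := c1.mul c3
  have c5 : ContinuousOn (fun x : ℝ => (x + δ)⁻¹ * (x * x) * (x + δ)⁻¹) (spectrum ℝ a) := c4.mul c1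
  have hid : cfc (fun x : ℝ => x) a = a := cfc_id' ℝ a
  have haa : cfc (fun x : ℝ => x * x) a = a * a := by
    rw [cfc_mul (fun x : ℝ => x) (fun x => x) a c2 c2, hid]
  have h4 : cfc (fun x : ℝ => (x + δ)⁻¹ * (x * x)) a = cfc (fun x : ℝ => (x + δ)⁻¹) a * (a * a) := by
    rw [cfc_mul (fun x : ℝ => (x + δ)⁻¹) (fun x => x * x) a c1 c3, haa]
  refine ⟨cfc (fun x : ℝ => (x + δ)⁻¹) a, (cfc_predicate (p := IsSelfAdjoint) _ a), ?_, ?_⟩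
  · rw [← h4, ← cfc_mul (fun x : ℝ => (x + δ)⁻¹ * (x * x)) (fun x => (x + δ)⁻¹) a c4 c1]
    refine norm_cfc_le zero_le_one fun x hx => ?_
    have h0 := hspec x hx
    rw [Real.norm_of_nonneg (by positivity),
      show (x + δ)⁻¹ * (x * x) * (x + δ)⁻¹ = (x / (x + δ)) ^ 2 by field_simp]
    exact pow_le_one₀ (by positivity) ((div_le_one (by positivity)).2 (by linarith))
  · have e : a - cfc (fun x : ℝ => (x + δ)⁻¹) a * (a * a)
        = cfc (fun x : ℝ => x - (x + δ)⁻¹ * (x * x)) a := by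
      rw [cfc_sub (fun x : ℝ => x) (fun x => (x + δ)⁻¹ * (x * x)) a c2 c4, h4, hid]
    rw [e]
    refine norm_cfc_le hδ.le fun x hx => ?_
    have h0 := hspec x hx
    rw [show x - (x + δ)⁻¹ * (x * x) = (x / (x + δ)) * δ by field_simp; ring,
      Real.norm_of_nonneg (by positivity)]
    exact mul_le_of_le_one_left hδ.le ((div_le_one (by positivity)).2 (by linarith))

/-- A substitute for the polar decomposition: with a = |K| and S = (a + δ)⁻¹ the operator S K* is a
contraction, and S K* K = S a² differs from a by at most δ in norm. A finite sum of diagonal entries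
of a is then at most c plus a multiple of δ, and δ tends to 0. -/
lemma TrBound.isTraceClass {K : H →L[ℂ] H} {c : ℝ} (h : TrBound K c) : IsTraceClass K := by
  intro ι b
  obtain ⟨a, hadef⟩ : ∃ a, a = CFC.abs K := ⟨_, rfl⟩
  rw [← hadef]
  have ha : 0 ≤ a := hadef ▸ CFC.abs_nonneg K
  have hKK : star K * K = a * a := hadef ▸ (CFC.abs_mul_abs K).symm
  have hpos : ∀ i, 0 ≤ (⟪b i, a (b i)⟫_ℂ).re := fun i =>
    ((ContinuousLinearMap.nonneg_iff_isPositive _).1 ha).re_inner_nonneg_right _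
  refine summable_of_sum_le (c := c) hpos fun s => ?_
  have key : ∀ δ : ℝ, 0 < δ → ∑ i ∈ s, (⟪b i, a (b i)⟫_ℂ).re ≤ c + s.card * δ := by
    intro δ hδ
    obtain ⟨S, hS, hS1, hd⟩ := exists_regularized_inverse a ha hδ
    have hV : ‖S * star K‖ ≤ 1 := by
      have e : (S * star K) * star (S * star K) = S * (a * a) * S := by
        rw [star_mul, star_star, hS, ← hKK]
        simp only [mul_assoc]
      rw [← e, CStarRing.norm_self_mul_star] at hS1
      nlinarith [norm_nonneg (S * star K)]
    have h1 := h ι b s (S * star K) 1 hV ContinuousLinearMap.norm_id_le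
    calc ∑ i ∈ s, (⟪b i, a (b i)⟫_ℂ).re
        ≤ ∑ i ∈ s, (‖⟪b i, (S * star K) (K (b i))⟫_ℂ‖ + δ) := by
          refine Finset.sum_le_sum fun i _ => ?_
          have e3 : ⟪b i, a (b i)⟫_ℂ
              = ⟪b i, (S * star K) (K (b i))⟫_ℂ + ⟪b i, (a - S * (a * a)) (b i)⟫_ℂ := by
            rw [← inner_add_right, ← hKK, ← mul_assoc]
            congr 1
            exact (add_sub_cancel ((S * star K * K) (b i)) (a (b i))).symm
          rw [e3, Complex.add_re]
          refine add_le_add (Complex.re_le_norm _) ((Complex.re_le_norm _).trans ?_)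
          refine (norm_inner_le_norm _ _).trans ?_
          have hb : ‖b i‖ = 1 := b.orthonormal.1 i
          rw [hb, one_mul]
          refine ((a - S * (a * a)).le_opNorm _).trans ?_
          rw [hb, mul_one]
          exact hd
      _ ≤ c + s.card * δ := by
          rw [Finset.sum_add_distrib, Finset.sum_const, nsmul_eq_mul]
          exact add_le_add h1 le_rfl
  refine le_of_forall_pos_le_add fun η hη => ?_
  have := key (η / (s.card + 1)) (by positivity)
  refine this.trans (add_le_add le_rfl ?_)
  rw [mul_div_assoc', div_le_iff₀ (by positivity)]
  nlinarith

end TraceNorm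
end DiracVacuum
end

noncomputable section

namespace DiracVacuum

/-! ### Graphs of unbounded operators -/

section Graphs

variable {H : Type} [NormedAddCommGroup H] [InnerProductSpace ℂ H] [CompleteSpace H]

/-- Graphs replace dependent domain proofs in what follows: compositions, shifts, inverses and
adjoints all become statements about pairs. -/
lemma mem_graph_iff_exists {T : H →ₗ.[ℂ] H} {x y : H} :
    (x, y) ∈ T.graph ↔ ∃ h : x ∈ T.domain, T ⟨x, h⟩ = y := by
  rw [LinearPMap.mem_graph_iff]
  constructor
  · rintro ⟨⟨a, ha⟩, rfl, rfl⟩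
    exact ⟨ha, rfl⟩
  · rintro ⟨h, rfl⟩
    exact ⟨⟨x, h⟩, rfl, rfl⟩

lemma mem_graph_pcomp {S T : H →ₗ.[ℂ] H} {x z : H} :
    (x, z) ∈ (pcomp S T).graph ↔ ∃ y, (x, y) ∈ T.graph ∧ (y, z) ∈ S.graph := by
  simp only [mem_graph_iff_exists]
  constructor
  · rintro ⟨⟨h, h'⟩, rfl⟩
    exact ⟨_, ⟨h, rfl⟩, h', rfl⟩
  · rintro ⟨y, ⟨h, rfl⟩, h', rfl⟩
    exact ⟨⟨h, h'⟩, rfl⟩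

lemma mem_graph_addConst {T : H →ₗ.[ℂ] H} {c : ℂ} {x y : H} :
    (x, y) ∈ (addConst T c).graph ↔ (x, y - c • x) ∈ T.graph := by
  simp only [mem_graph_iff_exists]
  refine exists_congr fun h => ?_
  have : addConst T c ⟨x, h⟩ = c • x + T ⟨x, h⟩ := rfl
  rw [this, eq_sub_iff_add_eq, add_comm]

lemma isBoundedInverse_iff {S : H →L[ℂ] H} {T : H →ₗ.[ℂ] H} :
    IsBoundedInverse S T ↔ ∀ x y, (x, y) ∈ T.graph ↔ S y = x := by
  simp only [mem_graph_iff_exists]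
  constructor
  · rintro ⟨h1, h2⟩ x y
    constructor
    · rintro ⟨h, rfl⟩
      exact h2 ⟨x, h⟩
    · rintro rfl
      exact h1 y
  · intro h
    exact ⟨fun y => (h _ _).2 rfl, fun x => (h x (T x)).1 ⟨x.2, rfl⟩⟩

lemma isBoundedInverse_addConst_iff {S : H →L[ℂ] H} {T : H →ₗ.[ℂ] H} {c : ℂ} :
    IsBoundedInverse S (addConst T c) ↔ ∀ x y, (x, y) ∈ T.graph ↔ S (y + c • x) = x := by
  rw [isBoundedInverse_iff]
  simp only [mem_graph_addConst]
  constructor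
  · intro h x y
    rw [← h]
    simp
  · intro h x y
    rw [h]
    simp

lemma IsBoundedInverse.unique {S S' : H →L[ℂ] H} {T : H →ₗ.[ℂ] H} (h : IsBoundedInverse S T)
    (h' : IsBoundedInverse S' T) : S = S' := by
  rw [isBoundedInverse_iff] at h h'
  ext1 y
  exact ((h' _ y).1 ((h _ y).2 rfl)).symm

lemma IsBoundedInverse.boundedInverse_eq {S : H →L[ℂ] H} {T : H →ₗ.[ℂ] H}
    (h : IsBoundedInverse S T) : boundedInverse T = S := by
  have hex : ∃ S, IsBoundedInverse S T := ⟨S, h⟩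
  rw [boundedInverse, dif_pos hex]
  exact hex.choose_spec.unique h

lemma isSelfAdjoint_of_graph {T : H →ₗ.[ℂ] H} (hd : Dense (T.domain : Set H))
    (hs : ∀ x y x' y', (x, y) ∈ T.graph → (x', y') ∈ T.graph → ⟪y, x'⟫_ℂ = ⟪x, y'⟫_ℂ)
    (hm : ∀ a b, (∀ x y, (x, y) ∈ T.graph → ⟪y, a⟫_ℂ = ⟪x, b⟫_ℂ) → (a, b) ∈ T.graph) :
    IsSelfAdjoint T := by
  rw [LinearPMap.isSelfAdjoint_def]
  refine LinearPMap.eq_of_eq_graph ?_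
  rw [LinearPMap.adjoint_graph_eq_graph_adjoint hd]
  ext ⟨a, b⟩
  rw [Submodule.mem_adjoint_iff]
  constructor
  · exact fun h => hm a b fun x y hxy => sub_eq_zero.1 (h x y hxy)
  · exact fun h x y hxy => sub_eq_zero.2 (hs x y a b hxy h)

lemma _root_.IsSelfAdjoint.inner_graph {T : H →ₗ.[ℂ] H} (hT : IsSelfAdjoint T) {x y x' y' : H}
    (h : (x, y) ∈ T.graph) (h' : (x', y') ∈ T.graph) : ⟪y, x'⟫_ℂ = ⟪x, y'⟫_ℂ := by
  have h1 : (x', y') ∈ T.graph.adjoint := by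
    rw [← LinearPMap.adjoint_graph_eq_graph_adjoint hT.dense_domain,
      LinearPMap.isSelfAdjoint_def.1 hT]
    exact h'
  exact sub_eq_zero.1 ((Submodule.mem_adjoint_iff _ _).1 h1 x y h)

/-- A symmetric operator `T` for which `T² + ω²` is onto is self-adjoint. -/
lemma isSelfAdjoint_of_surjective {T : H →ₗ.[ℂ] H} {ω : ℝ} (hω : ω ≠ 0)
    (hs : ∀ x y x' y', (x, y) ∈ T.graph → (x', y') ∈ T.graph → ⟪y, x'⟫_ℂ = ⟪x, y'⟫_ℂ)
    (hr : ∀ z, ∃ x y w, (x, y) ∈ T.graph ∧ (y, w) ∈ T.graph ∧ w + ((ω ^ 2 : ℝ) : ℂ) • x = z) :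
    IsSelfAdjoint T := by
  -- Since T² + ω² = (T + iτ)(T − iτ) for τ = ±ω, the vector Tx − iτx is a preimage of z under T +
  -- iτ.
  have hpm : ∀ τ : ℝ, τ ^ 2 = ω ^ 2 → ∀ z, ∃ x y, (x, y) ∈ T.graph ∧
      y + (Complex.I * τ) • x = z := by
    intro τ hτ z
    obtain ⟨x, y, w, h1, h2, h3⟩ := hr z
    refine ⟨y - (Complex.I * τ) • x, w - (Complex.I * τ) • y, ?_, ?_⟩
    · exact T.graph.sub_mem h2 (T.graph.smul_mem (Complex.I * τ) h1)
    · rw [← h3, smul_sub, smul_smul, ← hτ]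
      have : (Complex.I * τ) * (Complex.I * τ) = -((τ ^ 2 : ℝ) : ℂ) := by
        push_cast; linear_combination (τ : ℂ) ^ 2 * Complex.I_sq
      rw [this, neg_smul]
      abel
  refine isSelfAdjoint_of_graph ?_ hs fun a b hab => ?_
  · rw [Submodule.dense_iff_topologicalClosure_eq_top, Submodule.topologicalClosure_eq_top_iff,
      Submodule.eq_bot_iff]
    intro w hw
    -- A vector w = (T + iω)x orthogonal to the domain satisfies ⟨x, Tx⟩ + iω‖x‖² = 0. The first
    -- term is real, so x = 0.
    obtain ⟨x, y, hxy, rfl⟩ := hpm ω rfl w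
    have hx : x ∈ T.domain := LinearPMap.mem_domain_of_mem_graph hxy
    have h0 : ⟪x, y + (Complex.I * ω) • x⟫_ℂ = 0 := hw x hx
    rw [inner_add_right, inner_smul_right] at h0
    have hre : (⟪x, y⟫_ℂ).im = 0 := by
      rw [← Complex.conj_eq_iff_im, inner_conj_symm]
      exact hs _ _ _ _ hxy hxy
    have h1 := congrArg Complex.im h0
    have h2 : ⟪x, x⟫_ℂ = ((‖x‖ ^ 2 : ℝ) : ℂ) := by
      rw [inner_self_eq_norm_sq_to_K]; simp
    rw [h2, Complex.add_im, hre] at h1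
    have h3 : ω * ‖x‖ ^ 2 = 0 := by
      have e : (Complex.I * ω) * ((‖x‖ ^ 2 : ℝ) : ℂ) = Complex.I * ((ω * ‖x‖ ^ 2 : ℝ) : ℂ) := by
        push_cast; ring
      rw [e, Complex.I_mul_im, Complex.ofReal_re, zero_add] at h1
      exact h1
    have hx0 : x = 0 := by simpa [hω] using h3
    subst hx0
    have hy := T.graph_fst_eq_zero_snd hxy rfl
    simp [hy]
  -- If (a, b) is in the graph of the adjoint and (T + iω)x = b + iωa, then a − x is orthogonal to
  -- the range of T − iω, which is the whole space. So a = x and b = Tx.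
  · obtain ⟨x, y, hxy, h⟩ := hpm ω rfl (b + (Complex.I * ω) • a)
    obtain ⟨p, q, hpq, hd⟩ := hpm (-ω) (by ring) (a - x)
    have e1 : ⟪q, a - x⟫_ℂ = ⟪p, b - y⟫_ℂ := by
      rw [inner_sub_right, inner_sub_right, hab p q hpq, hs p q x y hpq hxy]
    have e2 : b - y = -((Complex.I * ω) • (a - x)) := by
      rw [smul_sub]
      have : b = y + (Complex.I * ω) • x - (Complex.I * ω) • a := by rw [h]; abel
      rw [this]; abel
    have e3 : ⟪q + (Complex.I * ((-ω : ℝ) : ℂ)) • p, a - x⟫_ℂ = 0 := by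
      rw [inner_add_left, e1, e2, inner_neg_right, inner_smul_right, inner_smul_left]
      simp
    rw [hd] at e3
    rw [inner_self_eq_zero, sub_eq_zero] at e3
    have e4 : b = y := by rw [← sub_eq_zero, e2, e3]; simp
    rw [e3, e4]
    exact hxy

end Graphs
end DiracVacuum
end

noncomputable section

namespace DiracVacuum

/-! ### The absolute value of a self-adjoint operator -/

section AbsoluteValue

variable {H : Type} [NormedAddCommGroup H] [InnerProductSpace ℂ H] [CompleteSpace H]

lemma mem_Icc_of_mem_spectrum {S : H →L[ℂ] H} (h0 : 0 ≤ S) (h1 : ‖S‖ ≤ 1) {x : ℝ}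
    (hx : x ∈ spectrum ℝ S) : 0 ≤ x ∧ x ≤ 1 := by
  refine ⟨spectrum_nonneg_of_nonneg h0 hx, ?_⟩
  rcases subsingleton_or_nontrivial H with hs | hn
  · have : Subsingleton (H →L[ℂ] H) := ⟨fun a b => ContinuousLinearMap.ext fun x => Subsingleton.elim _ _⟩
    rw [spectrum.of_subsingleton] at hx
    exact absurd hx (Set.notMem_empty x)
  · exact (le_abs_self x).trans ((spectrum.norm_le_norm_of_mem hx).trans h1)

/-- `√(S(1-S))`. -/
def sqrtMulOneSub (S : H →L[ℂ] H) : H →L[ℂ] H := cfc (fun x : ℝ => √(x * (1 - x))) S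

lemma sqrtMulOneSub_nonneg (S : H →L[ℂ] H) : 0 ≤ sqrtMulOneSub S :=
  cfc_nonneg fun _ _ => Real.sqrt_nonneg _

lemma sqrtMulOneSub_sq {S : H →L[ℂ] H} (h0 : 0 ≤ S) (h1 : ‖S‖ ≤ 1) :
    sqrtMulOneSub S * sqrtMulOneSub S = S * (1 - S) := by
  have hsa : IsSelfAdjoint S := h0.isSelfAdjoint
  have hid : cfc (fun x : ℝ => x) S = S := cfc_id' ℝ S
  have e1 : cfc (fun x : ℝ => 1 - x) S = 1 - S := by
    rw [cfc_sub (fun _ : ℝ => (1 : ℝ)) (fun x => x) S (by fun_prop) (by fun_prop), hid,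
      cfc_const_one ℝ S]
  rw [sqrtMulOneSub, ← cfc_mul (fun x : ℝ => √(x * (1 - x))) (fun x : ℝ => √(x * (1 - x))) S
    (by fun_prop) (by fun_prop)]
  rw [show S * (1 - S) = cfc (fun x : ℝ => x) S * cfc (fun x : ℝ => 1 - x) S by rw [e1, hid],
    ← cfc_mul (fun x : ℝ => x) (fun x : ℝ => 1 - x) S (by fun_prop) (by fun_prop)]
  refine cfc_congr fun x hx => ?_
  have := mem_Icc_of_mem_spectrum h0 h1 hx
  exact Real.mul_self_sqrt (mul_nonneg this.1 (by linarith))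

/-- The absolute value exists: `|T|` has graph `{(√S v, √(1-S) v)}`, where `S = (T² + 1)⁻¹`. -/
lemma exists_isAbs {T : H →ₗ.[ℂ] H} (hT : IsSelfAdjoint T) {S : H →L[ℂ] H} (h0 : 0 ≤ S)
    (h1 : ‖S‖ ≤ 1) (hS : ∀ x y, (x, y) ∈ (pcomp T T).graph ↔ S (y + x) = x) :
    ∃ A, IsAbs A T := by
  have hsa : IsSelfAdjoint S := h0.isSelfAdjoint
  have hspec : ∀ x ∈ spectrum ℝ S, 0 ≤ x ∧ x ≤ 1 := fun x => mem_Icc_of_mem_spectrum h0 h1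
  have hid : cfc (fun x : ℝ => x) S = S := cfc_id' ℝ S
  obtain ⟨C, hC⟩ : ∃ C, C = cfc (fun x : ℝ => √x) S := ⟨_, rfl⟩
  obtain ⟨E, hE⟩ : ∃ E, E = cfc (fun x : ℝ => √(1 - x)) S := ⟨_, rfl⟩
  have hCC : C * C = S := by
    rw [hC, ← cfc_mul (fun x : ℝ => √x) (fun x : ℝ => √x) S (by fun_prop) (by fun_prop)]
    conv_rhs => rw [← hid]
    exact cfc_congr fun x hx => Real.mul_self_sqrt (hspec x hx).1
  have hEE : C * C + E * E = 1 := by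
    rw [hCC, hE, ← cfc_mul (fun x : ℝ => √(1 - x)) (fun x : ℝ => √(1 - x)) S (by fun_prop)
      (by fun_prop)]
    rw [show S + cfc (fun x : ℝ => √(1 - x) * √(1 - x)) S
        = cfc (fun x : ℝ => x) S + cfc (fun x : ℝ => √(1 - x) * √(1 - x)) S by rw [hid],
      ← cfc_add S (fun x : ℝ => x) (fun x : ℝ => √(1 - x) * √(1 - x)) (by fun_prop) (by fun_prop),
      ← cfc_const_one ℝ S]
    refine cfc_congr fun x hx => ?_
    have := hspec x hx
    rw [Real.mul_self_sqrt (by linarith)]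
    simp
  have hCE : C * E = E * C := by
    rw [hC, hE]
    exact cfc_commute_cfc _ _ S
  have hCEpos : 0 ≤ C * E := by
    rw [hC, hE, ← cfc_mul (fun x : ℝ => √x) (fun x : ℝ => √(1 - x)) S (by fun_prop) (by fun_prop)]
    exact cfc_nonneg fun x _ => mul_nonneg (Real.sqrt_nonneg _) (Real.sqrt_nonneg _)
  have hCs : ∀ x y, ⟪C x, y⟫_ℂ = ⟪x, C y⟫_ℂ := by
    have : IsSelfAdjoint C := hC ▸ cfc_predicate _ S
    exact fun x y => ContinuousLinearMap.isSelfAdjoint_iff_isSymmetric.1 this x y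
  have hEs : ∀ x y, ⟪E x, y⟫_ℂ = ⟪x, E y⟫_ℂ := by
    have : IsSelfAdjoint E := hE ▸ cfc_predicate _ S
    exact fun x y => ContinuousLinearMap.isSelfAdjoint_iff_isSymmetric.1 this x y
  have hSinj : ∀ v, S v = 0 → v = 0 := fun v hv => by
    have := (hS 0 v).2 (by simpa using hv)
    exact LinearPMap.graph_fst_eq_zero_snd _ this rfl
  have hCinj : ∀ v, C v = 0 → v = 0 := fun v hv => by
    refine hSinj v ?_
    rw [← hCC, mul_apply_eq_comp, hv, map_zero]
  have aCC : ∀ v, C (C v) + E (E v) = v := fun v => by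
    simpa using congrArg (fun L : H →L[ℂ] H => L v) hEE
  have aCE : ∀ v, C (E v) = E (C v) := fun v => congrArg (fun L : H →L[ℂ] H => L v) hCE
  -- If T were multiplication by t, then √S = 1/√(t² + 1) and √(1 − S) = |t|/√(t² + 1), with
  -- quotient |t|.
  let G : Submodule ℂ (H × H) := LinearMap.range ((C : H →ₗ[ℂ] H).prod (E : H →ₗ[ℂ] H))
  have hG : ∀ x y, (x, y) ∈ G.toLinearPMap.graph ↔ ∃ v, C v = x ∧ E v = y := by
    intro x y
    rw [Submodule.toLinearPMap_graph_eq]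
    · simp [G]
    · rintro _ ⟨v, rfl⟩ h
      have : v = 0 := hCinj v h
      simp [this]
  have hA : IsSelfAdjoint G.toLinearPMap := by
    refine isSelfAdjoint_of_graph ?_ ?_ ?_
    · rw [Submodule.dense_iff_topologicalClosure_eq_top, Submodule.topologicalClosure_eq_top_iff,
        Submodule.eq_bot_iff]
      intro w hw
      refine hCinj w (inner_self_eq_zero (𝕜 := ℂ).1 ?_)
      rw [← hCs]
      exact hw _ (LinearPMap.mem_domain_of_mem_graph ((hG _ _).2 ⟨_, rfl, rfl⟩))
    · intro x y x' y' h h'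
      obtain ⟨v, rfl, rfl⟩ := (hG _ _).1 h
      obtain ⟨v', rfl, rfl⟩ := (hG _ _).1 h'
      rw [hEs, hCs, aCE]
    · intro a b hab
      have key : E a = C b := by
        refine ext_inner_left ℂ fun v => ?_
        rw [← hEs, ← hCs]
        exact hab _ _ ((hG _ _).2 ⟨v, rfl, rfl⟩)
      -- Because C² + E² = 1, a pair with E a = C b is the image of v = C a + E b.
      refine (hG _ _).2 ⟨C a + E b, ?_, ?_⟩
      · rw [map_add, aCE, ← key, aCC]
      · rw [map_add, ← aCE, key, aCC]
  refine ⟨G.toLinearPMap, hA, ?_, ?_⟩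
  · intro x
    obtain ⟨v, hv, hv'⟩ := (hG _ _).1 (G.toLinearPMap.mem_graph x)
    rw [← hv, ← hv', hCs]
    exact ((ContinuousLinearMap.nonneg_iff_isPositive _).1 hCEpos).re_inner_nonneg_right v
  · rw [LinearPMap.isSelfAdjoint_def.1 hT]
    refine LinearPMap.eq_of_eq_graph ?_
    ext ⟨x, z⟩
    rw [hS, mem_graph_pcomp]
    constructor
    · rintro ⟨y, h, h'⟩
      obtain ⟨v, rfl, rfl⟩ := (hG _ _).1 h
      obtain ⟨w, hw, rfl⟩ := (hG _ _).1 h'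
      rw [← hCC, mul_apply_eq_comp, map_add, aCE, hw, add_comm, aCC]
    · intro h
      refine ⟨E (C (z + x)), (hG _ _).2 ⟨C (z + x), ?_, rfl⟩, (hG _ _).2 ⟨E (z + x), aCE _, ?_⟩⟩
      · rw [← mul_apply_eq_comp, hCC, h]
      · have := aCC (z + x)
        rw [← mul_apply_eq_comp C C, hCC, h, add_comm z x] at this
        rw [add_comm z x]
        exact add_left_cancel this

/-- Every absolute value of `T` is given by `√(S(1-S)) S⁻¹` on the range of `S = (T² + 1)⁻¹`. -/
lemma IsAbs.mem_graph {A T : H →ₗ.[ℂ] H} (hA : IsAbs A T) (hT : IsSelfAdjoint T) {S : H →L[ℂ] H}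
    (h0 : 0 ≤ S) (h1 : ‖S‖ ≤ 1) (hS : ∀ x y, (x, y) ∈ (pcomp T T).graph ↔ S (y + x) = x) (z : H) :
    (S z, sqrtMulOneSub S z) ∈ A.graph := by
  obtain ⟨hAs, hpos, hsq⟩ := hA
  rw [LinearPMap.isSelfAdjoint_def.1 hT] at hsq
  have hin : ∀ x y x' y', (x, y) ∈ A.graph → (x', y') ∈ A.graph → ⟪y, x'⟫_ℂ = ⟪x, y'⟫_ℂ :=
    fun x y x' y' h h' => hAs.inner_graph h h'
  -- The range of S is the domain of A² = T², so p = A S is defined on the whole space.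
  have hz : ∀ z, ∃ y, (S z, y) ∈ A.graph ∧ (y, z - S z) ∈ A.graph := fun z => by
    rw [← mem_graph_pcomp, hsq, hS]
    simp
  choose p hp hp' using hz
  have padd : ∀ z w, p (z + w) = p z + p w := fun z w => by
    have h := A.graph.add_mem (hp z) (hp w)
    exact LinearPMap.mem_graph_snd_inj A (hp (z + w)) h (map_add S z w)
  have psmul : ∀ (c : ℂ) z, p (c • z) = c • p z := fun c z => by
    have h := A.graph.smul_mem c (hp z)
    exact LinearPMap.mem_graph_snd_inj A (hp (c • z)) h (map_smul S c z)
  let P : H →ₗ[ℂ] H := { toFun := p, map_add' := padd, map_smul' := psmul }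
  -- The splitting y = S y + A p(y) needs no commutation of A with S. A symmetric operator defined
  -- everywhere is bounded by Hellinger–Toeplitz.
  have hsymm : P.IsSymmetric := fun x y => by
    change ⟪p x, y⟫_ℂ = ⟪x, p y⟫_ℂ
    have e3 := hin _ _ _ _ (hp x) (hp y)
    have e4 : ⟪p x, y⟫_ℂ = ⟪p x, S y⟫_ℂ + ⟪p x, y - S y⟫_ℂ := by
      rw [← inner_add_right]; simp
    have e5 : ⟪x, p y⟫_ℂ = ⟪S x, p y⟫_ℂ + ⟪x - S x, p y⟫_ℂ := by
      rw [← inner_add_left]; simp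
    rw [e4, e5, e3, hin _ _ _ _ (hp' x) (hp' y)]
  let P' : H →L[ℂ] H := ⟨P, hsymm.continuous⟩
  have hP' : ∀ z, P' z = p z := fun z => rfl
  have hPpos : 0 ≤ P' := by
    rw [ContinuousLinearMap.nonneg_iff_isPositive]
    refine ⟨hsymm, fun x => ?_⟩
    have hpos' : ∀ a b, (a, b) ∈ A.graph → 0 ≤ (⟪b, a⟫_ℂ).re := fun a b h => by
      obtain ⟨ha, rfl⟩ := mem_graph_iff_exists.1 h
      rw [hin _ _ _ _ h h]
      exact hpos ⟨a, ha⟩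
    have e4 : ⟪p x, x⟫_ℂ = ⟪p x, S x⟫_ℂ + ⟪p x, x - S x⟫_ℂ := by
      rw [← inner_add_right]; simp
    have h1 := hpos' _ _ (hp x)
    have h2 := hpos' _ _ (hp' x)
    rw [hin _ _ _ _ (hp' x) (hp' x)] at h2
    change 0 ≤ (⟪p x, x⟫_ℂ).re
    rw [e4, Complex.add_re]
    exact add_nonneg h1 h2
  -- A commutes with the resolvent S of A², whence (A S)² = S A² S = S(1 − S). Being nonnegative, A
  -- S is the unique such square root.
  have hPsq : P' * P' = S * (1 - S) := by
    have hcomm : ∀ w, S (p w) = p (S w) := fun w => by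
      have h := A.graph.sub_mem (hp w) (hp (S w))
      have hq : (p (S w), p w - p (S w)) ∈ (pcomp T T).graph := by
        rw [← hsq]
        exact mem_graph_pcomp.2 ⟨_, hp' (S w), h⟩
      have := (hS _ _).1 hq
      rwa [sub_add_cancel] at this
    ext1 z
    have h := hp (p z)
    rw [hcomm] at h
    have := LinearPMap.mem_graph_snd_inj A h (hp' (S z)) rfl
    change p (p z) = S (z - S z)
    rw [this, map_sub]
  have e : sqrtMulOneSub S = P' := by
    rw [← CFC.sqrt_unique (sqrtMulOneSub_sq h0 h1) (sqrtMulOneSub_nonneg S),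
      CFC.sqrt_unique hPsq hPpos]
  rw [e]
  exact hp z

/-- The integrand of the integral representation of `√(s(1-s))`. -/
def sqrtIntegrand (ω s : ℝ) : ℝ := s * (1 - s) / ((1 - s) + ω ^ 2 * s)

lemma sqrtIntegrand_denom_pos {ω s : ℝ} (hω : ω ≠ 0) (h : 0 ≤ s ∧ s ≤ 1) :
    0 < (1 - s) + ω ^ 2 * s := by
  have : 0 < ω ^ 2 := by positivity
  rcases h.2.lt_or_eq with h2 | h2
  · nlinarith [mul_nonneg this.le h.1]
  · subst h2; simpa using this

/-- Here s(1 − s)(1 + ω²) ≤ (1 − s) + ω²s, as s ≤ 1 and 1 − s ≤ 1. The bound is uniform in s and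
integrable in ω, so the integral may enter the continuous functional calculus. -/
lemma abs_sqrtIntegrand_le {ω s : ℝ} (hω : ω ≠ 0) (h : 0 ≤ s ∧ s ≤ 1) :
    |sqrtIntegrand ω s| ≤ (1 + ω ^ 2)⁻¹ := by
  have hd := sqrtIntegrand_denom_pos hω h
  have hn : 0 ≤ s * (1 - s) := mul_nonneg h.1 (by linarith [h.2])
  rw [sqrtIntegrand, abs_of_nonneg (div_nonneg hn hd.le), div_le_iff₀ hd, ← div_eq_inv_mul,
    le_div_iff₀ (by positivity)]
  nlinarith [mul_nonneg (sq_nonneg ω) h.1, mul_nonneg (mul_nonneg (sq_nonneg ω) h.1) h.1, h.1, h.2,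
    sq_nonneg (1 - s)]

/-- For 0 < s < 1 the integrand is s/(1 + (ω/a)²) with a² = (1 − s)/s, whose integral is πsa. At the
endpoints both sides vanish. -/
lemma integral_sqrtIntegrand {s : ℝ} (h : 0 ≤ s ∧ s ≤ 1) :
    ∫ ω, sqrtIntegrand ω s = Real.pi * √(s * (1 - s)) := by
  rcases h.1.eq_or_lt with h0 | h0
  · subst h0; simp [sqrtIntegrand]
  rcases h.2.eq_or_lt with h1 | h1
  · subst h1; simp [sqrtIntegrand]
  have hs1 : 0 < 1 - s := by linarith
  set a := √((1 - s) / s) with ha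
  have ha0 : 0 < a := Real.sqrt_pos.2 (by positivity)
  have haa : a ^ 2 = (1 - s) / s := Real.sq_sqrt (by positivity)
  have e : ∀ ω, sqrtIntegrand ω s = s * (1 + (ω / a) ^ 2)⁻¹ := fun ω => by
    rw [sqrtIntegrand, div_pow, haa]
    have : 0 < (1 - s) + ω ^ 2 * s := by positivity
    field_simp
  simp only [e]
  rw [integral_const_mul, Measure.integral_comp_div (fun x : ℝ => (1 + x ^ 2)⁻¹),
    integral_univ_inv_one_add_sq, abs_of_pos ha0, smul_eq_mul]
  have : s * a = √(s * (1 - s)) := by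
    rw [ha, ← Real.sqrt_sq h.1, ← Real.sqrt_mul (by positivity), Real.sqrt_sq h.1]
    congr 1
    field_simp
  rw [← this]
  ring

/-- The integral representation `√(S(1-S)) = π⁻¹ ∫ S(1-S) / ((1-S) + ω²S) dω`. -/
lemma sqrtMulOneSub_eq_integral {S : H →L[ℂ] H} (h0 : 0 ≤ S) (h1 : ‖S‖ ≤ 1) :
    Integrable (fun ω : ℝ => cfc (sqrtIntegrand ω) S) ∧
    (Real.pi : ℝ) • sqrtMulOneSub S = ∫ ω : ℝ, cfc (sqrtIntegrand ω) S := by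
  have hsa : IsSelfAdjoint S := h0.isSelfAdjoint
  have hspec : ∀ x ∈ spectrum ℝ S, 0 ≤ x ∧ x ≤ 1 := fun x => mem_Icc_of_mem_spectrum h0 h1
  -- The integrand is discontinuous at (ω, s) = (0, 1), where its denominator vanishes; the null set
  -- {0} is therefore removed from the ω line.
  have hms : MeasurableSet ({0}ᶜ : Set ℝ) := (measurableSet_singleton 0).compl
  have hres : (volume : Measure ℝ).restrict {0}ᶜ = volume := Measure.restrict_eq_self_of_ae_mem
    (by simp [ae_iff])
  have hcont : ContinuousOn (Function.uncurry sqrtIntegrand) (({0}ᶜ : Set ℝ) ×ˢ spectrum ℝ S) := by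
    refine ContinuousOn.div (by fun_prop) (by fun_prop) ?_
    rintro ⟨ω, s⟩ ⟨hω, hs⟩
    exact (sqrtIntegrand_denom_pos hω (hspec s hs)).ne'
  have hb : ∀ᵐ ω ∂(volume : Measure ℝ).restrict {0}ᶜ, ∀ z ∈ spectrum ℝ S,
      ‖sqrtIntegrand ω z‖ ≤ (1 + ω ^ 2)⁻¹ := by
    filter_upwards [ae_restrict_mem hms] with ω hω z hz
    exact abs_sqrtIntegrand_le hω (hspec z hz)
  have hbi : HasFiniteIntegral (fun ω : ℝ => (1 + ω ^ 2)⁻¹)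
      ((volume : Measure ℝ).restrict {0}ᶜ) := by
    rw [hres]; exact integrable_inv_one_add_sq.2
  have i1 := integrableOn_cfc hms sqrtIntegrand _ S hcont hb hbi hsa
  have i2 := cfc_setIntegral hms sqrtIntegrand _ S hcont hb hbi hsa
  rw [IntegrableOn, hres] at i1
  rw [hres] at i2
  refine ⟨i1, ?_⟩
  rw [← i2, sqrtMulOneSub, ← cfc_const_mul Real.pi _ S (by fun_prop)]
  exact cfc_congr fun x hx => (integral_sqrtIntegrand (hspec x hx)).symm

/-- In terms of `R = (T² + ω²)⁻¹` and `S = (T² + 1)⁻¹` the integrand is `(1 - ω²R) S`. -/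
lemma cfc_sqrtIntegrand {S R : H →L[ℂ] H} (h0 : 0 ≤ S) (h1 : ‖S‖ ≤ 1) {ω : ℝ} (hω : ω ≠ 0)
    (hR : R * ((1 - S) + ((ω ^ 2 : ℝ) : ℂ) • S) = S) :
    cfc (sqrtIntegrand ω) S = (1 - ((ω ^ 2 : ℝ) : ℂ) • R) * S := by
  have hsa : IsSelfAdjoint S := h0.isSelfAdjoint
  have hspec : ∀ x ∈ spectrum ℝ S, 0 ≤ x ∧ x ≤ 1 := fun x => mem_Icc_of_mem_spectrum h0 h1
  have hid : cfc (fun x : ℝ => x) S = S := cfc_id' ℝ S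
  have hsm : ((ω ^ 2 : ℝ) : ℂ) • S = (ω ^ 2 : ℝ) • S := by
    ext1 x; exact Complex.coe_smul (ω ^ 2) (S x)
  have e1 : cfc (fun x : ℝ => (1 - x) + ω ^ 2 * x) S = (1 - S) + ((ω ^ 2 : ℝ) : ℂ) • S := by
    rw [cfc_add S (fun x : ℝ => 1 - x) (fun x => ω ^ 2 * x) (by fun_prop) (by fun_prop),
      cfc_sub (fun _ : ℝ => (1 : ℝ)) (fun x => x) S (by fun_prop) (by fun_prop), hid,
      cfc_const_one ℝ S, cfc_const_mul (ω ^ 2) (fun x : ℝ => x) S (by fun_prop), hid, hsm]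
  have cg : ContinuousOn (fun x : ℝ => ((1 - x) + ω ^ 2 * x)⁻¹) (spectrum ℝ S) :=
    ContinuousOn.inv₀ (by fun_prop) fun x hx => (sqrtIntegrand_denom_pos hω (hspec x hx)).ne'
  have e2 : ((1 - S) + ((ω ^ 2 : ℝ) : ℂ) • S) * cfc (fun x : ℝ => ((1 - x) + ω ^ 2 * x)⁻¹) S = 1 := by
    rw [← e1, ← cfc_mul (fun x : ℝ => (1 - x) + ω ^ 2 * x) (fun x : ℝ => ((1 - x) + ω ^ 2 * x)⁻¹) S
      (by fun_prop) cg, ← cfc_const_one ℝ S]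
    exact cfc_congr fun x hx => mul_inv_cancel₀ (sqrtIntegrand_denom_pos hω (hspec x hx)).ne'
  have e3 : R = cfc (fun x : ℝ => x * ((1 - x) + ω ^ 2 * x)⁻¹) S := by
    rw [cfc_mul (fun x : ℝ => x) (fun x : ℝ => ((1 - x) + ω ^ 2 * x)⁻¹) S (by fun_prop) cg, hid]
    conv_rhs => enter [1]; rw [← hR]
    rw [mul_assoc, e2, mul_one]
  have cR : ContinuousOn (fun x : ℝ => x * ((1 - x) + ω ^ 2 * x)⁻¹) (spectrum ℝ S) :=
    continuousOn_id.mul cg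
  have hsm' : ((ω ^ 2 : ℝ) : ℂ) • R = (ω ^ 2 : ℝ) • R := by
    ext1 x; exact Complex.coe_smul (ω ^ 2) (R x)
  have e4 : 1 - ((ω ^ 2 : ℝ) : ℂ) • R
      = cfc (fun x : ℝ => 1 - ω ^ 2 * (x * ((1 - x) + ω ^ 2 * x)⁻¹)) S := by
    rw [cfc_sub (fun _ : ℝ => (1 : ℝ)) (fun x => ω ^ 2 * (x * ((1 - x) + ω ^ 2 * x)⁻¹)) S
      (by fun_prop) (continuousOn_const.mul cR), cfc_const_one ℝ S,
      cfc_const_mul (ω ^ 2) (fun x : ℝ => x * ((1 - x) + ω ^ 2 * x)⁻¹) S cR, ← e3, hsm']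
  have e5 : (1 - ((ω ^ 2 : ℝ) : ℂ) • R) * S
      = cfc (fun x : ℝ => (1 - ω ^ 2 * (x * ((1 - x) + ω ^ 2 * x)⁻¹)) * x) S := by
    rw [cfc_mul (fun x : ℝ => 1 - ω ^ 2 * (x * ((1 - x) + ω ^ 2 * x)⁻¹)) (fun x : ℝ => x) S
      (continuousOn_const.sub (continuousOn_const.mul cR)) (by fun_prop), hid, e4]
  rw [e5]
  refine cfc_congr fun x hx => ?_
  have := mul_inv_cancel₀ (sqrtIntegrand_denom_pos hω (hspec x hx)).ne'
  rw [sqrtIntegrand, div_eq_mul_inv]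
  linear_combination x * this

end AbsoluteValue
end DiracVacuum
end

noncomputable section

namespace DiracVacuum

open FourierTransform
open scoped BoundedContinuousFunction ENNReal

/-! ### The free resolvent -/

section FreeResolvent

/-- The symbol `1 + ω² + c²|ξ|²` of `D_0² + ω²`, where `c = 2πε`. -/
def qf (c ω : ℝ) (ξ : R3) : ℝ := 1 + ω ^ 2 + c ^ 2 * ‖ξ‖ ^ 2

lemma one_add_sq_le_qf (c ω : ℝ) (ξ : R3) : 1 + ω ^ 2 ≤ qf c ω ξ := by
  rw [qf]; nlinarith [mul_nonneg (sq_nonneg c) (sq_nonneg ‖ξ‖)]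

lemma qf_pos (c ω : ℝ) (ξ : R3) : 0 < qf c ω ξ :=
  lt_of_lt_of_le (by positivity) (one_add_sq_le_qf c ω ξ)

lemma continuous_qf (c ω : ℝ) : Continuous (qf c ω) := by
  unfold qf; fun_prop

lemma norm_ofReal_inv_qf_le (c ω : ℝ) (ξ : R3) : ‖(((qf c ω ξ)⁻¹ : ℝ) : ℂ)‖ ≤ (1 + ω ^ 2)⁻¹ := by
  rw [Complex.norm_real, Real.norm_of_nonneg (inv_nonneg.2 (qf_pos c ω ξ).le)]
  exact inv_anti₀ (by positivity) (one_add_sq_le_qf c ω ξ)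

/-- The symbol of `(D_0² + ω²)⁻¹`. -/
def res (c ω : ℝ) : R3 →ᵇ ℂ :=
  BoundedContinuousFunction.ofNormedAddCommGroup (fun ξ => (((qf c ω ξ)⁻¹ : ℝ) : ℂ))
    (Complex.continuous_ofReal.comp ((continuous_qf c ω).inv₀ fun ξ => (qf_pos c ω ξ).ne'))
    (1 + ω ^ 2)⁻¹ (norm_ofReal_inv_qf_le c ω)

lemma res_apply (c ω : ℝ) (ξ : R3) : res c ω ξ = (((qf c ω ξ)⁻¹ : ℝ) : ℂ) := rfl

lemma norm_res_le (c ω : ℝ) : ‖res c ω‖ ≤ (1 + ω ^ 2)⁻¹ :=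
  BoundedContinuousFunction.norm_ofNormedAddCommGroup_le _ (by positivity) _

lemma star_res (c ω : ℝ) : star (res c ω) = res c ω := by
  ext ξ
  simp [res_apply]

lemma res_sub (c ω τ : ℝ) :
    res c ω - res c τ = ((τ ^ 2 - ω ^ 2 : ℝ) : ℂ) • (res c ω * res c τ) := by
  ext ξ
  have h1 := (qf_pos c ω ξ).ne'
  have h2 := (qf_pos c τ ξ).ne'
  simp only [BoundedContinuousFunction.coe_sub, Pi.sub_apply, BoundedContinuousFunction.coe_smul,
    BoundedContinuousFunction.coe_mul, Pi.mul_apply, res_apply, smul_eq_mul]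
  rw [← Complex.ofReal_sub, ← Complex.ofReal_mul, ← Complex.ofReal_mul]
  congr 1
  field_simp
  simp only [qf]
  ring

/-- The weight `(1 + ω²)^{-1/4}`. -/
def wt (ω : ℝ) : ℝ := (1 + ω ^ 2) ^ (-(1 / 4) : ℝ)

lemma wt_pos (ω : ℝ) : 0 < wt ω := Real.rpow_pos_of_pos (by positivity) _

lemma wt_le_one (ω : ℝ) : wt ω ≤ 1 :=
  Real.rpow_le_one_of_one_le_of_nonpos (by nlinarith [sq_nonneg ω]) (by norm_num)

lemma wt_sq (ω : ℝ) : wt ω ^ 2 = (√(1 + ω ^ 2))⁻¹ := by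
  rw [wt, ← Real.rpow_natCast, ← Real.rpow_mul (by positivity), Real.sqrt_eq_rpow,
    ← Real.rpow_neg (by positivity)]
  norm_num

lemma wt_pow_four (ω : ℝ) : wt ω ^ 4 = (1 + ω ^ 2)⁻¹ := by
  rw [wt, ← Real.rpow_natCast, ← Real.rpow_mul (by positivity), ← Real.rpow_neg_one]
  norm_num

lemma continuous_wt : Continuous wt :=
  Continuous.rpow_const (by fun_prop) fun ω => Or.inl (by positivity)

/-- wt³ decays like |ω|^{-3/2}, whereas wt² decays only like |ω|⁻¹. Three factors A are thus needed
for an integrable bound. -/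
lemma integrable_wt_cubed : Integrable fun ω => wt ω ^ 3 := by
  have h := integrable_rpow_neg_one_add_norm_sq (E := ℝ) (μ := volume) (r := 3 / 2) (by norm_num)
  refine h.congr (.of_forall fun ω => ?_)
  have e : wt ω ^ 3 = (1 + ω ^ 2) ^ (-(1 / 4) * (3 : ℕ) : ℝ) := by
    rw [wt, ← Real.rpow_natCast, ← Real.rpow_mul (by positivity)]
  simp only [e, Real.norm_eq_abs, sq_abs]
  norm_num

/-- The constant in the decay of the `L²` norm of the free resolvent symbol. -/
def resConst (c : ℝ) : ℝ :=
  √((c ^ 3)⁻¹ * ∫ ξ : R3, ((1 : ℝ) + ‖ξ‖ ^ 2) ^ (-4 / 2 : ℝ))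

lemma norm_res_sq_eq {c : ℝ} (hc : 0 < c) (ω : ℝ) (ξ : R3) :
    ‖res c ω ξ‖ ^ 2 = ((1 + ω ^ 2) ^ 2)⁻¹ *
      ((1 : ℝ) + ‖(c / √(1 + ω ^ 2)) • ξ‖ ^ 2) ^ (-4 / 2 : ℝ) := by
  have h0 : (0 : ℝ) < 1 + ω ^ 2 := by positivity
  rw [res_apply, Complex.norm_real, norm_smul, mul_pow, Real.norm_eq_abs, Real.norm_eq_abs, sq_abs,
    sq_abs, div_pow, Real.sq_sqrt h0.le, show (-4 / 2 : ℝ) = -((2 : ℕ) : ℝ) by norm_num,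
    Real.rpow_neg (by positivity), Real.rpow_natCast, ← mul_inv, ← mul_pow, inv_pow]
  congr 2
  rw [qf]
  field_simp

lemma integrable_norm_res_sq {c : ℝ} (hc : 0 < c) (ω : ℝ) :
    Integrable fun ξ => ‖res c ω ξ‖ ^ 2 := by
  simp only [norm_res_sq_eq hc]
  refine Integrable.const_mul ?_ _
  have h := integrable_rpow_neg_one_add_norm_sq (E := R3) (μ := volume) (r := 4) (by norm_num)
  exact h.comp_smul (R := c / √(1 + ω ^ 2)) (by positivity)

lemma memLp_res {c : ℝ} (hc : 0 < c) (ω : ℝ) : MemLp (res c ω) 2 volume :=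
  (memLp_two_iff_integrable_sq_norm (res c ω).continuous.aestronglyMeasurable).2
    (integrable_norm_res_sq hc ω)

/-- The symbol of `(D_0² + ω²)⁻¹` as an element of `L²`. -/
def resL {c : ℝ} (hc : 0 < c) (ω : ℝ) : L2 ℂ := (memLp_res hc ω).toLp

lemma norm_sq_Lp {G : Type} [NormedAddCommGroup G] (f : L2 G) : ‖f‖ ^ 2 = ∫ x, ‖f x‖ ^ 2 := by
  rw [Lp.norm_def, (Lp.memLp f).eLpNorm_eq_integral_rpow_norm (by norm_num) (by norm_num)]
  rw [ENNReal.toReal_ofReal (by positivity), ← Real.rpow_natCast, ← Real.rpow_mul (by positivity)]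
  simp

/-- Rescaling ξ by c/√(1 + ω²) removes ω from the integrand. It leaves (1 + ω²)^{-2} from the
squared symbol and (1 + ω²)^{3/2} from the volume in three dimensions; the square root of the
product is wt ω. -/
lemma norm_resL {c : ℝ} (hc : 0 < c) (ω : ℝ) : ‖resL hc ω‖ = resConst c * wt ω := by
  have h0 : (0 : ℝ) < 1 + ω ^ 2 := by positivity
  refine (sq_eq_sq₀ (norm_nonneg _) (mul_nonneg (Real.sqrt_nonneg _) (wt_pos ω).le)).1 ?_
  have hI : 0 ≤ ∫ ξ : R3, ((1 : ℝ) + ‖ξ‖ ^ 2) ^ (-4 / 2 : ℝ) :=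
    integral_nonneg fun ξ => by positivity
  have e : ∫ ξ, ‖resL hc ω ξ‖ ^ 2 = ∫ ξ, ‖res c ω ξ‖ ^ 2 := by
    refine integral_congr_ae ?_
    filter_upwards [(memLp_res hc ω).coeFn_toLp] with ξ hξ
    rw [resL, hξ]
  rw [norm_sq_Lp, e]
  simp only [norm_res_sq_eq hc]
  rw [integral_const_mul, Measure.integral_comp_smul volume
    (fun ξ : R3 => ((1 : ℝ) + ‖ξ‖ ^ 2) ^ (-4 / 2 : ℝ)), mul_pow, wt_sq,
    Real.sq_sqrt (by positivity), abs_of_nonneg (by positivity), smul_eq_mul]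
  have h3 : Module.finrank ℝ R3 = 3 := by simp
  rw [h3]
  have hs : √(1 + ω ^ 2) ^ 2 = 1 + ω ^ 2 := Real.sq_sqrt h0.le
  have hs0 : 0 < √(1 + ω ^ 2) := Real.sqrt_pos.2 h0
  have : ((1 + ω ^ 2) ^ 2)⁻¹ * ((c / √(1 + ω ^ 2)) ^ 3)⁻¹ = (c ^ 3)⁻¹ * (√(1 + ω ^ 2))⁻¹ := by
    have h4 : (1 + ω ^ 2) ^ 2 = √(1 + ω ^ 2) ^ 4 := by rw [← hs]; ring_nf; rw [hs]
    rw [h4]; field_simp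
  rw [← mul_assoc, this]
  ring

lemma resL_sub_norm_le {c : ℝ} (hc : 0 < c) (ω τ : ℝ) :
    ‖resL hc ω - resL hc τ‖ ≤ |τ ^ 2 - ω ^ 2| * ‖resL hc ω‖ := by
  refine Lp.norm_le_mul_norm_of_ae_le_mul ?_
  filter_upwards [(memLp_res hc ω).coeFn_toLp, (memLp_res hc τ).coeFn_toLp,
    Lp.coeFn_sub (resL hc ω) (resL hc τ)] with ξ h1 h2 h3
  rw [h3, Pi.sub_apply, resL, resL, h1, h2]
  have := DFunLike.congr_fun (res_sub c ω τ) ξ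
  simp only [BoundedContinuousFunction.coe_sub, Pi.sub_apply, BoundedContinuousFunction.coe_smul,
    BoundedContinuousFunction.coe_mul, Pi.mul_apply, smul_eq_mul] at this
  rw [this, norm_mul, Complex.norm_real, norm_mul, Real.norm_eq_abs]
  refine mul_le_mul_of_nonneg_left ?_ (abs_nonneg _)
  refine mul_le_of_le_one_right (norm_nonneg _) ?_
  exact (norm_ofReal_inv_qf_le c τ ξ).trans (inv_le_one_of_one_le₀ (by nlinarith [sq_nonneg τ]))

lemma continuous_resL {c : ℝ} (hc : 0 < c) : Continuous (resL hc) := by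
  rw [continuous_iff_continuousAt]
  intro ω
  rw [ContinuousAt, tendsto_iff_norm_sub_tendsto_zero]
  have h : Tendsto (fun τ : ℝ => |τ ^ 2 - ω ^ 2| * ‖resL hc ω‖) (𝓝 ω) (𝓝 0) := by
    have : Continuous fun τ : ℝ => |τ ^ 2 - ω ^ 2| * ‖resL hc ω‖ := by fun_prop
    simpa using this.tendsto ω
  refine squeeze_zero (fun _ => norm_nonneg _) (fun τ => ?_) h
  rw [norm_sub_rev]
  exact resL_sub_norm_le hc ω τ

/-- The free resolvent `(D_0² + ω²)⁻¹`. -/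
def R (c ω : ℝ) : L2 C4 →L[ℂ] L2 C4 := fmul (res c ω)

lemma norm_R_le (c ω : ℝ) : ‖R c ω‖ ≤ (1 + ω ^ 2)⁻¹ := (norm_fmul_le _).trans (norm_res_le c ω)

lemma norm_R_le_one (c ω : ℝ) : ‖R c ω‖ ≤ 1 :=
  (norm_R_le c ω).trans (inv_le_one_of_one_le₀ (by nlinarith [sq_nonneg ω]))

lemma R_sub (c ω τ : ℝ) : R c ω - R c τ = ((τ ^ 2 - ω ^ 2 : ℝ) : ℂ) • (R c ω * R c τ) := by
  have h : (fmul (res c ω - res c τ) : L2 C4 →L[ℂ] L2 C4) = R c ω - R c τ := by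
    rw [eq_sub_iff_add_eq, R, R, ← fmul_add, sub_add_cancel]
  rw [← h, res_sub, fmul_smul, fmul_mul]
  rfl

lemma R_commute (c ω τ : ℝ) : R c ω * R c τ = R c τ * R c ω := by
  rw [R, R, ← fmul_mul, mul_comm, fmul_mul]

lemma inner_R_left (c ω : ℝ) (u v : L2 C4) : ⟪R c ω u, v⟫_ℂ = ⟪u, R c ω v⟫_ℂ := by
  rw [R, inner_fmul_left, star_res]

lemma continuous_R (c : ℝ) : Continuous (R c) := by
  rw [continuous_iff_continuousAt]
  intro ω
  rw [ContinuousAt, tendsto_iff_norm_sub_tendsto_zero]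
  have h : Tendsto (fun τ : ℝ => |ω ^ 2 - τ ^ 2|) (𝓝 ω) (𝓝 0) := by
    have : Continuous fun τ : ℝ => |ω ^ 2 - τ ^ 2| := by fun_prop
    simpa using this.tendsto ω
  refine squeeze_zero (fun _ => norm_nonneg _) (fun τ => ?_) h
  rw [R_sub, norm_smul, Complex.norm_real, Real.norm_eq_abs]
  exact mul_le_of_le_one_right (abs_nonneg _) ((norm_mul_le _ _).trans
    (mul_le_one₀ (norm_R_le_one c τ) (norm_nonneg _) (norm_R_le_one c ω)))

lemma R_injective (c ω : ℝ) {u : L2 C4} (h : R c ω u = 0) : u = 0 := by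
  refine fourier_injective (Lp.ext ?_)
  have h0 : (𝓕 (0 : L2 C4) : L2 C4) = 0 := map_zero (Lp.fourierTransformₗᵢ R3 C4)
  have h1 := fourier_fmul_ae (res c ω) u
  rw [show fmul (res c ω) u = 0 from h, h0] at h1
  rw [h0]
  filter_upwards [h1, Lp.coeFn_zero C4 2 (volume : Measure R3)] with ξ h2 h3
  rw [h3, Pi.zero_apply] at h2
  rw [h3, Pi.zero_apply]
  refine (smul_eq_zero.1 h2.symm).resolve_left ?_
  rw [res_apply]
  exact_mod_cast inv_ne_zero (qf_pos c ω ξ).ne'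

/-! ### The Sobolev space `H²` -/

lemma abs_coord_le (ξ : R3) (j : Fin 3) : |ξ j| ≤ ‖ξ‖ := by
  simpa using PiLp.norm_apply_le ξ j

/-- The symbol of `∂_j (D_0²)⁻¹`. -/
def dres {c : ℝ} (hc : 0 < c) (j : Fin 3) : R3 →ᵇ ℂ :=
  BoundedContinuousFunction.ofNormedAddCommGroup
    (fun ξ => 2 * Real.pi * Complex.I * (ξ j : ℂ) * res c 0 ξ)
    (by have := (res c 0).continuous; fun_prop) (2 * Real.pi * c⁻¹)
    (fun ξ => by
      rw [norm_mul, norm_mul, norm_mul, norm_mul, res_apply, Complex.norm_real, Complex.norm_real,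
        Complex.norm_real, Complex.norm_I, Complex.norm_two, mul_one, Real.norm_of_nonneg Real.pi_pos.le,
        mul_assoc]
      refine mul_le_mul_of_nonneg_left ?_ (by positivity)
      have hq := qf_pos c 0 ξ
      rw [Real.norm_of_nonneg (inv_nonneg.2 hq.le), ← div_eq_mul_inv, div_le_iff₀ hq,
        ← div_eq_inv_mul, le_div_iff₀ hc, Real.norm_eq_abs]
      have := abs_coord_le ξ j
      rw [qf]
      nlinarith [sq_nonneg (c * ‖ξ‖ - 1), norm_nonneg ξ, mul_le_mul_of_nonneg_right this hc.le])

/-- The symbol of `∂_j ∂_k (D_0²)⁻¹`. -/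
def ddres {c : ℝ} (hc : 0 < c) (j k : Fin 3) : R3 →ᵇ ℂ :=
  BoundedContinuousFunction.ofNormedAddCommGroup
    (fun ξ => 2 * Real.pi * Complex.I * (ξ j : ℂ) * dres hc k ξ)
    (by have := (dres hc k).continuous; fun_prop) (4 * Real.pi ^ 2 * (c ^ 2)⁻¹)
    (fun ξ => by
      change ‖2 * Real.pi * Complex.I * (ξ j : ℂ) *
        (2 * Real.pi * Complex.I * (ξ k : ℂ) * res c 0 ξ)‖ ≤ _
      simp only [norm_mul, res_apply, Complex.norm_real, Complex.norm_I, Complex.norm_two,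
        Real.norm_of_nonneg Real.pi_pos.le]
      have hq := qf_pos c 0 ξ
      rw [Real.norm_of_nonneg (inv_nonneg.2 hq.le), Real.norm_eq_abs, Real.norm_eq_abs]
      have h1 := abs_coord_le ξ j
      have h2 := abs_coord_le ξ k
      have h3 : |ξ j| * |ξ k| * (qf c 0 ξ)⁻¹ ≤ (c ^ 2)⁻¹ := by
        rw [← div_eq_mul_inv, div_le_iff₀ hq, ← div_eq_inv_mul, le_div_iff₀ (by positivity)]
        have : |ξ j| * |ξ k| ≤ ‖ξ‖ * ‖ξ‖ := mul_le_mul h1 h2 (abs_nonneg _) (norm_nonneg _)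
        rw [qf]
        nlinarith [mul_le_mul_of_nonneg_right this (sq_nonneg c)]
      calc _ = 4 * Real.pi ^ 2 * (|ξ j| * |ξ k| * (qf c 0 ξ)⁻¹) := by ring
        _ ≤ _ := mul_le_mul_of_nonneg_left h3 (by positivity))

lemma hasWeakDeriv_R {c : ℝ} (hc : 0 < c) (j : Fin 3) (f : L2 C4) :
    HasWeakDeriv j (R c 0 f) (fmul (dres hc j) f) :=
  hasWeakDeriv_fmul (fun _ => rfl) f

lemma hasWeakDeriv_dR {c : ℝ} (hc : 0 < c) (j k : Fin 3) (f : L2 C4) :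
    HasWeakDeriv j (fmul (dres hc k) f) (fmul (ddres hc j k) f) :=
  hasWeakDeriv_fmul (fun _ => rfl) f

/-- The components `∂^a u` of `u ∈ H²`. -/
def H2.comp (a : Unit ⊕ (Fin 3 ⊕ Fin 3 × Fin 3)) : H2 →L[ℂ] L2 C4 :=
  (PiLp.proj 2 (fun _ : Unit ⊕ (Fin 3 ⊕ Fin 3 × Fin 3) => L2 C4) a) ∘L H2space.subtypeL

/-- `D_0² = 1 - ε²Δ` as an operator from `H²` to `L²`. -/
def Jop (ε : ℝ) : H2 →L[ℂ] L2 C4 :=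
  H2.comp (.inl ()) - ((ε ^ 2 : ℝ) : ℂ) • ∑ j, H2.comp (.inr (.inr (j, j)))

lemma H2.comp_fn (u : H2) : H2.comp (.inl ()) u = u.fn := rfl

lemma H2.hasWeakDeriv (u : H2) (j : Fin 3) : HasWeakDeriv j u.fn (H2.comp (.inr (.inl j)) u) :=
  u.2.1 j

lemma H2.hasWeakDeriv₂ (u : H2) (j k : Fin 3) :
    HasWeakDeriv j (H2.comp (.inr (.inl k)) u) (H2.comp (.inr (.inr (j, k))) u) := u.2.2 j k

lemma fourier_Jop_ae (ε : ℝ) (u : H2) :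
    ∀ᵐ ξ, (𝓕 (Jop ε u) : L2 C4) ξ = (qf (2 * Real.pi * ε) 0 ξ : ℂ) • (𝓕 u.fn : L2 C4) ξ := by
  have h1 : ∀ᵐ ξ, ∀ j, (𝓕 (H2.comp (.inr (.inl j)) u) : L2 C4) ξ
      = (2 * Real.pi * Complex.I * (ξ j : ℂ)) • (𝓕 u.fn : L2 C4) ξ :=
    ae_all_iff.2 fun j => (hasWeakDeriv_iff_fourier j _ _).1 (u.hasWeakDeriv j)
  have h2 : ∀ᵐ ξ, ∀ j, (𝓕 (H2.comp (.inr (.inr (j, j))) u) : L2 C4) ξ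
      = (2 * Real.pi * Complex.I * (ξ j : ℂ)) • (𝓕 (H2.comp (.inr (.inl j)) u) : L2 C4) ξ :=
    ae_all_iff.2 fun j => (hasWeakDeriv_iff_fourier j _ _).1 (u.hasWeakDeriv₂ j j)
  have e : (𝓕 (Jop ε u) : L2 C4) = 𝓕 u.fn
      - ((ε ^ 2 : ℝ) : ℂ) • ∑ j, (𝓕 (H2.comp (.inr (.inr (j, j))) u) : L2 C4) := by
    have : Jop ε u = u.fn - ((ε ^ 2 : ℝ) : ℂ) • ∑ j, H2.comp (.inr (.inr (j, j))) u := by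
      simp [Jop, H2.comp_fn]
    rw [this]
    change Lp.fourierTransformₗᵢ R3 C4 _ = Lp.fourierTransformₗᵢ R3 C4 _
      - _ • ∑ j, Lp.fourierTransformₗᵢ R3 C4 _
    rw [map_sub, map_smul, map_sum]
  rw [e]
  have h3 := Lp.coeFn_sub (𝓕 u.fn : L2 C4)
    (((ε ^ 2 : ℝ) : ℂ) • ∑ j, (𝓕 (H2.comp (.inr (.inr (j, j))) u) : L2 C4))
  have h4 := Lp.coeFn_smul ((ε ^ 2 : ℝ) : ℂ)
    (∑ j, (𝓕 (H2.comp (.inr (.inr (j, j))) u) : L2 C4))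
  have h5 := Lp.coeFn_finsetSum (Finset.univ : Finset (Fin 3))
    (fun j => (𝓕 (H2.comp (.inr (.inr (j, j))) u) : L2 C4))
  filter_upwards [h1, h2, h3, h4, h5] with ξ k1 k2 k3 k4 k5
  rw [k3, Pi.sub_apply, k4, Pi.smul_apply, k5, Finset.sum_apply]
  simp only [k2, k1, smul_smul, ← Finset.sum_smul]
  conv_lhs => enter [1]; rw [← one_smul ℂ ((𝓕 u.fn : L2 C4) ξ)]
  rw [← sub_smul]
  congr 1
  rw [qf, EuclideanSpace.norm_sq_eq]
  simp only [Fin.sum_univ_three, Real.norm_eq_abs, sq_abs]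
  push_cast
  linear_combination (-4 * (Real.pi : ℂ) ^ 2 * (ε : ℂ) ^ 2 *
    ((ξ 0 : ℂ) ^ 2 + (ξ 1 : ℂ) ^ 2 + (ξ 2 : ℂ) ^ 2)) * Complex.I_sq

/-- `R_0 = (D_0²)⁻¹` inverts `D_0² : H² → L²`. -/
lemma R_Jop (ε : ℝ) (u : H2) : R (2 * Real.pi * ε) 0 (Jop ε u) = u.fn := by
  refine (eq_fmul ?_).symm
  filter_upwards [fourier_Jop_ae ε u] with ξ h
  rw [h, smul_smul, res_apply, ← Complex.ofReal_mul, inv_mul_cancel₀ (qf_pos _ _ _).ne']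
  simp

/-- Every function in the range of `R_0` belongs to `H²`. -/
lemma exists_H2 {ε : ℝ} (hε : 0 < ε) (f : L2 C4) :
    ∃ u : H2, u.fn = R (2 * Real.pi * ε) 0 f ∧ Jop ε u = f := by
  have hc : 0 < 2 * Real.pi * ε := by positivity
  let w : PiLp 2 fun _ : Unit ⊕ (Fin 3 ⊕ Fin 3 × Fin 3) => L2 C4 := WithLp.toLp 2 fun
    | .inl _ => R (2 * Real.pi * ε) 0 f
    | .inr (.inl j) => fmul (dres hc j) f
    | .inr (.inr (j, k)) => fmul (ddres hc j k) f
  let u : H2 := ⟨w, fun j => hasWeakDeriv_R hc j f, fun j k => hasWeakDeriv_dR hc j k f⟩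
  refine ⟨u, rfl, ?_⟩
  have h := R_Jop ε u
  have h2 : R (2 * Real.pi * ε) 0 (Jop ε u - f) = 0 := by
    rw [map_sub, h, sub_eq_zero]; rfl
  exact sub_eq_zero.1 (R_injective _ _ h2)

end FreeResolvent
end DiracVacuum
end

noncomputable section

namespace DiracVacuum

open FourierTransform
open scoped BoundedContinuousFunction ENNReal

/-! ### The embedding of `H¹` into `L⁴` -/

section Embedding

/-- For self-adjoint `h` and `m` the operator `h m h` is bounded by the norm of `m h²`. -/
lemma norm_conj_le_norm_mul_sq {A : Type} [CStarAlgebra A] {h m : A}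
    (hh : IsSelfAdjoint h) (hm : IsSelfAdjoint m) : ‖h * (m * h)‖ ≤ ‖m * h * h‖ := by
  rcases subsingleton_or_nontrivial A with hA | hA
  · rw [Subsingleton.elim (h * (m * h)) (m * h * h)]
  have hs : IsSelfAdjoint (h * (m * h)) := by
    rw [IsSelfAdjoint, star_mul, star_mul, hh.star_eq, hm.star_eq, mul_assoc]
  -- h(mh) and (mh)h have the same nonzero spectrum, and the spectral radius of the self-adjoint
  -- element hmh is its norm.
  have hle : spectralRadius ℂ (h * (m * h)) ≤ spectralRadius ℂ (m * h * h) := by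
    refine iSup₂_le fun k hk => ?_
    rcases eq_or_ne k 0 with rfl | h0
    · simp
    · have : k ∈ spectrum ℂ (h * (m * h)) \ {0} := ⟨hk, h0⟩
      rw [spectrum.nonzero_mul_comm] at this
      exact le_iSup₂ (f := fun (k : ℂ) (_ : k ∈ spectrum ℂ (m * h * h)) => (‖k‖₊ : ℝ≥0∞)) k this.1
  rw [hs.spectralRadius_eq_nnnorm] at hle
  exact_mod_cast hle.trans (spectrum.spectralRadius_le_nnnorm _)

/-- Multiplication by a bounded function. -/
def mulInf : Lp ℂ ∞ (volume : Measure R3) →L[ℂ] L2 C4 →L[ℂ] L2 C4 :=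
  (ContinuousLinearMap.lsmul ℂ ℂ : ℂ →L[ℂ] C4 →L[ℂ] C4).holderL volume ∞ 2 2

lemma mulInf_ae (g : Lp ℂ ∞ (volume : Measure R3)) (u : L2 C4) :
    ∀ᵐ x, mulInf g u x = g x • u x :=
  (ContinuousLinearMap.lsmul ℂ ℂ : ℂ →L[ℂ] C4 →L[ℂ] C4).coeFn_holder (r := 2) g u

lemma isSelfAdjoint_mulInf {g : Lp ℂ ∞ (volume : Measure R3)} (hg : ∀ᵐ x, star (g x) = g x) :
    IsSelfAdjoint (mulInf g) := by
  rw [ContinuousLinearMap.isSelfAdjoint_iff_isSymmetric]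
  intro u v
  change ⟪mulInf g u, v⟫_ℂ = ⟪u, mulInf g v⟫_ℂ
  rw [L2.inner_def, L2.inner_def]
  refine integral_congr_ae ?_
  filter_upwards [mulInf_ae g u, mulInf_ae g v, hg] with x h1 h2 h3
  rw [h1, h2, inner_smul_left, inner_smul_right, starRingEnd_apply, h3]

/-- The symbol of `(D_0²)^{-1/2}` with `ε = 1 / (2π)`-units. -/
def hres : R3 →ᵇ ℂ :=
  BoundedContinuousFunction.ofNormedAddCommGroup (fun ξ => (((√(qf (2 * Real.pi) 0 ξ))⁻¹ : ℝ) : ℂ))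
    (Complex.continuous_ofReal.comp ((continuous_qf _ 0).sqrt.inv₀
      fun ξ => (Real.sqrt_pos.2 (qf_pos _ 0 ξ)).ne')) 1 (fun ξ => by
    rw [Complex.norm_real, Real.norm_of_nonneg (by positivity)]
    refine inv_le_one_of_one_le₀ (Real.one_le_sqrt.2 ?_)
    simpa using one_add_sq_le_qf (2 * Real.pi) 0 ξ)

lemma hres_apply (ξ : R3) : hres ξ = (((√(qf (2 * Real.pi) 0 ξ))⁻¹ : ℝ) : ℂ) := rfl

lemma hres_mul_self : hres * hres = res (2 * Real.pi) 0 := by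
  ext ξ
  rw [BoundedContinuousFunction.mul_apply, hres_apply, res_apply, ← Complex.ofReal_mul, ← mul_inv,
    Real.mul_self_sqrt (qf_pos _ _ _).le]

lemma star_hres : star hres = hres := by
  ext ξ
  simp [hres_apply]

/-- The symbol of `∂_j (D_0²)^{-1/2}`. -/
def dhres (j : Fin 3) : R3 →ᵇ ℂ :=
  BoundedContinuousFunction.ofNormedAddCommGroup
    (fun ξ => 2 * Real.pi * Complex.I * (ξ j : ℂ) * hres ξ)
    (by have := hres.continuous; fun_prop) 1
    (fun ξ => by
      have hq := qf_pos (2 * Real.pi) 0 ξ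
      simp only [norm_mul, hres_apply, Complex.norm_real, Complex.norm_I, Complex.norm_two,
        Real.norm_of_nonneg Real.pi_pos.le, mul_one]
      rw [Real.norm_of_nonneg (inv_nonneg.2 (Real.sqrt_nonneg (qf (2 * Real.pi) 0 ξ))),
        ← div_eq_mul_inv, div_le_one (Real.sqrt_pos.2 hq)]
      refine Real.le_sqrt_of_sq_le ?_
      rw [mul_pow, Real.norm_eq_abs, qf]
      have := pow_le_pow_left₀ (abs_nonneg _) (abs_coord_le ξ j) 2
      nlinarith [sq_nonneg (2 * Real.pi)])

lemma dhres_apply (j : Fin 3) (ξ : R3) :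
    dhres j ξ = 2 * Real.pi * Complex.I * (ξ j : ℂ) * hres ξ := rfl

lemma norm_hres_le : ‖hres‖ ≤ 1 :=
  BoundedContinuousFunction.norm_ofNormedAddCommGroup_le _ zero_le_one _

lemma norm_dhres_le (j : Fin 3) : ‖dhres j‖ ≤ 1 :=
  BoundedContinuousFunction.norm_ofNormedAddCommGroup_le _ zero_le_one _

/-- Functions in `H¹` belong to the range of `(1 - Δ)^{-1/2}`. -/
lemma exists_eq_fmul_hres {u : L2 C4} {g : Fin 3 → L2 C4} (hg : ∀ j, HasWeakDeriv j u (g j)) :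
    ∃ v : L2 C4, u = fmul hres v ∧ ‖v‖ ≤ ‖u‖ + ∑ j, ‖g j‖ := by
  have hb : ∀ (m : R3 →ᵇ ℂ) (w : L2 C4), ‖m‖ ≤ 1 → ‖fmul m w‖ ≤ ‖w‖ := fun m w hm =>
    (ContinuousLinearMap.le_of_opNorm_le _ ((norm_fmul_le m).trans hm) w).trans_eq (one_mul _)
  -- The witness is v = (1 − Δ)^{1/2}u, written as hu − Σ_j (∂_j h)∂_ju with h = (1 − Δ)^{-1/2}, so
  -- that only multipliers bounded by 1 occur.
  refine ⟨fmul hres u - ∑ j, fmul (dhres j) (g j), ?_, ?_⟩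
  · refine fourier_injective (Lp.ext ?_)
    have e : (𝓕 (fmul hres u - ∑ j, fmul (dhres j) (g j)) : L2 C4)
        = 𝓕 (fmul hres u) - ∑ j, (𝓕 (fmul (dhres j) (g j)) : L2 C4) := by
      change Lp.fourierTransformₗᵢ R3 C4 _ = Lp.fourierTransformₗᵢ R3 C4 _
        - ∑ j, Lp.fourierTransformₗᵢ R3 C4 _
      rw [map_sub, map_sum]
    have h1 : ∀ᵐ ξ, ∀ j, (𝓕 (g j) : L2 C4) ξ
        = (2 * Real.pi * Complex.I * (ξ j : ℂ)) • (𝓕 u : L2 C4) ξ :=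
      ae_all_iff.2 fun j => (hasWeakDeriv_iff_fourier j _ _).1 (hg j)
    have h2 : ∀ᵐ ξ, ∀ j, (𝓕 (fmul (dhres j) (g j)) : L2 C4) ξ = dhres j ξ • (𝓕 (g j) : L2 C4) ξ :=
      ae_all_iff.2 fun j => fourier_fmul_ae _ _
    have h3 := fourier_fmul_ae hres (fmul hres u - ∑ j, fmul (dhres j) (g j))
    rw [e] at h3
    have h4 := Lp.coeFn_sub (𝓕 (fmul hres u)) (∑ j, (𝓕 (fmul (dhres j) (g j)) : L2 C4))
    have h5 := Lp.coeFn_finsetSum (Finset.univ : Finset (Fin 3))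
      (fun j => (𝓕 (fmul (dhres j) (g j)) : L2 C4))
    filter_upwards [h1, h2, h3, h4, h5, fourier_fmul_ae hres u] with ξ k1 k2 k3 k4 k5 k6
    rw [k3, k4, Pi.sub_apply, k5, Finset.sum_apply, k6]
    simp only [k2, k1, smul_smul, ← Finset.sum_smul]
    rw [← sub_smul, smul_smul]
    conv_lhs => rw [← one_smul ℂ ((𝓕 u : L2 C4) ξ)]
    congr 1
    have hq := qf_pos (2 * Real.pi) 0 ξ
    have hh : hres ξ * hres ξ = ((qf (2 * Real.pi) 0 ξ : ℝ) : ℂ)⁻¹ := by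
      rw [hres_apply, ← Complex.ofReal_mul, ← mul_inv, Real.mul_self_sqrt hq.le, Complex.ofReal_inv]
    have hq' : ((qf (2 * Real.pi) 0 ξ : ℝ) : ℂ)
        = 1 + 4 * (Real.pi : ℂ) ^ 2 * ((ξ 0 : ℂ) ^ 2 + (ξ 1 : ℂ) ^ 2 + (ξ 2 : ℂ) ^ 2) := by
      rw [qf, EuclideanSpace.norm_sq_eq]
      simp only [Fin.sum_univ_three, Real.norm_eq_abs, sq_abs]
      push_cast
      ring
    have h1 : (1 : ℂ) = hres ξ * hres ξ * ((qf (2 * Real.pi) 0 ξ : ℝ) : ℂ) := by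
      rw [hh, inv_mul_cancel₀ (by exact_mod_cast hq.ne')]
    rw [h1, hq']
    simp only [Fin.sum_univ_three, dhres_apply]
    linear_combination (4 * (Real.pi : ℂ) ^ 2 * ((ξ 0 : ℂ) ^ 2 + (ξ 1 : ℂ) ^ 2 + (ξ 2 : ℂ) ^ 2)
      * hres ξ * hres ξ) * Complex.I_sq
  · refine (norm_sub_le _ _).trans (add_le_add (hb _ _ norm_hres_le) ?_)
    exact (norm_sum_le _ _).trans (Finset.sum_le_sum fun j _ => hb _ _ (norm_dhres_le j))

/-- The Sobolev constant. -/
def sobConst : ℝ := 2 * ‖resL (c := 2 * Real.pi) (by positivity) 0‖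

lemma sobConst_nonneg : 0 ≤ sobConst := by unfold sobConst; positivity

lemma norm_clm_conj_le {H : Type} [NormedAddCommGroup H] [InnerProductSpace ℂ H] [CompleteSpace H]
    {h m : H →L[ℂ] H} (hh : IsSelfAdjoint h) (hm : IsSelfAdjoint m) :
    ‖h * (m * h)‖ ≤ ‖m * h * h‖ := norm_conj_le_norm_mul_sq hh hm

/-- The symbol of h² = (1 − Δ)⁻¹ is square integrable, so h²f is bounded pointwise by a multiple of
the L² norm of f, and multiplication by g costs only its L² norm. -/
lemma norm_mulInf_res_le {g : Lp ℂ ∞ (volume : Measure R3)} (g2 : L2 ℂ)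
    (hg2 : ∀ᵐ x, g2 x = g x) : ‖mulInf g * fmul hres * fmul hres‖ ≤ sobConst * ‖g2‖ := by
  refine ContinuousLinearMap.opNorm_le_bound _ (mul_nonneg sobConst_nonneg (norm_nonneg _))
    fun f => ?_
  rw [mul_assoc, ← fmul_mul, hres_mul_self, mul_right_comm]
  change ‖mulInf g (fmul (res (2 * Real.pi) 0) f)‖ ≤ _
  refine Lp.norm_le_mul_norm_of_ae_le_mul ?_
  filter_upwards [mulInf_ae g (fmul (res (2 * Real.pi) 0) f), hg2,
    fmul_ae_evFun _ (memLp_res (c := 2 * Real.pi) (by positivity) 0) f] with x k1 k2 k3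
  rw [k1, norm_smul, k3, k2, mul_comm]
  exact mul_le_mul_of_nonneg_right (norm_evFun_le _ _ _) (norm_nonneg _)

lemma isSelfAdjoint_hres : IsSelfAdjoint (fmul hres : L2 C4 →L[ℂ] L2 C4) := by
  rw [ContinuousLinearMap.isSelfAdjoint_iff_isSymmetric]
  intro u v
  have h := inner_fmul_left hres u v
  rw [star_hres] at h
  exact h

/-- ⟨hv, g hv⟩ = ⟨v, hgh v⟩, and the norm of hgh is at most that of gh²: a half power of the
resolvent on each side is traded for a full power on one side. -/
lemma norm_inner_mulInf_le {g : Lp ℂ ∞ (volume : Measure R3)} (hg : ∀ᵐ x, star (g x) = g x)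
    (g2 : L2 ℂ) (hg2 : ∀ᵐ x, g2 x = g x) (v : L2 C4) :
    ‖⟪fmul hres v, mulInf g (fmul hres v)⟫_ℂ‖ ≤ sobConst * ‖g2‖ * ‖v‖ ^ 2 := by
  have h1 := norm_clm_conj_le isSelfAdjoint_hres (isSelfAdjoint_mulInf hg)
  have h3 := ContinuousLinearMap.le_of_opNorm_le _ (h1.trans (norm_mulInf_res_le g2 hg2)) v
  have h4 : ⟪fmul hres v, mulInf g (fmul hres v)⟫_ℂ
      = ⟪v, fmul hres (mulInf g (fmul hres v))⟫_ℂ := by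
    rw [inner_fmul_left, star_hres]
  rw [h4]
  refine (norm_inner_le_norm _ _).trans ((mul_le_mul_of_nonneg_left h3 (norm_nonneg v)).trans_eq ?_)
  ring

lemma aestronglyMeasurable_trunc (u : L2 C4) (n : ℕ) :
    AEStronglyMeasurable (fun x => min ‖u x‖ (n : ℝ)) volume :=
  ((Lp.aestronglyMeasurable u).norm.aemeasurable.min aemeasurable_const).aestronglyMeasurable

lemma memLp_trunc_sq (u : L2 C4) (n : ℕ) :
    MemLp (fun x => (((min ‖u x‖ (n : ℝ)) ^ 2 : ℝ) : ℂ)) 2 volume := by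
  refine ((Lp.memLp u).norm.const_mul (n : ℝ)).mono
    (Complex.continuous_ofReal.comp_aestronglyMeasurable
      ((aestronglyMeasurable_trunc u n).pow 2)) (.of_forall fun x => ?_)
  have h1 : 0 ≤ min ‖u x‖ (n : ℝ) := le_min (norm_nonneg _) n.cast_nonneg
  rw [Complex.norm_real, Real.norm_of_nonneg (by positivity), Real.norm_of_nonneg (by positivity), sq]
  exact mul_comm (n : ℝ) _ ▸ mul_le_mul (min_le_left _ _) (min_le_right _ _) h1 (norm_nonneg _)

lemma memLp_top_trunc_sq (u : L2 C4) (n : ℕ) :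
    MemLp (fun x => (((min ‖u x‖ (n : ℝ)) ^ 2 : ℝ) : ℂ)) ∞ volume := by
  refine memLp_top_of_bound (memLp_trunc_sq u n).1 ((n : ℝ) ^ 2) (.of_forall fun x => ?_)
  have h1 : 0 ≤ min ‖u x‖ (n : ℝ) := le_min (norm_nonneg _) n.cast_nonneg
  rw [Complex.norm_real, Real.norm_of_nonneg (by positivity)]
  exact pow_le_pow_left₀ h1 (min_le_right _ _) 2

/-- A self-improving estimate: g = min(|u|, n)² satisfies ‖g‖₂² ≤ ⟨u, gu⟩ ≤ C‖g‖₂‖v‖², and one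
factor ‖g‖₂ cancels. The truncation ensures beforehand that g is bounded and square integrable. -/
lemma norm_trunc_sq_le (v : L2 C4) (n : ℕ) :
    ‖(memLp_trunc_sq (fmul hres v) n).toLp‖ ≤ sobConst * ‖v‖ ^ 2 := by
  set u := fmul hres v with hu
  set g2 : L2 ℂ := (memLp_trunc_sq u n).toLp with hg2
  set g : Lp ℂ ∞ (volume : Measure R3) := (memLp_top_trunc_sq u n).toLp with hg
  have e1 : ∀ᵐ x, g2 x = (((min ‖u x‖ (n : ℝ)) ^ 2 : ℝ) : ℂ) := (memLp_trunc_sq u n).coeFn_toLp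
  have e2 : ∀ᵐ x, g x = (((min ‖u x‖ (n : ℝ)) ^ 2 : ℝ) : ℂ) := (memLp_top_trunc_sq u n).coeFn_toLp
  have h1 := norm_inner_mulInf_le (g := g)
    (by filter_upwards [e2] with x hx; rw [hx]; simp) g2
    (by filter_upwards [e1, e2] with x h1 h2; rw [h1, h2]) v
  have h2 : ‖g2‖ ^ 2 ≤ ‖⟪u, mulInf g u⟫_ℂ‖ := by
    have e3 : ∀ᵐ x, ⟪u x, mulInf g u x⟫_ℂ = (((min ‖u x‖ (n : ℝ)) ^ 2 * ‖u x‖ ^ 2 : ℝ) : ℂ) := by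
      filter_upwards [e2, mulInf_ae g u] with x k1 k2
      rw [k2, k1, inner_smul_right, inner_self_eq_norm_sq_to_K]
      push_cast
      rfl
    have hi : Integrable fun x => (min ‖u x‖ (n : ℝ)) ^ 2 * ‖u x‖ ^ 2 := by
      have := (L2.integrable_inner (𝕜 := ℂ) u (mulInf g u)).congr e3
      refine this.re.congr (.of_forall fun x => ?_)
      exact Complex.ofReal_re _
    rw [L2.inner_def, integral_congr_ae e3, integral_complex_ofReal, norm_sq_Lp]
    refine le_trans ?_ (le_abs_self _ |>.trans_eq (Complex.norm_real _).symm)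
    refine integral_mono_ae ((memLp_two_iff_integrable_sq_norm (Lp.aestronglyMeasurable g2)).1
      (Lp.memLp g2)) hi ?_
    filter_upwards [e1] with x k1
    have h1 : 0 ≤ min ‖u x‖ (n : ℝ) := le_min (norm_nonneg _) n.cast_nonneg
    rw [k1, Complex.norm_real, Real.norm_of_nonneg (by positivity), sq (_ ^ 2)]
    exact mul_le_mul_of_nonneg_left (pow_le_pow_left₀ h1 (min_le_left _ _) 2) (by positivity)
  rcases (norm_nonneg g2).eq_or_lt with h0 | h0
  · rw [← h0]; exact mul_nonneg sobConst_nonneg (by positivity)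
  · refine le_of_mul_le_mul_left ?_ h0
    calc ‖g2‖ * ‖g2‖ = ‖g2‖ ^ 2 := (sq _).symm
      _ ≤ _ := h2.trans h1
      _ = _ := by ring

lemma eLpNorm_trunc_le (v : L2 C4) (n : ℕ) :
    eLpNorm (fun x => min ‖fmul hres v x‖ (n : ℝ)) 4 volume ≤ ENNReal.ofReal (√sobConst * ‖v‖) := by
  set f : R3 → ℝ := fun x => min ‖fmul hres v x‖ (n : ℝ) with hf
  have h1 := norm_trunc_sq_le v n
  have h2 : eLpNorm (fun x => ((f x ^ 2 : ℝ) : ℂ)) 2 volume ≤ ENNReal.ofReal (sobConst * ‖v‖ ^ 2) := by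
    rw [Lp.norm_toLp] at h1
    rw [← ENNReal.ofReal_toReal (memLp_trunc_sq (fmul hres v) n).2.ne]
    exact ENNReal.ofReal_le_ofReal h1
  have h3 : eLpNorm (fun x => ((f x ^ 2 : ℝ) : ℂ)) 2 volume = eLpNorm f 4 volume ^ 2 := by
    have := eLpNorm_norm_rpow (p := 2) (μ := (volume : Measure R3)) f (q := 2) (by norm_num)
    have e : (2 : ℝ≥0∞) * ENNReal.ofReal 2 = 4 := by
      rw [show ENNReal.ofReal 2 = 2 by simp]; norm_num
    rw [e, ENNReal.rpow_ofNat] at this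
    rw [← this]
    refine eLpNorm_congr_norm_ae (.of_forall fun x => ?_)
    rw [Complex.norm_real]
    simp
  rw [h3] at h2
  refine (ENNReal.pow_le_pow_left_iff (n := 2) two_ne_zero).1 (h2.trans_eq ?_)
  rw [← ENNReal.ofReal_pow (by positivity), mul_pow, Real.sq_sqrt sobConst_nonneg]

/-- The Sobolev embedding `H¹(ℝ³, ℂ⁴) ⊆ L⁴(ℝ³, ℂ⁴)`. -/
lemma eLpNorm_four_le {u : L2 C4} {g : Fin 3 → L2 C4} (hg : ∀ j, HasWeakDeriv j u (g j)) :
    eLpNorm u 4 volume ≤ ENNReal.ofReal (√sobConst * (‖u‖ + ∑ j, ‖g j‖)) := by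
  obtain ⟨v, rfl, hv⟩ := exists_eq_fmul_hres hg
  have h1 : eLpNorm (fun x => ‖fmul hres v x‖) 4 volume ≤ ENNReal.ofReal (√sobConst * ‖v‖) := by
    -- Fatou's lemma, as the truncation level tends to infinity.
    refine (Lp.eLpNorm_lim_le_liminf_eLpNorm
      (fun n : ℕ => aestronglyMeasurable_trunc (fmul hres v) n) _ (.of_forall fun x => ?_)).trans ?_
    · obtain ⟨N, hN⟩ := exists_nat_ge ‖fmul hres v x‖
      refine tendsto_const_nhds.congr' ?_
      filter_upwards [eventually_ge_atTop N] with n hn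
      rw [min_eq_left (hN.trans (by exact_mod_cast hn))]
    · refine liminf_le_of_le (by isBoundedDefault) fun b hb => ?_
      obtain ⟨n, hn⟩ := hb.exists
      exact hn.trans (eLpNorm_trunc_le v n)
  rw [eLpNorm_norm] at h1
  exact h1.trans (ENNReal.ofReal_le_ofReal (mul_le_mul_of_nonneg_left hv (Real.sqrt_nonneg _)))

lemma memLp_four {u : L2 C4} {g : Fin 3 → L2 C4} (hg : ∀ j, HasWeakDeriv j u (g j)) :
    MemLp u 4 volume :=
  ⟨Lp.aestronglyMeasurable u, (eLpNorm_four_le hg).trans_lt ENNReal.ofReal_lt_top⟩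

lemma HasWeakDeriv.compLpL {F G : Type} [NormedAddCommGroup F] [NormedSpace ℝ F] [CompleteSpace F]
    [NormedAddCommGroup G] [NormedSpace ℝ G] [CompleteSpace G] {j : Fin 3} {u g : L2 F}
    (h : HasWeakDeriv j u g) (L : F →L[ℝ] G) :
    HasWeakDeriv j (L.compLpL 2 volume u) (L.compLpL 2 volume g) := by
  intro η hη hc
  have key : ∀ (f : R3 → ℝ), Continuous f → HasCompactSupport f → ∀ a : L2 F,
      ∫ x, f x • (L.compLpL 2 volume a) x = L (∫ x, f x • a x) := by
    intro f hf hfc a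
    rw [← L.integral_comp_comm (integrable_test_smul hf hfc a)]
    refine integral_congr_ae ?_
    filter_upwards [L.coeFn_compLpL a] with x hx
    rw [hx, map_smul]
  rw [key _ (continuous_test_deriv hη j) (hasCompactSupport_test_deriv hc j),
    key _ hη.continuous hc, h η hη hc, map_neg]

/-- The components of an element of `H¹`. -/
def H1.comp (a : Option (Fin 3)) : H1 →L[ℝ] L2 ℝ :=
  (PiLp.proj 2 (fun _ : Option (Fin 3) => L2 ℝ) a) ∘L H1space.subtypeL

lemma H1.comp_fn (φ : H1) : H1.comp none φ = φ.fn := rfl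

lemma H1.hasWeakDeriv (φ : H1) (j : Fin 3) : HasWeakDeriv j φ.fn (H1.comp (some j) φ) := φ.2 j

lemma H1.norm_comp_le (a : Option (Fin 3)) (φ : H1) : ‖H1.comp a φ‖ ≤ ‖φ‖ :=
  PiLp.norm_apply_le (φ : PiLp 2 fun _ : Option (Fin 3) => L2 ℝ) a

/-- The embedding of the real line into the spinors along the first coordinate. -/
def spinorEmb : ℝ →L[ℝ] C4 :=
  (ContinuousLinearMap.id ℝ ℝ).smulRight (EuclideanSpace.single 0 1 : C4)

lemma norm_spinorEmb (r : ℝ) : ‖spinorEmb r‖ = ‖r‖ := by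
  simp [spinorEmb, norm_smul]

lemma norm_spinorEmb_compLpL (f : L2 ℝ) : ‖spinorEmb.compLpL 2 volume f‖ = ‖f‖ := by
  rw [Lp.norm_def, Lp.norm_def]
  congr 1
  refine eLpNorm_congr_norm_ae ?_
  filter_upwards [spinorEmb.coeFn_compLpL f] with x hx
  rw [hx, norm_spinorEmb]

lemma H1.eLpNorm_four_le (φ : H1) :
    eLpNorm φ.fn 4 volume ≤ ENNReal.ofReal (√sobConst * 4 * ‖φ‖) := by
  have h := DiracVacuum.eLpNorm_four_le fun j => (φ.hasWeakDeriv j).compLpL spinorEmb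
  have e : eLpNorm (spinorEmb.compLpL 2 volume φ.fn) 4 volume = eLpNorm φ.fn 4 volume := by
    refine eLpNorm_congr_norm_ae ?_
    filter_upwards [spinorEmb.coeFn_compLpL φ.fn] with x hx
    rw [hx, norm_spinorEmb]
  rw [e] at h
  refine h.trans (ENNReal.ofReal_le_ofReal ?_)
  simp only [norm_spinorEmb_compLpL, Fin.sum_univ_three, mul_assoc]
  have h0 := H1.norm_comp_le none φ
  have h1 := fun j => H1.norm_comp_le (some j) φ
  rw [H1.comp_fn] at h0
  -- The factor 4 counts φ and its three derivatives.
  exact mul_le_mul_of_nonneg_left (by linarith [h1 0, h1 1, h1 2]) (Real.sqrt_nonneg _)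

lemma H1.memLp_four (φ : H1) : MemLp φ.fn 4 volume :=
  ⟨Lp.aestronglyMeasurable _, (H1.eLpNorm_four_le φ).trans_lt ENNReal.ofReal_lt_top⟩

instance fact_one_le_four : Fact ((1 : ℝ≥0∞) ≤ 4) := ⟨by norm_num⟩

instance holderTriple_four : ENNReal.HolderTriple 4 4 2 := ⟨by
  rw [← two_mul, show (4 : ℝ≥0∞) = 2 * 2 by norm_num,
    ENNReal.mul_inv (Or.inl two_ne_zero) (Or.inl ENNReal.ofNat_ne_top), ← mul_assoc,
    ENNReal.mul_inv_cancel two_ne_zero ENNReal.ofNat_ne_top, one_mul]⟩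

/-- The Sobolev embedding `H¹(ℝ³, ℝ) → L⁴(ℝ³, ℝ)`. -/
def H1.four : H1 →L[ℝ] Lp ℝ 4 (volume : Measure R3) :=
  LinearMap.mkContinuous
    { toFun := fun φ => φ.memLp_four.toLp
      map_add' := fun φ ψ => by
        rw [← MemLp.toLp_add]
        exact MemLp.toLp_congr _ _ (Lp.coeFn_add φ.fn ψ.fn)
      map_smul' := fun c φ => by
        rw [RingHom.id_apply, ← MemLp.toLp_const_smul]
        exact MemLp.toLp_congr _ _ (Lp.coeFn_smul c φ.fn) }
    (√sobConst * 4) (fun φ => by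
      change ‖φ.memLp_four.toLp‖ ≤ _
      rw [Lp.norm_toLp]
      exact ENNReal.toReal_le_of_le_ofReal (by positivity) (H1.eLpNorm_four_le φ))

lemma H1.four_ae (φ : H1) : ∀ᵐ x, H1.four φ x = φ.fn x := φ.memLp_four.coeFn_toLp

end Embedding
end DiracVacuum
end

noncomputable section

namespace DiracVacuum

open FourierTransform
open scoped BoundedContinuousFunction ENNReal

/-! ### Potentials -/

section Potentials

variable (α : Fin 3 → Matrix (Fin 4) (Fin 4) ℂ) (β : Matrix (Fin 4) (Fin 4) ℂ) (ε : ℝ)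

/-- The map `r ↦ r a` for a matrix `a`. -/
def potCoef (a : M4) : ℝ →L[ℝ] M4 :=
  (((ContinuousLinearMap.id ℂ ℂ).smulRight a).restrictScalars ℝ) ∘L Complex.ofRealCLM

lemma potCoef_apply (a : M4) (r : ℝ) : potCoef a r = (r : ℂ) • a := rfl

/-- The part `2φ - iε ∑_j ∂_jφ α_jβ` of `D_φ² - D_0²` that is linear in `φ`. -/
def linPot : H1 →L[ℝ] L2 M4 :=
  (potCoef ((2 : ℂ) • 1)).compLpL 2 volume ∘L H1.comp none +
    ∑ j, (potCoef (-(Complex.I * ε) • act (α j * β))).compLpL 2 volume ∘L H1.comp (some j)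

/-- The bilinear map `(φ, ψ) ↦ φψ`, whose diagonal is the quadratic part of `D_φ² - D_0²`. -/
def quadPot : H1 →L[ℝ] H1 →L[ℝ] L2 M4 :=
  (((ContinuousLinearMap.compL ℝ ℝ ℝ M4 (potCoef 1)) ∘L ContinuousLinearMap.mul ℝ ℝ).holderL
    volume 4 4 2).bilinearComp H1.four H1.four

lemma linPot_ae (φ : H1) : ∀ᵐ x, linPot α β ε φ x = (φ.fn x : ℂ) • (2 : ℂ) • (1 : M4)
    + ∑ j, (H1.comp (some j) φ x : ℂ) • (-(Complex.I * ε) • act (α j * β)) := by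
  have h1 := (potCoef ((2 : ℂ) • 1)).coeFn_compLpL (p := 2) (μ := (volume : Measure R3)) φ.fn
  have h2 : ∀ᵐ x, ∀ j, (potCoef (-(Complex.I * ε) • act (α j * β))).compLpL 2 volume
      (H1.comp (some j) φ) x = (H1.comp (some j) φ x : ℂ) • (-(Complex.I * ε) • act (α j * β)) :=
    ae_all_iff.2 fun j => (potCoef (-(Complex.I * ε) • act (α j * β))).coeFn_compLpL
      (p := 2) (μ := (volume : Measure R3)) (H1.comp (some j) φ)
  have e : linPot α β ε φ = (potCoef ((2 : ℂ) • 1)).compLpL 2 volume φ.fn +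
      ∑ j, (potCoef (-(Complex.I * ε) • act (α j * β))).compLpL 2 volume (H1.comp (some j) φ) := by
    simp [linPot, H1.comp_fn]
  rw [e]
  filter_upwards [h1, h2, Lp.coeFn_add ((potCoef ((2 : ℂ) • 1)).compLpL 2 volume φ.fn)
    (∑ j, (potCoef (-(Complex.I * ε) • act (α j * β))).compLpL 2 volume (H1.comp (some j) φ)),
    Lp.coeFn_finsetSum (Finset.univ : Finset (Fin 3)) (fun j =>
      (potCoef (-(Complex.I * ε) • act (α j * β))).compLpL 2 volume (H1.comp (some j) φ))]
    with x k1 k2 k3 k4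
  rw [k3, Pi.add_apply, k4, Finset.sum_apply, k1, potCoef_apply]
  simp only [k2]

lemma quadPot_ae (φ : H1) : ∀ᵐ x, quadPot φ φ x = ((φ.fn x ^ 2 : ℝ) : ℂ) • (1 : M4) := by
  have h := ((ContinuousLinearMap.compL ℝ ℝ ℝ M4 (potCoef 1)) ∘L
    ContinuousLinearMap.mul ℝ ℝ).coeFn_holder (r := 2) (H1.four φ) (H1.four φ)
  filter_upwards [h, H1.four_ae φ] with x k1 k2
  refine k1.trans ?_
  rw [k2, sq]
  rfl

/-- `D_φ² - D_0²`. -/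
def pot (φ : H1) : L2 M4 := linPot α β ε φ + quadPot φ φ

lemma pot_ae (φ : H1) : ∀ᵐ x, ∀ v, pot α β ε φ x v = ((2 * φ.fn x + φ.fn x ^ 2 : ℝ) : ℂ) • v
    + ∑ j, (H1.comp (some j) φ x : ℂ) • (-(Complex.I * ε) • act (α j) (act β v)) := by
  filter_upwards [linPot_ae α β ε φ, quadPot_ae φ, Lp.coeFn_add (linPot α β ε φ) (quadPot φ φ)]
    with x h1 h2 h3 v
  rw [pot, h3, Pi.add_apply, h1, h2, add_apply, add_apply, sum_apply]
  simp only [smul_apply, map_mul, smul_smul]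
  push_cast
  rw [add_smul, mul_comm]
  simp only [Function.comp_apply, id_eq]
  abel

end Potentials

/-! ### The product rule -/

section Product

lemma memLp_top_test {η : R3 → ℝ} (hη : Continuous η) (hc : HasCompactSupport η) :
    MemLp η ∞ volume := hη.memLp_top_of_hasCompactSupport hc volume

lemma memLp_test_mul {η : R3 → ℝ} (hη : Continuous η) (hc : HasCompactSupport η) (φ : L2 ℝ) :
    MemLp (fun x => η x * φ x) 2 volume :=
  (Lp.memLp φ).mul (memLp_top_test hη hc)

lemma fderiv_mul_apply {η ζ : R3 → ℝ} (hη : ContDiff ℝ (⊤ : ℕ∞) η) (hζ : ContDiff ℝ (⊤ : ℕ∞) ζ)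
    (x v : R3) : fderiv ℝ (fun x => ζ x * η x) x v = fderiv ℝ ζ x v * η x + ζ x * fderiv ℝ η x v := by
  have h1 : DifferentiableAt ℝ η x := (hη.differentiable (by simp)) x
  have h2 : DifferentiableAt ℝ ζ x := (hζ.differentiable (by simp)) x
  rw [fderiv_fun_mul h2 h1]
  simp only [add_apply, smul_apply, smul_eq_mul]
  ring

/-- The product rule with a smooth factor, obtained from the test function ζη. It serves to localise
φ before the product rule for two Sobolev functions. -/
lemma HasWeakDeriv.test_mul {j : Fin 3} {φ g : L2 ℝ} (h : HasWeakDeriv j φ g) {η : R3 → ℝ}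
    (hη : ContDiff ℝ (⊤ : ℕ∞) η) (hc : HasCompactSupport η) :
    HasWeakDeriv j (memLp_test_mul hη.continuous hc φ).toLp
      ((memLp_test_mul (continuous_test_deriv hη j) (hasCompactSupport_test_deriv hc j) φ).toLp
        + (memLp_test_mul hη.continuous hc g).toLp) := by
  intro ζ hζ hζc
  have h1 := h (fun x => ζ x * η x) (hζ.mul hη) hζc.mul_right
  set e : R3 := EuclideanSpace.single j 1 with he
  have i1 : Integrable fun x => (fderiv ℝ ζ x e * η x) • φ x :=
    integrable_test_smul ((continuous_test_deriv hζ j).mul hη.continuous)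
      (hasCompactSupport_test_deriv hζc j).mul_right φ
  have i2 : Integrable fun x => (ζ x * fderiv ℝ η x e) • φ x :=
    integrable_test_smul (hζ.continuous.mul (continuous_test_deriv hη j)) hζc.mul_right φ
  have i3 : Integrable fun x => (ζ x * η x) • g x :=
    integrable_test_smul (hζ.continuous.mul hη.continuous) hζc.mul_right g
  simp only [fderiv_mul_apply hη hζ, add_smul] at h1
  rw [integral_add i1 i2] at h1
  have e1 : ∫ x, fderiv ℝ ζ x e • ((memLp_test_mul hη.continuous hc φ).toLp : L2 ℝ) x
      = ∫ x, (fderiv ℝ ζ x e * η x) • φ x := by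
    refine integral_congr_ae ?_
    filter_upwards [(memLp_test_mul hη.continuous hc φ).coeFn_toLp] with x hx
    rw [hx, smul_eq_mul, smul_eq_mul, mul_assoc]
  have e2 : ∫ x, ζ x • ((memLp_test_mul (continuous_test_deriv hη j)
      (hasCompactSupport_test_deriv hc j) φ).toLp + (memLp_test_mul hη.continuous hc g).toLp : L2 ℝ) x
      = (∫ x, (ζ x * fderiv ℝ η x e) • φ x) + ∫ x, (ζ x * η x) • g x := by
    rw [← integral_add i2 i3]
    refine integral_congr_ae ?_
    filter_upwards [(memLp_test_mul hη.continuous hc g).coeFn_toLp,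
      (memLp_test_mul (continuous_test_deriv hη j) (hasCompactSupport_test_deriv hc j) φ).coeFn_toLp,
      Lp.coeFn_add (memLp_test_mul (continuous_test_deriv hη j)
        (hasCompactSupport_test_deriv hc j) φ).toLp (memLp_test_mul hη.continuous hc g).toLp]
      with x k1 k2 k3
    rw [k3, Pi.add_apply, k1, k2]
    simp only [smul_eq_mul]
    ring
  rw [e1, e2]
  linarith

/-- Integration by parts. -/
lemma HasWeakDeriv.inner_left {F : Type} [NormedAddCommGroup F] [InnerProductSpace ℂ F]
    [CompleteSpace F] {j : Fin 3} {u g u' g' : L2 F} (h : HasWeakDeriv j u g)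
    (h' : HasWeakDeriv j u' g') : ⟪g, u'⟫_ℂ = -⟪u, g'⟫_ℂ := by
  have k1 := (hasWeakDeriv_iff_fourier j u g).1 h
  have k2 := (hasWeakDeriv_iff_fourier j u' g').1 h'
  have e : ∀ a b : L2 F, ⟪a, b⟫_ℂ = ⟪(𝓕 a : L2 F), (𝓕 b : L2 F)⟫_ℂ := fun a b =>
    ((Lp.fourierTransformₗᵢ R3 F).inner_map_map a b).symm
  -- By Plancherel; the sign comes from the symbol 2πiξ_j being purely imaginary.
  rw [e, e u, L2.inner_def, L2.inner_def, ← integral_neg]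
  refine integral_congr_ae ?_
  filter_upwards [k1, k2] with ξ h1 h2
  rw [h1, h2, inner_smul_left, inner_smul_right]
  simp [map_ofNat]

/-- The product of a real function and a vector. -/
def vecEmb (e : C4) : ℝ →L[ℝ] C4 := (ContinuousLinearMap.id ℝ ℝ).smulRight e

lemma integrable_smul_L2 (φ : L2 ℝ) (u : L2 C4) : Integrable fun x => φ x • u x :=
  memLp_one_iff_integrable.1 ((Lp.memLp u).smul (Lp.memLp φ))

/-- Paired with a fixed e, the vector integral ∫ φu is an L² inner product with the spinor field φe.
In this way integration by parts for inner products covers products of a scalar and a spinor. -/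
lemma inner_vecEmb_compLpL (e : C4) (φ : L2 ℝ) (u : L2 C4) :
    ⟪(vecEmb e).compLpL 2 volume φ, u⟫_ℂ = ⟪e, ∫ x, φ x • u x⟫_ℂ := by
  rw [L2.inner_def, ← integral_inner (integrable_smul_L2 φ u)]
  refine integral_congr_ae ?_
  filter_upwards [(vecEmb e).coeFn_compLpL φ] with x hx
  rw [hx]
  change ⟪φ x • e, u x⟫_ℂ = ⟪e, φ x • u x⟫_ℂ
  rw [← Complex.coe_smul, ← Complex.coe_smul, inner_smul_left, inner_smul_right, Complex.conj_ofReal]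

lemma HasWeakDeriv.integral_smul {j : Fin 3} {φ g : L2 ℝ} {u v : L2 C4} (h : HasWeakDeriv j φ g)
    (h' : HasWeakDeriv j u v) : ∫ x, g x • u x = -∫ x, φ x • v x := by
  refine ext_inner_left ℂ fun e => ?_
  rw [inner_neg_right, ← inner_vecEmb_compLpL, ← inner_vecEmb_compLpL]
  exact (h.compLpL (vecEmb e)).inner_left h'

/-- The product rule in `H¹`. -/
lemma HasWeakDeriv.mul {j : Fin 3} {φ g : L2 ℝ} {u v p q : L2 C4} (h : HasWeakDeriv j φ g)
    (h' : HasWeakDeriv j u v) (hp : ∀ᵐ x, p x = φ x • u x)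
    (hq : ∀ᵐ x, q x = g x • u x + φ x • v x) : HasWeakDeriv j p q := by
  intro η hη hc
  -- The test function is absorbed into the scalar factor: ηφ has weak derivative ∂_jη·φ + ηg, and
  -- integration by parts against u gives the rule.
  have h1 := (h.test_mul hη hc).integral_smul h'
  set e : R3 := EuclideanSpace.single j 1 with he
  have m1 := memLp_test_mul (continuous_test_deriv hη j) (hasCompactSupport_test_deriv hc j) φ
  have m2 := memLp_test_mul hη.continuous hc g
  have m3 := memLp_test_mul hη.continuous hc φ
  have i1 : Integrable fun x => (fderiv ℝ η x e * φ x) • u x :=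
    (integrable_smul_L2 m1.toLp u).congr (by filter_upwards [m1.coeFn_toLp] with x hx; rw [hx])
  have i2 : Integrable fun x => (η x * g x) • u x :=
    (integrable_smul_L2 m2.toLp u).congr (by filter_upwards [m2.coeFn_toLp] with x hx; rw [hx])
  have i3 : Integrable fun x => (η x * φ x) • v x :=
    (integrable_smul_L2 m3.toLp v).congr (by filter_upwards [m3.coeFn_toLp] with x hx; rw [hx])
  have e1 : ∫ x, (m1.toLp + m2.toLp : L2 ℝ) x • u x
      = (∫ x, (fderiv ℝ η x e * φ x) • u x) + ∫ x, (η x * g x) • u x := by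
    rw [← integral_add i1 i2]
    refine integral_congr_ae ?_
    filter_upwards [m1.coeFn_toLp, m2.coeFn_toLp, Lp.coeFn_add m1.toLp m2.toLp] with x k1 k2 k3
    rw [k3, Pi.add_apply, k1, k2, add_smul]
  have e2 : ∫ x, (m3.toLp : L2 ℝ) x • v x = ∫ x, (η x * φ x) • v x := by
    refine integral_congr_ae ?_
    filter_upwards [m3.coeFn_toLp] with x hx
    rw [hx]
  have e3 : ∫ x, fderiv ℝ η x e • p x = ∫ x, (fderiv ℝ η x e * φ x) • u x := by
    refine integral_congr_ae ?_
    filter_upwards [hp] with x hx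
    rw [hx, smul_smul]
  have e4 : ∫ x, η x • q x = (∫ x, (η x * g x) • u x) + ∫ x, (η x * φ x) • v x := by
    rw [← integral_add i2 i3]
    refine integral_congr_ae ?_
    filter_upwards [hq] with x hx
    rw [hx, smul_add, smul_smul, smul_smul]
  rw [e1, e2] at h1
  rw [e3, e4, neg_add, ← h1]
  abel

end Product
end DiracVacuum
end

noncomputable section

namespace DiracVacuum

open FourierTransform
open scoped BoundedContinuousFunction ENNReal

/-! ### The Dirac operator -/

section DiracOperator

variable {α : Fin 3 → Matrix (Fin 4) (Fin 4) ℂ} {β : Matrix (Fin 4) (Fin 4) ℂ} {ε : ℝ}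

/-- The action of a constant matrix on spinor fields. -/
def actL (M : Matrix (Fin 4) (Fin 4) ℂ) : L2 C4 →L[ℂ] L2 C4 := (act M).compLpL 2 volume

lemma actL_ae (M : Matrix (Fin 4) (Fin 4) ℂ) (u : L2 C4) : ∀ᵐ x, actL M u x = act M (u x) :=
  (act M).coeFn_compLpL u

lemma inner_act {M : Matrix (Fin 4) (Fin 4) ℂ} (hM : M.IsHermitian) (v w : C4) :
    ⟪act M v, w⟫_ℂ = ⟪v, act M w⟫_ℂ := by
  have h : IsSelfAdjoint (act M) := by
    rw [IsSelfAdjoint, act, ← map_star]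
    exact congrArg _ hM
  exact h.isSymmetric v w

lemma inner_actL {M : Matrix (Fin 4) (Fin 4) ℂ} (hM : M.IsHermitian) (u w : L2 C4) :
    ⟪actL M u, w⟫_ℂ = ⟪u, actL M w⟫_ℂ := by
  rw [L2.inner_def, L2.inner_def]
  refine integral_congr_ae ?_
  filter_upwards [actL_ae M u, actL_ae M w] with x h1 h2
  rw [h1, h2, inner_act hM]

lemma HasWeakDeriv.actL {j : Fin 3} {u g : L2 C4} (h : HasWeakDeriv j u g)
    (M : Matrix (Fin 4) (Fin 4) ℂ) : HasWeakDeriv j (actL M u) (actL M g) := by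
  have e : ∀ w, ((act M).restrictScalars ℝ).compLpL 2 volume w = DiracVacuum.actL M w := by
    intro w
    refine Lp.ext ?_
    filter_upwards [((act M).restrictScalars ℝ).coeFn_compLpL w, actL_ae M w] with x h1 h2
    rw [h1, h2]
    rfl
  rw [← e, ← e]
  exact h.compLpL _

lemma HasWeakDeriv.sum {j : Fin 3} {ι : Type} {s : Finset ι} {u g : ι → L2 C4}
    (h : ∀ i ∈ s, HasWeakDeriv j (u i) (g i)) : HasWeakDeriv j (∑ i ∈ s, u i) (∑ i ∈ s, g i) := by
  classical
  induction s using Finset.induction_on with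
  | empty => simpa using HasWeakDeriv.zero j
  | insert a s ha ih =>
    rw [Finset.sum_insert ha, Finset.sum_insert ha]
    exact (h a (Finset.mem_insert_self _ _)).add (ih fun i hi => h i (Finset.mem_insert_of_mem hi))

lemma mem_graph_dirac {φ : H1} {u v : L2 C4} : (u, v) ∈ (dirac α β ε φ).graph ↔
    ∃ g : Fin 3 → L2 C4, (∀ j, HasWeakDeriv j u (g j)) ∧
      ∀ᵐ x, v x = -(Complex.I * ε) • ∑ j, act (α j) (g j x)
        + ((1 + φ.fn x : ℝ) : ℂ) • act β (u x) := by
  rw [dirac, Submodule.toLinearPMap_graph_eq _ (diracGraph_eq_zero α β ε φ)]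
  rfl

/-- In operator form: `D_φ u = -iε ∑_j α_j ∂_ju + βu + q` with `q = φβu`. -/
lemma mem_graph_dirac_iff {φ : H1} {u v : L2 C4} : (u, v) ∈ (dirac α β ε φ).graph ↔
    ∃ (g : Fin 3 → L2 C4) (q : L2 C4), (∀ j, HasWeakDeriv j u (g j)) ∧
      (∀ᵐ x, q x = φ.fn x • actL β u x) ∧
      v = -(Complex.I * ε) • ∑ j, actL (α j) (g j) + actL β u + q := by
  rw [mem_graph_dirac]
  have key : ∀ (g : Fin 3 → L2 C4), ∀ᵐ x, (-(Complex.I * ε) • ∑ j, actL (α j) (g j)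
      + actL β u : L2 C4) x = -(Complex.I * ε) • ∑ j, act (α j) (g j x) + act β (u x) := by
    intro g
    have h1 : ∀ᵐ x, ∀ j, actL (α j) (g j) x = act (α j) (g j x) :=
      ae_all_iff.2 fun j => actL_ae _ _
    filter_upwards [h1, Lp.coeFn_add (-(Complex.I * ε) • ∑ j, actL (α j) (g j)) (actL β u),
      Lp.coeFn_smul (-(Complex.I * ε)) (∑ j, actL (α j) (g j)), actL_ae β u,
      Lp.coeFn_finsetSum (Finset.univ : Finset (Fin 3)) (fun j => actL (α j) (g j))]
      with x k1 k2 k3 k4 k5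
    rw [k2, Pi.add_apply, k3, Pi.smul_apply, k5, Finset.sum_apply, k4]
    simp only [k1]
  refine exists_congr fun g => ?_
  constructor
  · rintro ⟨hg, hv⟩
    refine ⟨v - (-(Complex.I * ε) • ∑ j, actL (α j) (g j) + actL β u), hg, ?_, by abel⟩
    filter_upwards [hv, key g, actL_ae β u,
      Lp.coeFn_sub v (-(Complex.I * ε) • ∑ j, actL (α j) (g j) + actL β u)] with x k1 k2 k3 k4
    rw [k4, Pi.sub_apply, k1, k2, k3, Complex.ofReal_add, add_smul, Complex.ofReal_one, one_smul,
      Complex.coe_smul]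
    abel
  · rintro ⟨q, hg, hq, rfl⟩
    refine ⟨hg, ?_⟩
    filter_upwards [hq, key g, actL_ae β u,
      Lp.coeFn_add (-(Complex.I * ε) • ∑ j, actL (α j) (g j) + actL β u) q] with x k1 k2 k3 k4
    rw [k4, Pi.add_apply, k1, k2, k3, Complex.ofReal_add, add_smul, Complex.ofReal_one, one_smul,
      Complex.coe_smul]
    abel

/-- Hölder with 1/4 + 1/4 = 1/2. This is why D_φ maps all of H¹ to L² and its domain does not depend
on φ. -/
lemma memLp_mul {φ : H1} {u : L2 C4} {g : Fin 3 → L2 C4} (hg : ∀ j, HasWeakDeriv j u (g j)) :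
    MemLp (fun x => φ.fn x • u x) 2 volume :=
  (memLp_four hg).smul φ.memLp_four

lemma exists_mem_graph_dirac (φ : H1) {u : L2 C4} {g : Fin 3 → L2 C4}
    (hg : ∀ j, HasWeakDeriv j u (g j)) : ∃ v, (u, v) ∈ (dirac α β ε φ).graph := by
  have hq := memLp_mul (φ := φ) fun j => (hg j).actL β
  exact ⟨_, mem_graph_dirac_iff.2 ⟨g, hq.toLp, hg, hq.coeFn_toLp, rfl⟩⟩

lemma domain_dirac (φ : H1) : ((dirac α β ε φ).domain : Set (L2 C4)) = spinorH1 := by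
  ext u
  constructor
  · intro hu
    obtain ⟨g, hg, -⟩ := mem_graph_dirac.1 (mem_graph_iff_exists.2 ⟨hu, rfl⟩)
    exact fun j => ⟨g j, hg j⟩
  · intro hu
    choose g hg using hu
    obtain ⟨v, hv⟩ := exists_mem_graph_dirac (α := α) (β := β) (ε := ε) φ hg
    exact (mem_graph_iff_exists.1 hv).1

/-- The scalar −iε and ∂_j are both skew and α_j commutes with ∂_j, so the kinetic part is
symmetric; β(1 + φ) is pointwise Hermitian. -/
lemma dirac_symmetric (hD : IsDiracMatrices α β) (φ : H1) {u v u' v' : L2 C4}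
    (h : (u, v) ∈ (dirac α β ε φ).graph) (h' : (u', v') ∈ (dirac α β ε φ).graph) :
    ⟪v, u'⟫_ℂ = ⟪u, v'⟫_ℂ := by
  obtain ⟨g, q, hg, hq, rfl⟩ := mem_graph_dirac_iff.1 h
  obtain ⟨g', q', hg', hq', rfl⟩ := mem_graph_dirac_iff.1 h'
  have e1 : ⟪q, u'⟫_ℂ = ⟪u, q'⟫_ℂ := by
    rw [L2.inner_def, L2.inner_def]
    refine integral_congr_ae ?_
    filter_upwards [hq, hq', actL_ae β u, actL_ae β u'] with x h1 h2 h3 h4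
    rw [h1, h2, h3, h4, ← Complex.coe_smul, ← Complex.coe_smul, inner_smul_left, inner_smul_right,
      Complex.conj_ofReal, inner_act hD.hermitian_β]
  have e2 : ∀ j, ⟪actL (α j) (g j), u'⟫_ℂ = -⟪u, actL (α j) (g' j)⟫_ℂ := fun j => by
    rw [((hg j).actL (α j)).inner_left (hg' j), inner_actL (hD.hermitian_α j)]
  rw [inner_add_left, inner_add_left, inner_add_right, inner_add_right, e1,
    inner_actL hD.hermitian_β, inner_smul_left, inner_smul_right, sum_inner, inner_sum]
  simp only [e2, Finset.sum_neg_distrib]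
  simp

end DiracOperator
end DiracVacuum
end

noncomputable section

namespace DiracVacuum

open FourierTransform
open scoped BoundedContinuousFunction ENNReal

/-! ### The square of the Dirac operator -/

section DiracSquare

variable {α : Fin 3 → Matrix (Fin 4) (Fin 4) ℂ} {β : Matrix (Fin 4) (Fin 4) ℂ} {ε : ℝ}

lemma act_mul_apply (M N : Matrix (Fin 4) (Fin 4) ℂ) (v : C4) :
    act M (act N v) = act (M * N) v := by
  rw [act, act, act, map_mul]
  rfl

lemma act_one_apply (v : C4) : act 1 v = v := by
  rw [act, map_one]
  rfl

lemma act_neg_apply (M : Matrix (Fin 4) (Fin 4) ℂ) (v : C4) : act (-M) v = -act M v := by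
  rw [act, act, map_neg]
  rfl

/-- The pointwise form of `D_φ² = 1 - ε²Δ + W`. -/
lemma dirac_algebra (hD : IsDiracMatrices α β) (u : C4) (g : Fin 3 → C4) (G : Fin 3 → Fin 3 → C4)
    (hG : ∀ j k, G j k = G k j) (z : ℂ) (d : Fin 3 → ℂ) :
    -(Complex.I * ε) • ∑ k, act (α k) (-(Complex.I * ε) • ∑ j, act (α j) (G k j) + act β (g k)
        + act β (d k • u + z • g k))
      + (1 + z) • act β (-(Complex.I * ε) • ∑ j, act (α j) (g j) + (1 + z) • act β u)
    = u - ((ε ^ 2 : ℝ) : ℂ) • ∑ j, G j j + ((2 * z + z ^ 2) • u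
      + ∑ j, d j • (-(Complex.I * ε) • act (α j) (act β u))) := by
  have haa : ∀ k v, act (α k) (act (α k) v) = v := fun k v => by
    rw [act_mul_apply, hD.sq_α, act_one_apply]
  have hbb : ∀ v, act β (act β v) = v := fun v => by
    rw [act_mul_apply, hD.sq_β, act_one_apply]
  have hba : ∀ k v, act β (act (α k) v) = -act (α k) (act β v) := fun k v => by
    rw [act_mul_apply, act_mul_apply, hD.anticomm_αβ, act_neg_apply, neg_neg]
  have hij : ∀ j k, j ≠ k → ∀ v, act (α j) (act (α k) v) = -act (α k) (act (α j) v) :=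
    fun j k h v => by rw [act_mul_apply, act_mul_apply, hD.anticomm_αα j k h, act_neg_apply]
  -- Moving β to the right and the α's into increasing order is a normal form. The mixed second
  -- derivatives then cancel because G j k = G k j.
  have h10 := hij 1 0 (by decide)
  have h20 := hij 2 0 (by decide)
  have h21 := hij 2 1 (by decide)
  have hε2 : ((ε ^ 2 : ℝ) : ℂ) = -((Complex.I * ε) * (Complex.I * ε)) := by
    push_cast
    linear_combination (ε : ℂ) ^ 2 * Complex.I_sq
  rw [hε2]
  simp only [Fin.sum_univ_three, map_add, map_smul, haa, hbb, hba, h10, h20, h21, hG 1 0, hG 2 0,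
    hG 2 1]
  module

lemma norm_R_zero_ae {c : ℝ} (hc : 0 < c) (f : L2 C4) :
    ∀ᵐ x, R c 0 f x = evFun (resL hc 0) f x := fmul_ae_evFun _ (memLp_res hc 0) f

/-- R_0 f is bounded (H² ⊂ L^∞ in three dimensions), so square integrability of the other factor
suffices; derivatives of φ have no more than that. -/
lemma memLp_deriv_mul {c : ℝ} (hc : 0 < c) (d : L2 ℝ) (f : L2 C4) :
    MemLp (fun x => d x • R c 0 f x) 2 volume := by
  have h : MemLp (R c 0 f) ∞ volume :=
    (memLp_top_evFun (resL hc 0) f).ae_eq ((norm_R_zero_ae hc f).mono fun x h => h.symm)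
  exact h.smul (Lp.memLp d)

lemma ddres_symm {c : ℝ} (hc : 0 < c) (j k : Fin 3) : ddres hc j k = ddres hc k j := by
  ext ξ
  change 2 * Real.pi * Complex.I * (ξ j : ℂ) * (2 * Real.pi * Complex.I * (ξ k : ℂ) * res c 0 ξ)
    = 2 * Real.pi * Complex.I * (ξ k : ℂ) * (2 * Real.pi * Complex.I * (ξ j : ℂ) * res c 0 ξ)
  ring

lemma eq_sub_laplacian (hε : 0 < ε) (hc : 0 < 2 * Real.pi * ε) (f : L2 C4) :
    f = R (2 * Real.pi * ε) 0 f - ((ε ^ 2 : ℝ) : ℂ) • ∑ j, fmul (ddres hc j j) f := by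
  obtain ⟨u, hu, hJ⟩ := exists_H2 hε f
  have h1 : ∀ j, HasWeakDeriv j u.fn (fmul (dres hc j) f) := fun j => by
    rw [hu]; exact hasWeakDeriv_R hc j f
  have h2 : ∀ j, H2.comp (.inr (.inl j)) u = fmul (dres hc j) f := fun j =>
    (u.hasWeakDeriv j).unique (h1 j)
  have h3 : ∀ j, H2.comp (.inr (.inr (j, j))) u = fmul (ddres hc j j) f := fun j => by
    have := u.hasWeakDeriv₂ j j
    rw [h2] at this
    exact this.unique (hasWeakDeriv_dR hc j j f)
  have h4 : Jop ε u = u.fn - ((ε ^ 2 : ℝ) : ℂ) • ∑ j, H2.comp (.inr (.inr (j, j))) u := by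
    simp [Jop, H2.comp_fn]
  rw [hJ, hu] at h4
  simpa only [h3] using h4

lemma exists_graph_formula (φ : H1) {u : L2 C4} {g : Fin 3 → L2 C4}
    (hg : ∀ j, HasWeakDeriv j u (g j)) : ∃ v, (u, v) ∈ (dirac α β ε φ).graph ∧
      ∀ᵐ x, v x = -(Complex.I * ε) • ∑ j, act (α j) (g j x)
        + ((1 + φ.fn x : ℝ) : ℂ) • act β (u x) := by
  obtain ⟨v, hv⟩ := exists_mem_graph_dirac (α := α) (β := β) (ε := ε) φ hg
  obtain ⟨g', hg', hv'⟩ := mem_graph_dirac.1 hv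
  have : g' = g := funext fun j => (hg' j).unique (hg j)
  exact ⟨v, hv, this ▸ hv'⟩

/-- `D_φ² R_0 = 1 + W R_0`. -/
lemma dirac_sq (hD : IsDiracMatrices α β) (hε : 0 < ε) (hc : 0 < 2 * Real.pi * ε) (φ : H1)
    (f : L2 C4) : ∃ v, (R (2 * Real.pi * ε) 0 f, v) ∈ (dirac α β ε φ).graph ∧
      (v, f + potOp (pot α β ε φ) (resL hc 0) f) ∈ (dirac α β ε φ).graph := by
  set u := R (2 * Real.pi * ε) 0 f with hu
  have hg := fun j => hasWeakDeriv_R hc j f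
  have hG := fun j k => hasWeakDeriv_dR hc j k f
  set g := fun j => fmul (dres hc j) f with hgdef
  set G := fun j k => fmul (ddres hc j k) f with hGdef
  obtain ⟨v, hv, hv'⟩ := exists_graph_formula (α := α) (β := β) (ε := ε) φ hg
  refine ⟨v, hv, ?_⟩
  -- φu lies in H¹: u is bounded, which handles φu and u∂_kφ, while φ∂_ku is a product of two L⁴
  -- functions. Hence v = D_φ u is again in the domain of D_φ.
  have m1 : MemLp (fun x => φ.fn x • u x) 2 volume := memLp_deriv_mul hc φ.fn f
  have m2 : ∀ k, MemLp (fun x => H1.comp (some k) φ x • u x + φ.fn x • g k x) 2 volume := fun k =>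
    (memLp_deriv_mul hc (H1.comp (some k) φ) f).add (memLp_mul fun j => hG j k)
  have hp : ∀ k, HasWeakDeriv k m1.toLp (m2 k).toLp := fun k =>
    (φ.hasWeakDeriv k).mul (hg k) m1.coeFn_toLp (m2 k).coeFn_toLp
  have ev : v = -(Complex.I * ε) • ∑ j, actL (α j) (g j) + actL β u + actL β m1.toLp := by
    obtain ⟨g', q, hg', hq, e⟩ := mem_graph_dirac_iff.1 hv
    have e1 : g' = g := funext fun j => (hg' j).unique (hg j)
    have e2 : q = actL β m1.toLp := by
      refine Lp.ext ?_
      filter_upwards [hq, actL_ae β u, actL_ae β m1.toLp, m1.coeFn_toLp] with x h1 h2 h3 h4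
      rw [h1, h2, h3, h4, ← Complex.coe_smul, ← Complex.coe_smul, map_smul]
    rw [e, e1, e2]
  set V : Fin 3 → L2 C4 := fun k =>
    -(Complex.I * ε) • ∑ j, actL (α j) (G k j) + actL β (g k) + actL β (m2 k).toLp with hV
  have hVd : ∀ k, HasWeakDeriv k v (V k) := fun k => by
    rw [ev]
    exact (((HasWeakDeriv.sum fun j _ => (hG k j).actL (α j)).smul _).add
      ((hg k).actL β)).add ((hp k).actL β)
  have hVx : ∀ᵐ x, ∀ k, V k x = -(Complex.I * ε) • ∑ j, act (α j) (G k j x) + act β (g k x)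
      + act β ((H1.comp (some k) φ x : ℂ) • u x + (φ.fn x : ℂ) • g k x) := by
    refine ae_all_iff.2 fun k => ?_
    have h1 : ∀ᵐ x, ∀ j, actL (α j) (G k j) x = act (α j) (G k j x) :=
      ae_all_iff.2 fun j => actL_ae _ _
    filter_upwards [h1, Lp.coeFn_add (-(Complex.I * ε) • ∑ j, actL (α j) (G k j) + actL β (g k))
        (actL β (m2 k).toLp), Lp.coeFn_add (-(Complex.I * ε) • ∑ j, actL (α j) (G k j))
        (actL β (g k)), Lp.coeFn_smul (-(Complex.I * ε)) (∑ j, actL (α j) (G k j)),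
      actL_ae β (g k), actL_ae β (m2 k).toLp, (m2 k).coeFn_toLp,
      Lp.coeFn_finsetSum (Finset.univ : Finset (Fin 3)) (fun j => actL (α j) (G k j))]
      with x k1 k2 k3 k4 k5 k6 k7 k8
    rw [hV]
    dsimp only
    rw [k2, Pi.add_apply, k3, Pi.add_apply, k4, Pi.smul_apply, k8, Finset.sum_apply, k5, k6, k7,
      Complex.coe_smul, Complex.coe_smul]
    simp only [k1]
  obtain ⟨w, hw, hw'⟩ := exists_graph_formula (α := α) (β := β) (ε := ε) φ hVd
  convert hw using 2
  refine Lp.ext ?_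
  have hsum : ∀ᵐ x, f x = u x - ((ε ^ 2 : ℝ) : ℂ) • ∑ j, G j j x := by
    have h := eq_sub_laplacian hε hc f
    filter_upwards [Lp.coeFn_sub u (((ε ^ 2 : ℝ) : ℂ) • ∑ j, G j j),
      Lp.coeFn_smul ((ε ^ 2 : ℝ) : ℂ) (∑ j, G j j),
      Lp.coeFn_finsetSum (Finset.univ : Finset (Fin 3)) (fun j => G j j)] with x k1 k2 k3
    conv_lhs => rw [h]
    rw [k1, Pi.sub_apply, k2, Pi.smul_apply, k3, Finset.sum_apply]
  filter_upwards [hw', hVx, hv', hsum, Lp.coeFn_add f (potOp (pot α β ε φ) (resL hc 0) f),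
    potOp_ae (pot α β ε φ) (resL hc 0) f, pot_ae α β ε φ, norm_R_zero_ae hc f]
    with x k1 k2 k3 k4 k5 k6 k7 k8
  rw [k1, k5, Pi.add_apply, k6, ← k8, k7, k4, k3]
  simp only [k2]
  push_cast
  have := dirac_algebra (ε := ε) hD (u x) (fun k => g k x) (fun j k => G j k x)
    (fun j k => by simp only [hGdef, ddres_symm hc j k]) (φ.fn x) (fun k => (H1.comp (some k) φ x : ℂ))
  push_cast at this
  exact this.symm

end DiracSquare
end DiracVacuum
end

noncomputable section

namespace DiracVacuum

/-! ### The resolvent of the square of a self-adjoint operator -/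

section SquareResolvent

variable {H : Type} [NormedAddCommGroup H] [InnerProductSpace ℂ H] [CompleteSpace H]
variable {T : H →ₗ.[ℂ] H} {S S' : H →L[ℂ] H} {ω μ : ℝ}

/-- `S = (T² + ω²)⁻¹`. -/
def IsSqResolvent (T : H →ₗ.[ℂ] H) (S : H →L[ℂ] H) (ω : ℝ) : Prop :=
  IsBoundedInverse S (addConst (pcomp T T) ((ω ^ 2 : ℝ) : ℂ))

lemma isSqResolvent_iff : IsSqResolvent T S ω ↔
    ∀ x y, (x, y) ∈ (pcomp T T).graph ↔ S (y + ((ω ^ 2 : ℝ) : ℂ) • x) = x :=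
  isBoundedInverse_addConst_iff

lemma _root_.IsSelfAdjoint.inner_sq_graph (hT : IsSelfAdjoint T) {x y x' y' : H}
    (h : (x, y) ∈ (pcomp T T).graph) (h' : (x', y') ∈ (pcomp T T).graph) :
    ⟪y, x'⟫_ℂ = ⟪x, y'⟫_ℂ := by
  obtain ⟨w, hw1, hw2⟩ := mem_graph_pcomp.1 h
  obtain ⟨w', hw1', hw2'⟩ := mem_graph_pcomp.1 h'
  rw [hT.inner_graph hw2 hw1', hT.inner_graph hw1 hw2']

lemma _root_.IsSelfAdjoint.inner_sq_graph_self (hT : IsSelfAdjoint T) {x w y : H}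
    (h : (x, w) ∈ T.graph) (h' : (w, y) ∈ T.graph) : ⟪x, y⟫_ℂ = ((‖w‖ ^ 2 : ℝ) : ℂ) := by
  rw [← hT.inner_graph h h', inner_self_eq_norm_sq_to_K]
  norm_cast

lemma _root_.IsSelfAdjoint.re_inner_sq_graph_nonneg (hT : IsSelfAdjoint T) {x y : H}
    (h : (x, y) ∈ (pcomp T T).graph) : 0 ≤ (⟪x, y⟫_ℂ).re := by
  obtain ⟨w, hw1, hw2⟩ := mem_graph_pcomp.1 h
  rw [hT.inner_sq_graph_self hw1 hw2, Complex.ofReal_re]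
  positivity

lemma re_inner_add_smul_self {x y : H} : (⟪x, y + ((ω ^ 2 : ℝ) : ℂ) • x⟫_ℂ).re
    = (⟪x, y⟫_ℂ).re + ω ^ 2 * ‖x‖ ^ 2 := by
  rw [inner_add_right, inner_smul_right, inner_self_eq_norm_sq_to_K, Complex.add_re]
  congr 1
  rw [Complex.re_ofReal_mul]
  norm_cast

/-- ⟨x, T²x⟩ = ‖Tx‖² ≥ 0, so pairing (T² + ω²)x with x gives at least ω²‖x‖²; Cauchy–Schwarz cancels
one factor ‖x‖. -/
lemma _root_.IsSelfAdjoint.sq_mul_norm_le (hT : IsSelfAdjoint T) (ω : ℝ) {x y : H}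
    (h : (x, y) ∈ (pcomp T T).graph) : ω ^ 2 * ‖x‖ ≤ ‖y + ((ω ^ 2 : ℝ) : ℂ) • x‖ := by
  rcases (norm_nonneg x).eq_or_lt with h0 | h0
  · rw [← h0, mul_zero]; exact norm_nonneg _
  · refine le_of_mul_le_mul_left ?_ h0
    have h1 := re_inner_add_smul_self (ω := ω) (x := x) (y := y)
    have h2 := (Complex.re_le_norm _).trans (norm_inner_le_norm (𝕜 := ℂ) x
      (y + ((ω ^ 2 : ℝ) : ℂ) • x))
    nlinarith [hT.re_inner_sq_graph_nonneg h]

/-- For ω ≠ 0 the lower bound makes T² + ω² injective, so a bounded right inverse is already the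
inverse. -/
lemma isSqResolvent_of_graph (hT : IsSelfAdjoint T) (hω : ω ≠ 0)
    (h : ∀ z, (S z, z - ((ω ^ 2 : ℝ) : ℂ) • S z) ∈ (pcomp T T).graph) : IsSqResolvent T S ω := by
  rw [isSqResolvent_iff]
  intro x y
  have h1 := h (y + ((ω ^ 2 : ℝ) : ℂ) • x)
  set z := y + ((ω ^ 2 : ℝ) : ℂ) • x with hz
  constructor
  · intro hxy
    have h2 := (pcomp T T).graph.sub_mem h1 hxy
    have h3 := hT.sq_mul_norm_le ω h2
    have h4 : (z - ((ω ^ 2 : ℝ) : ℂ) • S z - y) + ((ω ^ 2 : ℝ) : ℂ) • (S z - x) = 0 := by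
      rw [hz, smul_sub]; abel
    dsimp only [Prod.mk_sub_mk] at h3
    rw [h4, norm_zero] at h3
    have h5 : 0 < ω ^ 2 := by positivity
    have h6 : ‖S z - x‖ = 0 := by nlinarith [norm_nonneg (S z - x)]
    exact sub_eq_zero.1 (norm_eq_zero.1 h6)
  · intro hS
    rw [hS] at h1
    convert h1 using 2
    rw [hz]; abel

namespace IsSqResolvent

lemma graph (h : IsSqResolvent T S ω) (z : H) :
    (S z, z - ((ω ^ 2 : ℝ) : ℂ) • S z) ∈ (pcomp T T).graph := by
  rw [isSqResolvent_iff] at h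
  rw [h, sub_add_cancel]

lemma norm_le (h : IsSqResolvent T S ω) (hT : IsSelfAdjoint T) (hω : ω ≠ 0) :
    ‖S‖ ≤ (ω ^ 2)⁻¹ := by
  refine ContinuousLinearMap.opNorm_le_bound _ (by positivity) fun z => ?_
  have h1 := hT.sq_mul_norm_le ω (h.graph z)
  rw [sub_add_cancel] at h1
  rwa [← div_eq_inv_mul, le_div_iff₀ (by positivity), mul_comm]

lemma inner_left (h : IsSqResolvent T S ω) (hT : IsSelfAdjoint T) (z z' : H) :
    ⟪S z, z'⟫_ℂ = ⟪z, S z'⟫_ℂ := by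
  have h1 := hT.inner_sq_graph (h.graph z) (h.graph z')
  rw [inner_sub_left, inner_sub_right, inner_smul_left, inner_smul_right, Complex.conj_ofReal] at h1
  exact (sub_left_injective h1).symm

lemma isSelfAdjoint (h : IsSqResolvent T S ω) (hT : IsSelfAdjoint T) : IsSelfAdjoint S :=
  ContinuousLinearMap.isSelfAdjoint_iff_isSymmetric.2 (h.inner_left hT)

lemma nonneg (h : IsSqResolvent T S ω) (hT : IsSelfAdjoint T) : 0 ≤ S := by
  rw [ContinuousLinearMap.nonneg_iff_isPositive]
  refine ⟨h.inner_left hT, fun z => ?_⟩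
  rw [ContinuousLinearMap.reApplyInnerSelf_apply]
  have h1 := re_inner_add_smul_self (ω := ω) (x := S z) (y := z - ((ω ^ 2 : ℝ) : ℂ) • S z)
  rw [sub_add_cancel] at h1
  change 0 ≤ (⟪S z, z⟫_ℂ).re
  rw [h1]
  have := hT.re_inner_sq_graph_nonneg (h.graph z)
  positivity

/-- The resolvent identity. -/
lemma sub_eq (h : IsSqResolvent T S ω) (h' : IsSqResolvent T S' μ) :
    S - S' = ((μ ^ 2 - ω ^ 2 : ℝ) : ℂ) • (S' * S) := by
  ext1 z
  have h1 := (isSqResolvent_iff.1 h' _ _).1 (h.graph z)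
  have h2 : z - ((ω ^ 2 : ℝ) : ℂ) • S z + ((μ ^ 2 : ℝ) : ℂ) • S z
      = z + ((μ ^ 2 - ω ^ 2 : ℝ) : ℂ) • S z := by
    rw [Complex.ofReal_sub, sub_smul]; abel
  rw [h2, map_add, map_smul] at h1
  rw [sub_apply, smul_apply, mul_apply_eq_comp]
  exact sub_eq_of_eq_add' h1.symm

/-- The resolvent identity, used in both directions, produces the two orders of the product; the
nonzero scalar μ² − ω² can be divided out. -/
lemma commute (h : IsSqResolvent T S ω) (h' : IsSqResolvent T S' μ) (hne : μ ^ 2 ≠ ω ^ 2) :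
    S * S' = S' * S := by
  have h1 := h.sub_eq h'
  have h2 := h'.sub_eq h
  have h3 : ((μ ^ 2 - ω ^ 2 : ℝ) : ℂ) ≠ 0 := by exact_mod_cast sub_ne_zero.2 hne
  refine smul_right_injective _ h3 ?_
  dsimp only
  rw [← h1, ← neg_sub S' S, h2, ← neg_smul, ← Complex.ofReal_neg, neg_sub]

end IsSqResolvent

/-- If `T` is self-adjoint and `T²` has the bounded right inverse `S`, then `T` has a bounded
inverse. -/
lemma exists_isBoundedInverse_of_sq (hT : IsSelfAdjoint T)
    (h : ∀ z, (S z, z) ∈ (pcomp T T).graph) : ∃ B, IsBoundedInverse B T := by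
  have hinj : ∀ x, (x, (0 : H)) ∈ T.graph → x = 0 := by
    intro x hx
    obtain ⟨w, hw1, hw2⟩ := mem_graph_pcomp.1 (h x)
    have := hT.inner_graph hx hw2
    rw [inner_zero_left] at this
    exact inner_self_eq_zero.1 this.symm
  -- B = T S, which is bounded because ‖Bz‖² = ⟨Sz, T²Sz⟩ = ⟨Sz, z⟩.
  choose B hB1 hB2 using fun z => mem_graph_pcomp.1 (h z)
  have huniq : ∀ x y, (x, y) ∈ T.graph → B y = x := by
    intro x y hxy
    have := T.graph.sub_mem (hB2 y) hxy
    rw [Prod.mk_sub_mk, sub_self] at this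
    exact sub_eq_zero.1 (hinj _ this)
  let BL : H →ₗ[ℂ] H :=
    { toFun := B
      map_add' := fun a b => huniq _ _ (T.graph.add_mem (hB2 a) (hB2 b))
      map_smul' := fun c a => huniq _ _ (T.graph.smul_mem c (hB2 a)) }
  refine ⟨BL.mkContinuous (√‖S‖) fun z => ?_, isBoundedInverse_iff.2 fun x y => ?_⟩
  · change ‖B z‖ ≤ √‖S‖ * ‖z‖
    refine le_of_sq_le_sq ?_ (by positivity)
    have h1 : ‖B z‖ ^ 2 = ‖⟪S z, z⟫_ℂ‖ := by
      rw [hT.inner_sq_graph_self (hB1 z) (hB2 z), Complex.norm_real, Real.norm_of_nonneg]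
      positivity
    rw [h1, mul_pow, Real.sq_sqrt (norm_nonneg _), sq, ← mul_assoc]
    exact (norm_inner_le_norm _ _).trans
      (mul_le_mul_of_nonneg_right (S.le_opNorm z) (norm_nonneg z))
  · exact ⟨huniq x y, fun hx => by rw [← hx]; exact hB2 y⟩

/-- If `T` has a bounded inverse, so has `T²`. -/
lemma isSqResolvent_zero {B : H →L[ℂ] H} (h : IsBoundedInverse B T) : IsSqResolvent T (B * B) 0 := by
  rw [isBoundedInverse_iff] at h
  rw [isSqResolvent_iff]
  intro x y
  rw [mem_graph_pcomp]
  simp only [h]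
  simp

end SquareResolvent
end DiracVacuum
end

noncomputable section

namespace DiracVacuum

open FourierTransform
open scoped BoundedContinuousFunction ENNReal

/-! ### The operators `W (D_0² + ω²)⁻¹` -/

section RelativePotential

variable {c : ℝ} (hc : 0 < c)

/-- The operator `A = W (D_0² + ω²)⁻¹`. -/
def A (W : L2 M4) (ω : ℝ) : L2 C4 →L[ℂ] L2 C4 := potOp W (resL hc ω)

lemma A_add (W W' : L2 M4) (ω : ℝ) : A hc (W + W') ω = A hc W ω + A hc W' ω := by
  rw [A, map_add, add_apply]; rfl

lemma A_smul (r : ℝ) (W : L2 M4) (ω : ℝ) : A hc (r • W) ω = r • A hc W ω := by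
  have : r • W = (r : ℂ) • W := by
    refine Lp.ext ?_
    filter_upwards [Lp.coeFn_smul r W, Lp.coeFn_smul (r : ℂ) W] with x h1 h2
    rw [h1, h2, Pi.smul_apply, Pi.smul_apply, Complex.coe_smul]
  rw [A, this, map_smul, smul_apply, Complex.coe_smul]; rfl

lemma norm_potOp_le (W : L2 M4) (m : L2 ℂ) : ‖potOp W m‖ ≤ 2 * ‖W‖ * ‖m‖ := by
  refine ContinuousLinearMap.opNorm_le_bound _ (by positivity) fun u => ?_
  have : ‖potOp W m u‖ ≤ (2 * ‖m‖ * ‖u‖) * ‖W‖ := by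
    refine Lp.norm_le_mul_norm_of_ae_le_mul ?_
    filter_upwards [potOp_ae W m u] with x hx
    rw [hx, mul_comm (2 * ‖m‖ * ‖u‖)]
    exact ((W x).le_opNorm _).trans (mul_le_mul_of_nonneg_left (norm_evFun_le m u x) (norm_nonneg _))
  exact this.trans_eq (by ring)

lemma norm_A_le (W : L2 M4) (ω : ℝ) : ‖A hc W ω‖ ≤ 2 * ‖W‖ * (resConst c * wt ω) := by
  rw [← norm_resL hc]
  exact norm_potOp_le W _

lemma resConst_nonneg (c : ℝ) : 0 ≤ resConst c := Real.sqrt_nonneg _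

lemma hsBound_A (W : L2 M4) (ω : ℝ) : HSBound (A hc W ω) (2 * ‖W‖ * (resConst c * wt ω)) := by
  have h0 := resConst_nonneg c
  have h1 := wt_pos ω
  refine ⟨by positivity, fun ι b s => ?_⟩
  rw [← norm_resL hc]
  exact sum_sq_norm_potOp_le W _ b.orthonormal s

lemma continuous_A (W : L2 M4) : Continuous (A hc W) :=
  (potOp W).continuous.comp (continuous_resL hc)

lemma evFun_congr {m n : L2 ℂ} {u v : L2 C4}
    (h : ∀ᵐ ξ, m ξ • (𝓕 u : L2 C4) ξ = n ξ • (𝓕 v : L2 C4) ξ) (x : R3) :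
    evFun m u x = evFun n v x := by
  rw [evFun_eq_integral, evFun_eq_integral]
  refine integral_congr_ae ?_
  filter_upwards [h] with ξ hξ
  rw [hξ]

lemma resL_ae (ω : ℝ) : ∀ᵐ ξ, resL hc ω ξ = res c ω ξ := (memLp_res hc ω).coeFn_toLp

/-- Both sides are W after the multiplier with symbol res c ω · res c τ. The exchange transfers
decay in ω to a resolvent on the right, as in `FreeData.N_mul_A_mul_R`. -/
lemma A_mul_R (W : L2 M4) (ω τ : ℝ) : A hc W ω * R c τ = A hc W τ * R c ω := by
  ext1 f
  rw [mul_apply_eq_comp, mul_apply_eq_comp]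
  refine Lp.ext ?_
  filter_upwards [potOp_ae W (resL hc ω) (R c τ f), potOp_ae W (resL hc τ) (R c ω f)] with x h1 h2
  rw [A, h1, A, h2]
  congr 1
  refine evFun_congr ?_ x
  filter_upwards [resL_ae hc ω, resL_ae hc τ, fourier_fmul_ae (res c ω) f,
    fourier_fmul_ae (res c τ) f] with ξ k1 k2 k3 k4
  rw [R, R, k1, k2, k3, k4, smul_comm]

lemma A_sub (W : L2 M4) (ω τ : ℝ) :
    A hc W ω - A hc W τ = ((τ ^ 2 - ω ^ 2 : ℝ) : ℂ) • (A hc W ω * R c τ) := by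
  ext1 f
  rw [sub_apply, smul_apply, mul_apply_eq_comp, sub_eq_iff_eq_add', ← map_smul]
  refine Lp.ext ?_
  filter_upwards [potOp_ae W (resL hc ω) f, potOp_ae W (resL hc τ) f,
    potOp_ae W (resL hc ω) (((τ ^ 2 - ω ^ 2 : ℝ) : ℂ) • R c τ f),
    Lp.coeFn_add (A hc W τ f) (A hc W ω (((τ ^ 2 - ω ^ 2 : ℝ) : ℂ) • R c τ f))] with x h1 h2 h3 h4
  rw [h4, Pi.add_apply, A, A, h1, h2, h3, ← map_add]
  congr 1
  rw [evFun_eq_integral, evFun_eq_integral, evFun_eq_integral,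
    ← integral_add (integrable_char_smul _ _ x) (integrable_char_smul _ _ x)]
  refine integral_congr_ae ?_
  filter_upwards [resL_ae hc ω, resL_ae hc τ, fourier_fmul_ae (res c τ) f,
    fourier_smul_ae ((τ ^ 2 - ω ^ 2 : ℝ) : ℂ) (R c τ f)] with ξ k1 k2 k3 k4
  rw [k1, k2, k4, R, k3, ← smul_add, smul_smul, smul_smul, ← add_smul]
  congr 2
  have := DFunLike.congr_fun (res_sub c ω τ) ξ
  simp only [BoundedContinuousFunction.coe_sub, Pi.sub_apply, BoundedContinuousFunction.coe_smul,
    BoundedContinuousFunction.coe_mul, Pi.mul_apply, smul_eq_mul] at this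
  linear_combination this

/-- Change of the spectral parameter. -/
lemma one_add_A_mul (W : L2 M4) (ω μ : ℝ) :
    (1 + A hc W ω) * (1 - ((μ ^ 2 - ω ^ 2 : ℝ) : ℂ) • R c μ)
      = 1 + A hc W μ - ((μ ^ 2 - ω ^ 2 : ℝ) : ℂ) • R c μ := by
  have h := A_sub hc W ω μ
  rw [mul_sub, mul_one, add_mul, one_mul, mul_smul_comm, ← h]
  abel

lemma one_sub_R_mul (ω μ : ℝ) : (1 - ((μ ^ 2 - ω ^ 2 : ℝ) : ℂ) • R c μ) *
    (1 + ((μ ^ 2 - ω ^ 2 : ℝ) : ℂ) • R c ω) = 1 := by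
  have h := R_sub c ω μ
  rw [R_commute] at h
  rw [sub_mul, one_mul, mul_add, mul_one, smul_mul_assoc, mul_smul_comm, ← h, smul_sub]
  abel

lemma one_sub_mul_one_add_comm {𝔄 : Type} [Ring 𝔄] [Algebra ℂ 𝔄] {a b : 𝔄} (h : a * b = b * a)
    (δ : ℂ) : (1 - δ • a) * (1 + δ • b) = (1 + δ • b) * (1 - δ • a) := by
  simp only [sub_mul, mul_sub, add_mul, mul_add, one_mul, mul_one, smul_mul_assoc, mul_smul_comm, h,
    smul_sub, smul_add]
  abel

lemma isUnit_one_sub_R (ω μ : ℝ) : IsUnit (1 - ((μ ^ 2 - ω ^ 2 : ℝ) : ℂ) • R c μ) :=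
  ⟨⟨_, 1 + ((μ ^ 2 - ω ^ 2 : ℝ) : ℂ) • R c ω, one_sub_R_mul ω μ,
    (one_sub_mul_one_add_comm (R_commute c μ ω) _).symm.trans (one_sub_R_mul ω μ)⟩, rfl⟩

/-- The resolvent factor `N = (1 + A)⁻¹` (and `0` if there is none). -/
def N (W : L2 M4) (ω : ℝ) : L2 C4 →L[ℂ] L2 C4 := Ring.inverse (1 + A hc W ω)

lemma A_mul_N {W : L2 M4} {ω : ℝ} (h : IsUnit (1 + A hc W ω)) : A hc W ω * N hc W ω = 1 - N hc W ω := by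
  have := Ring.mul_inverse_cancel _ h
  rw [add_mul, one_mul] at this
  exact eq_sub_of_add_eq' this

lemma norm_one_le : ‖(1 : L2 C4 →L[ℂ] L2 C4)‖ ≤ 1 := ContinuousLinearMap.norm_id_le

lemma isUnit_of_norm_lt {W : L2 M4} {ω : ℝ} (h : ‖A hc W ω‖ < 1) : IsUnit (1 + A hc W ω) := by
  have := (Units.oneSub (-A hc W ω) (by rwa [norm_neg])).isUnit
  simpa using this

lemma norm_N_le_two {W : L2 M4} {ω : ℝ} (h : ‖A hc W ω‖ ≤ 1 / 2) : ‖N hc W ω‖ ≤ 2 := by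
  have h1 := A_mul_N hc (isUnit_of_norm_lt hc (h.trans_lt (by norm_num)))
  have h2 : N hc W ω = 1 - A hc W ω * N hc W ω := by rw [h1]; abel
  have h3 : ‖N hc W ω‖ ≤ 1 + 1 / 2 * ‖N hc W ω‖ := by
    conv_lhs => rw [h2]
    exact (norm_sub_le _ _).trans (add_le_add norm_one_le
      ((norm_mul_le _ _).trans (mul_le_mul_of_nonneg_right h (norm_nonneg _))))
  linarith

/-- The threshold beyond which `‖A‖ ≤ 1/2` for `‖W‖ ≤ K`. -/
def thr (c K : ℝ) : ℝ := 1 + 4 * (2 * K * resConst c) ^ 2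

lemma one_le_thr (c K : ℝ) : 1 ≤ thr c K := by unfold thr; nlinarith [sq_nonneg (2 * K * resConst c)]

/-- Since ‖A‖ ≤ L wt ω with L = 2K · resConst c and wt⁴ = (1 + ω²)⁻¹, it suffices that 16L⁴ ≤ 1 +
ω², which follows from 4L² ≤ |ω|. -/
lemma norm_A_le_half {W : L2 M4} {ω K : ℝ} (hK : ‖W‖ ≤ K) (hω : thr c K ≤ |ω|) :
    ‖A hc W ω‖ ≤ 1 / 2 := by
  have h0 := resConst_nonneg c
  have hK0 : 0 ≤ K := (norm_nonneg _).trans hK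
  have hw := wt_pos ω
  set L := 2 * K * resConst c with hL
  have hL0 : 0 ≤ L := by positivity
  have h1 : ‖A hc W ω‖ ≤ L * wt ω := by
    refine (norm_A_le hc W ω).trans ?_
    rw [hL, mul_assoc (2 * K)]
    exact mul_le_mul_of_nonneg_right (by linarith) (by positivity)
  refine h1.trans ((pow_le_pow_iff_left₀ (by positivity) (by norm_num) four_ne_zero).1 ?_)
  rw [mul_pow, wt_pow_four, ← div_eq_mul_inv, div_le_iff₀ (by positivity), ← sq_abs ω]
  have h2 : 4 * L ^ 2 ≤ |ω| := le_trans (by rw [thr]; linarith) hω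
  have h3 := pow_le_pow_left₀ (by positivity) h2 2
  nlinarith

lemma isUnit_of_thr {W : L2 M4} {ω K : ℝ} (hK : ‖W‖ ≤ K) (hω : thr c K ≤ |ω|) :
    IsUnit (1 + A hc W ω) :=
  isUnit_of_norm_lt hc ((norm_A_le_half hc hK hω).trans_lt (by norm_num))

/-- R_μ N_μ is going to be the resolvent (D_φ² + μ²)⁻¹. Up to invertible factors 1 + A_ω equals 1 −
(μ² − ω²)R_μ N_μ, so a single good parameter μ decides invertibility at every ω (`isUnit_iff`). -/
lemma one_add_A_mul_eq {W : L2 M4} {μ : ℝ} (h : IsUnit (1 + A hc W μ)) (ω : ℝ) :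
    (1 + A hc W ω) * (1 - ((μ ^ 2 - ω ^ 2 : ℝ) : ℂ) • R c μ)
      = (1 - ((μ ^ 2 - ω ^ 2 : ℝ) : ℂ) • (R c μ * N hc W μ)) * (1 + A hc W μ) := by
  rw [one_add_A_mul, sub_mul, one_mul, smul_mul_assoc, mul_assoc, N, Ring.inverse_mul_cancel _ h,
    mul_one]

lemma isUnit_iff_of_mul_eq {𝔄 : Type} [Monoid 𝔄] {u v w x : 𝔄} (hv : IsUnit v) (hx : IsUnit x)
    (h : u * v = w * x) : IsUnit u ↔ IsUnit w := by
  obtain ⟨v, rfl⟩ := hv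
  obtain ⟨x, rfl⟩ := hx
  rw [← Units.isUnit_mul_units u v, h, Units.isUnit_mul_units]

lemma isUnit_iff {W : L2 M4} {μ : ℝ} (h : IsUnit (1 + A hc W μ)) (ω : ℝ) :
    IsUnit (1 + A hc W ω) ↔
      IsUnit (1 - ((μ ^ 2 - ω ^ 2 : ℝ) : ℂ) • (R c μ * N hc W μ)) :=
  isUnit_iff_of_mul_eq (isUnit_one_sub_R ω μ) h (one_add_A_mul_eq hc h ω)

end RelativePotential

/-! ### Self-adjointness of D_φ and the resolvent of D_φ² -/

section DiracResolvent

variable {α : Fin 3 → Matrix (Fin 4) (Fin 4) ℂ} {β : Matrix (Fin 4) (Fin 4) ℂ} {ε : ℝ}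

/-- Reduces to the case ω = 0, which is `dirac_sq`, by writing R_ω f = R_0(f − ω²R_ω f). -/
lemma graph_R (hD : IsDiracMatrices α β) (hε : 0 < ε)
    (hc : 0 < 2 * Real.pi * ε) (φ : H1) (ω : ℝ) (f : L2 C4) : (R (2 * Real.pi * ε) ω f,
    f + A hc (pot α β ε φ) ω f - ((ω ^ 2 : ℝ) : ℂ) • R (2 * Real.pi * ε) ω f) ∈
      (pcomp (dirac α β ε φ) (dirac α β ε φ)).graph := by
  set c := 2 * Real.pi * ε
  obtain ⟨v, hv1, hv2⟩ := dirac_sq hD hε hc φ (f - ((ω ^ 2 : ℝ) : ℂ) • R c ω f)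
  have h := mem_graph_pcomp.2 ⟨v, hv1, hv2⟩
  have e1 : R c 0 (f - ((ω ^ 2 : ℝ) : ℂ) • R c ω f) = R c ω f := by
    have h1 := DFunLike.congr_fun (R_sub c ω 0) f
    rw [R_commute, sub_apply, smul_apply, mul_apply_eq_comp] at h1
    rw [map_sub, map_smul, eq_comm, ← sub_eq_zero]
    have : R c ω f - (R c 0 f - ((ω ^ 2 : ℝ) : ℂ) • R c 0 (R c ω f))
        = (R c ω f - R c 0 f) + ((ω ^ 2 : ℝ) : ℂ) • R c 0 (R c ω f) := by abel
    rw [this, h1, ← add_smul, ← Complex.ofReal_add]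
    simp
  have e2 : A hc (pot α β ε φ) 0 (f - ((ω ^ 2 : ℝ) : ℂ) • R c ω f) = A hc (pot α β ε φ) ω f := by
    have h1 := DFunLike.congr_fun (A_sub hc (pot α β ε φ) ω 0) f
    rw [A_mul_R, sub_apply, smul_apply, mul_apply_eq_comp] at h1
    rw [map_sub, map_smul, eq_comm, ← sub_eq_zero]
    have : ∀ a b d : L2 C4, a - (b - d) = (a - b) + d := fun a b d => by abel
    rw [this, h1, ← add_smul, ← Complex.ofReal_add]
    simp
  rw [e1] at h
  convert h using 2
  change _ = _ + A hc (pot α β ε φ) 0 _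
  rw [e2]
  abel

lemma graph_R_N (hD : IsDiracMatrices α β) (hε : 0 < ε)
    (hc : 0 < 2 * Real.pi * ε) {φ : H1} {ω : ℝ} (h : IsUnit (1 + A hc (pot α β ε φ) ω)) (z : L2 C4) :
    ((R (2 * Real.pi * ε) ω * N hc (pot α β ε φ) ω) z,
      z - ((ω ^ 2 : ℝ) : ℂ) • (R (2 * Real.pi * ε) ω * N hc (pot α β ε φ) ω) z) ∈
      (pcomp (dirac α β ε φ) (dirac α β ε φ)).graph := by
  have h1 := graph_R hD hε hc φ ω (N hc (pot α β ε φ) ω z)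
  have h2 := DFunLike.congr_fun (Ring.mul_inverse_cancel _ h) z
  rw [mul_apply_eq_comp, add_apply] at h2
  change N hc (pot α β ε φ) ω z + A hc (pot α β ε φ) ω (N hc (pot α β ε φ) ω z) = z at h2
  rw [h2] at h1
  exact h1

/-- For large ω the Neumann series inverts 1 + A_ω, so D_φ² + ω² is onto; a symmetric operator with
this property is self-adjoint. -/
theorem isSelfAdjoint_dirac (hD : IsDiracMatrices α β) (hε : 0 < ε)
    (hc : 0 < 2 * Real.pi * ε) (φ : H1) : IsSelfAdjoint (dirac α β ε φ) := by
  set ω := thr (2 * Real.pi * ε) ‖pot α β ε φ‖ with hω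
  have h1 : 1 ≤ ω := one_le_thr _ _
  have hu : IsUnit (1 + A hc (pot α β ε φ) ω) := isUnit_of_thr hc le_rfl (le_abs_self _)
  refine isSelfAdjoint_of_surjective (ω := ω) (by positivity)
    (fun x y x' y' h h' => dirac_symmetric hD φ h h') fun z => ?_
  obtain ⟨y, hy1, hy2⟩ := mem_graph_pcomp.1 (graph_R_N hD hε hc hu z)
  exact ⟨_, y, _, hy1, hy2, sub_add_cancel _ _⟩

lemma isSqResolvent_R_N (hD : IsDiracMatrices α β) (hε : 0 < ε)
    (hc : 0 < 2 * Real.pi * ε) {φ : H1} {ω : ℝ} (hω : ω ≠ 0) (h : IsUnit (1 + A hc (pot α β ε φ) ω)) :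
    IsSqResolvent (dirac α β ε φ) (R (2 * Real.pi * ε) ω * N hc (pot α β ε φ) ω) ω :=
  isSqResolvent_of_graph (isSelfAdjoint_dirac hD hε hc φ) hω (graph_R_N hD hε hc h)

/-- For μ ≥ |ω| above the threshold, self-adjointness gives ‖(D_φ² + μ²)⁻¹‖ ≤ μ⁻². So (μ² − ω²)(D_φ²
+ μ²)⁻¹ has norm below 1 and `isUnit_iff` applies. -/
theorem isUnit_of_ne_zero (hD : IsDiracMatrices α β) (hε : 0 < ε)
    (hc : 0 < 2 * Real.pi * ε) (φ : H1) {ω : ℝ} (hω : ω ≠ 0) : IsUnit (1 + A hc (pot α β ε φ) ω) := by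
  set μ := max (thr (2 * Real.pi * ε) ‖pot α β ε φ‖) |ω| with hμ
  have h1 : 1 ≤ μ := (one_le_thr _ _).trans (le_max_left _ _)
  have hu : IsUnit (1 + A hc (pot α β ε φ) μ) :=
    isUnit_of_thr hc le_rfl ((le_max_left _ _).trans (le_abs_self _))
  rw [isUnit_iff hc hu ω]
  have h2 := (isSqResolvent_R_N hD hε hc (by positivity) hu).norm_le
    (isSelfAdjoint_dirac hD hε hc φ) (by positivity)
  refine (Units.oneSub _ ?_).isUnit
  have h3 : ω ^ 2 ≤ μ ^ 2 := by
    rw [← sq_abs ω]; exact pow_le_pow_left₀ (abs_nonneg _) (le_max_right _ _) 2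
  rw [norm_smul, Complex.norm_real, Real.norm_of_nonneg (by linarith)]
  refine (mul_le_mul_of_nonneg_left h2 (by linarith)).trans_lt ?_
  rw [← div_eq_mul_inv, div_lt_one (by positivity)]
  have : 0 < ω ^ 2 := by positivity
  linarith

end DiracResolvent
end DiracVacuum
end

noncomputable section

namespace DiracVacuum

open scoped BoundedContinuousFunction ENNReal

/-! ### Behaviour of the resolvent near ω = 0 and the spectral gap -/

section ResolventBounds

variable {α : Fin 3 → Matrix (Fin 4) (Fin 4) ℂ} {β : Matrix (Fin 4) (Fin 4) ℂ} {ε : ℝ}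

lemma abs_sub_sq_le {ω μ : ℝ} (h : |ω| ≤ μ) : |μ ^ 2 - ω ^ 2| ≤ μ ^ 2 := by
  have h1 : ω ^ 2 ≤ μ ^ 2 := by
    rw [← sq_abs ω]; exact pow_le_pow_left₀ (abs_nonneg _) h 2
  rw [abs_of_nonneg (by linarith)]
  nlinarith [sq_nonneg ω]

lemma norm_one_add_smul_le {H : Type} [NormedAddCommGroup H] [InnerProductSpace ℂ H] (δ : ℝ)
    (X : H →L[ℂ] H) : ‖1 + (δ : ℂ) • X‖ ≤ 1 + |δ| * ‖X‖ := by
  refine (norm_add_le _ _).trans (add_le_add ContinuousLinearMap.norm_id_le ?_)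
  rw [norm_smul, Complex.norm_real, Real.norm_eq_abs]

/-- The possible singularity of N_ω at ω = 0 is isolated in (D_φ² + ω²)⁻¹, whose norm is at most
ω⁻², while μ may be kept large and fixed. -/
lemma N_eq (hD : IsDiracMatrices α β) (hε : 0 < ε) (hc : 0 < 2 * Real.pi * ε) (φ : H1) {ω μ : ℝ}
    (hω : ω ≠ 0) (hμ : μ ≠ 0) : N hc (pot α β ε φ) ω =
      (1 - ((μ ^ 2 - ω ^ 2 : ℝ) : ℂ) • R (2 * Real.pi * ε) μ) * N hc (pot α β ε φ) μ *
        (1 + ((μ ^ 2 - ω ^ 2 : ℝ) : ℂ) • (R (2 * Real.pi * ε) ω * N hc (pot α β ε φ) ω)) := by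
  have hu := isUnit_of_ne_zero hD hε hc φ hω
  have hv := isUnit_of_ne_zero hD hε hc φ hμ
  have h1 := one_add_A_mul_eq hc hv ω
  have h2 := (isSqResolvent_R_N hD hε hc hω hu).sub_eq (isSqResolvent_R_N hD hε hc hμ hv)
  set Sω := R (2 * Real.pi * ε) ω * N hc (pot α β ε φ) ω
  set Sμ := R (2 * Real.pi * ε) μ * N hc (pot α β ε φ) μ
  set δ : ℂ := ((μ ^ 2 - ω ^ 2 : ℝ) : ℂ)
  have h3 : (1 - δ • Sμ) * (1 + δ • Sω) = 1 := by
    rw [sub_mul, one_mul, mul_add, mul_one, smul_mul_assoc, mul_smul_comm, ← h2, smul_sub]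
    abel
  have h4 : 1 = (1 + A hc (pot α β ε φ) ω) * ((1 - δ • R (2 * Real.pi * ε) μ) *
      N hc (pot α β ε φ) μ * (1 + δ • Sω)) := by
    rw [← mul_assoc, ← mul_assoc, h1, mul_assoc (1 - δ • Sμ), N, Ring.mul_inverse_cancel _ hv,
      mul_one, h3]
  have h5 := (Ring.inverse_mul_eq_iff_eq_mul _ _ _ hu).2 h4
  rwa [mul_one] at h5

/-- Above the threshold ‖N‖ ≤ 2; below it, `N_eq` with μ the threshold and ‖(D_φ² + ω²)⁻¹‖ ≤ ω⁻².
The constant depends on φ only through K, hence is locally uniform in φ. -/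
lemma sq_mul_norm_N_le (hD : IsDiracMatrices α β) (hε : 0 < ε) (hc : 0 < 2 * Real.pi * ε) {φ : H1}
    {K ω : ℝ} (hK : ‖pot α β ε φ‖ ≤ K) (hω : ω ≠ 0) :
    ω ^ 2 * ‖N hc (pot α β ε φ) ω‖ ≤ 2 * (1 + thr (2 * Real.pi * ε) K ^ 2) ^ 2 * (1 + ω ^ 2) := by
  set μ := thr (2 * Real.pi * ε) K with hμ
  have h1 : 1 ≤ μ := one_le_thr _ _
  have hω2 : 0 < ω ^ 2 := by positivity
  rcases le_total μ |ω| with h | h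
  · have h2 := norm_N_le_two hc (norm_A_le_half hc hK h)
    nlinarith [mul_le_mul_of_nonneg_left h2 hω2.le, sq_nonneg μ, mul_nonneg (sq_nonneg μ) hω2.le,
      mul_nonneg (mul_nonneg (sq_nonneg μ) (sq_nonneg μ)) hω2.le, sq_nonneg (μ ^ 2)]
  · have hμ0 : μ ≠ 0 := by positivity
    have h2 := norm_N_le_two hc (norm_A_le_half hc hK (le_abs_self μ))
    have h3 := (isSqResolvent_R_N hD hε hc hω (isUnit_of_ne_zero hD hε hc φ hω)).norm_le
      (isSelfAdjoint_dirac hD hε hc φ) hω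
    have h4 := abs_sub_sq_le h
    have h5 : ‖1 - ((μ ^ 2 - ω ^ 2 : ℝ) : ℂ) • R (2 * Real.pi * ε) μ‖ ≤ 1 + μ ^ 2 := by
      have := norm_one_add_smul_le (-(μ ^ 2 - ω ^ 2)) (R (2 * Real.pi * ε) μ)
      rw [Complex.ofReal_neg, neg_smul, ← sub_eq_add_neg, abs_neg] at this
      refine this.trans (add_le_add_right ?_ _)
      exact (mul_le_mul h4 (norm_R_le_one _ _) (norm_nonneg _) (sq_nonneg μ)).trans_eq (mul_one _)
    have h6 := norm_one_add_smul_le (μ ^ 2 - ω ^ 2)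
      (R (2 * Real.pi * ε) ω * N hc (pot α β ε φ) ω)
    have h7 : ω ^ 2 * ‖1 + ((μ ^ 2 - ω ^ 2 : ℝ) : ℂ) •
        (R (2 * Real.pi * ε) ω * N hc (pot α β ε φ) ω)‖ ≤ ω ^ 2 + μ ^ 2 := by
      refine (mul_le_mul_of_nonneg_left (h6.trans (add_le_add_right
        (mul_le_mul h4 h3 (norm_nonneg _) (sq_nonneg μ)) _)) hω2.le).trans_eq ?_
      field_simp
    rw [N_eq hD hε hc φ hω hμ0]
    refine (mul_le_mul_of_nonneg_left (norm_mul₃_le) hω2.le).trans ?_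
    calc _ = (‖1 - ((μ ^ 2 - ω ^ 2 : ℝ) : ℂ) • R (2 * Real.pi * ε) μ‖ * ‖N hc (pot α β ε φ) μ‖) *
          (ω ^ 2 * ‖1 + ((μ ^ 2 - ω ^ 2 : ℝ) : ℂ) •
            (R (2 * Real.pi * ε) ω * N hc (pot α β ε φ) ω)‖) := by ring
      _ ≤ ((1 + μ ^ 2) * 2) * (ω ^ 2 + μ ^ 2) := by gcongr
      _ ≤ _ := by nlinarith [mul_nonneg (sq_nonneg μ) hω2.le, sq_nonneg μ, sq_nonneg (μ ^ 2),
                    mul_nonneg (mul_nonneg (sq_nonneg μ) (sq_nonneg μ)) hω2.le]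

/-- `0 ∉ σ(D_φ)` in terms of the Birman–Schwinger type operator `A`. -/
lemma mem_gapSet_iff (hD : IsDiracMatrices α β) (hε : 0 < ε) (hc : 0 < 2 * Real.pi * ε) (φ : H1) :
    φ ∈ gapSet α β ε ↔ IsUnit (1 + A hc (pot α β ε φ) 0) := by
  have hadd : addConst (dirac α β ε φ) (-0) = dirac α β ε φ := by
    refine LinearPMap.eq_of_eq_graph (Submodule.ext fun p => ?_)
    obtain ⟨x, y⟩ := p
    rw [mem_graph_addConst]
    simp
  have hT := isSelfAdjoint_dirac hD hε hc φ
  rw [gapSet, Set.mem_ofPred_eq, pspectrum, Set.mem_ofPred_eq, not_not, hadd]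
  constructor
  -- B² inverts D_φ², so the resolvent identity between the parameters 0 and 1 exhibits 1 + B² as
  -- the inverse of 1 − (D_φ² + 1)⁻¹.
  · rintro ⟨B, hB⟩
    have h0 := isSqResolvent_zero hB
    have hu := isUnit_of_ne_zero hD hε hc φ one_ne_zero
    have h1 := isSqResolvent_R_N hD hε hc one_ne_zero hu
    rw [isUnit_iff hc hu 0]
    set S := R (2 * Real.pi * ε) 1 * N hc (pot α β ε φ) 1
    have h2 := h0.sub_eq h1
    have h3 := h0.commute h1 (by norm_num)
    set δ : ℂ := ((1 ^ 2 - 0 ^ 2 : ℝ) : ℂ)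
    have h4 : (1 - δ • S) * (1 + δ • (B * B)) = 1 := by
      rw [sub_mul, one_mul, mul_add, mul_one, smul_mul_assoc, mul_smul_comm, ← h2, smul_sub]
      abel
    exact ⟨⟨_, _, h4, (one_sub_mul_one_add_comm h3.symm δ).symm.trans h4⟩, rfl⟩
  · intro hu
    refine exists_isBoundedInverse_of_sq hT (S := R (2 * Real.pi * ε) 0 * N hc (pot α β ε φ) 0)
      fun z => ?_
    have := graph_R_N hD hε hc hu z
    simpa using this

lemma contDiff_linear_add_quadratic {E F : Type} [NormedAddCommGroup E] [NormedSpace ℝ E]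
    [NormedAddCommGroup F] [NormedSpace ℝ F] (L : E →L[ℝ] F) (B : E →L[ℝ] E →L[ℝ] F)
    {n : WithTop ℕ∞} : ContDiff ℝ n fun x => L x + B x x :=
  L.contDiff.add (B.contDiff.clm_apply contDiff_id)

lemma contDiff_pot (α : Fin 3 → Matrix (Fin 4) (Fin 4) ℂ) (β : Matrix (Fin 4) (Fin 4) ℂ) (ε : ℝ)
    {n : WithTop ℕ∞} : ContDiff ℝ n (pot α β ε) :=
  contDiff_linear_add_quadratic (linPot α β ε) quadPot

lemma continuous_A_left {c : ℝ} (hc : 0 < c) (ω : ℝ) : Continuous fun W => A hc W ω :=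
  (potOp.flip (resL hc ω)).continuous

lemma isOpen_gapSet (hD : IsDiracMatrices α β) (hε : 0 < ε) : IsOpen (gapSet α β ε) := by
  have hc : 0 < 2 * Real.pi * ε := by positivity
  have : gapSet α β ε = (fun φ => 1 + A hc (pot α β ε φ) 0) ⁻¹' {x | IsUnit x} := by
    ext φ
    exact mem_gapSet_iff hD hε hc φ
  rw [this]
  refine Units.isOpen.preimage ?_
  have := (continuous_A_left hc 0).comp (contDiff_pot α β ε (n := 0)).continuous
  exact continuous_const.add this

end ResolventBounds

/-! ### The absolute value of D_φ on H² -/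

section AbsoluteValue

variable {α : Fin 3 → Matrix (Fin 4) (Fin 4) ℂ} {β : Matrix (Fin 4) (Fin 4) ℂ} {ε : ℝ}

/-- The operator `D_φ²/(D_φ² + ω²)`. -/
lemma quotientOp_eq (hD : IsDiracMatrices α β) (hε : 0 < ε) (hc : 0 < 2 * Real.pi * ε) (φ : H1)
    (ω : ℝ) : quotientOp α β ε φ ω = 1 - ((ω ^ 2 : ℝ) : ℂ) •
      (R (2 * Real.pi * ε) ω * N hc (pot α β ε φ) ω) := by
  rw [quotientOp]
  rcases eq_or_ne ω 0 with rfl | hω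
  · simp
  · rw [IsBoundedInverse.boundedInverse_eq
      (isSqResolvent_R_N hD hε hc hω (isUnit_of_ne_zero hD hε hc φ hω))]

/-- The first resolvent `S = (D_φ² + 1)⁻¹`. -/
def resOne (hc : 0 < 2 * Real.pi * ε) (W : L2 M4) : L2 C4 →L[ℂ] L2 C4 :=
  R (2 * Real.pi * ε) 1 * N hc W 1

lemma isSqResolvent_resOne (hD : IsDiracMatrices α β) (hε : 0 < ε) (hc : 0 < 2 * Real.pi * ε)
    (φ : H1) : IsSqResolvent (dirac α β ε φ) (resOne hc (pot α β ε φ)) 1 :=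
  isSqResolvent_R_N hD hε hc one_ne_zero (isUnit_of_ne_zero hD hε hc φ one_ne_zero)

lemma resOne_graph_iff (hD : IsDiracMatrices α β) (hε : 0 < ε) (hc : 0 < 2 * Real.pi * ε)
    (φ : H1) (x y : L2 C4) : (x, y) ∈ (pcomp (dirac α β ε φ) (dirac α β ε φ)).graph ↔
      resOne hc (pot α β ε φ) (y + x) = x := by
  rw [isSqResolvent_iff.1 (isSqResolvent_resOne hD hε hc φ)]
  simp

lemma norm_resOne_le (hD : IsDiracMatrices α β) (hε : 0 < ε) (hc : 0 < 2 * Real.pi * ε)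
    (φ : H1) : ‖resOne hc (pot α β ε φ)‖ ≤ 1 := by
  simpa using (isSqResolvent_resOne hD hε hc φ).norm_le (isSelfAdjoint_dirac hD hε hc φ) one_ne_zero

theorem isAbs_absOp (hD : IsDiracMatrices α β) (hε : 0 < ε) (φ : H1) :
    IsAbs (absOp (dirac α β ε φ)) (dirac α β ε φ) := by
  have hc : 0 < 2 * Real.pi * ε := by positivity
  have hT := isSelfAdjoint_dirac hD hε hc φ
  have h : ∃ A, IsAbs A (dirac α β ε φ) := exists_isAbs hT
    ((isSqResolvent_resOne hD hε hc φ).nonneg hT) (norm_resOne_le hD hε hc φ)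
    (resOne_graph_iff hD hε hc φ)
  rw [absOp, dif_pos h]
  exact h.choose_spec

/-- `|D_φ| (D_0²)⁻¹` as a bounded operator. -/
def absR (hc : 0 < 2 * Real.pi * ε) (W : L2 M4) : L2 C4 →L[ℂ] L2 C4 :=
  sqrtMulOneSub (resOne hc W) * (1 + A hc W 0 + R (2 * Real.pi * ε) 0)

/-- (D_φ² + 1)R_0 = 1 + A_0 + R_0. So H², the range of R_0, lies in the range of (D_φ² + 1)⁻¹, where
|D_φ| is explicit. -/
lemma resOne_mul (hD : IsDiracMatrices α β) (hε : 0 < ε) (hc : 0 < 2 * Real.pi * ε)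
    (φ : H1) : resOne hc (pot α β ε φ) * (1 + A hc (pot α β ε φ) 0 + R (2 * Real.pi * ε) 0)
      = R (2 * Real.pi * ε) 0 := by
  ext1 f
  have h := graph_R hD hε hc φ 0 f
  rw [resOne_graph_iff hD hε hc] at h
  simpa using h

lemma isRestrictionToH2_absR (hD : IsDiracMatrices α β) (hε : 0 < ε) (hc : 0 < 2 * Real.pi * ε)
    (φ : H1) : IsRestrictionToH2 (absR hc (pot α β ε φ) ∘L Jop ε) (absOp (dirac α β ε φ)) := by
  intro u
  have hT := isSelfAdjoint_dirac hD hε hc φ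
  have h := (isAbs_absOp hD hε φ).mem_graph hT
    ((isSqResolvent_resOne hD hε hc φ).nonneg hT) (norm_resOne_le hD hε hc φ)
    (resOne_graph_iff hD hε hc φ)
    ((1 + A hc (pot α β ε φ) 0 + R (2 * Real.pi * ε) 0) (Jop ε u))
  rw [← mul_apply_eq_comp, resOne_mul hD hε hc, R_Jop] at h
  exact mem_graph_iff_exists.1 h

lemma IsRestrictionToH2.unique {B B' : H2 →L[ℂ] L2 C4} {T : L2 C4 →ₗ.[ℂ] L2 C4}
    (h : IsRestrictionToH2 B T) (h' : IsRestrictionToH2 B' T) : B = B' := by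
  ext1 u
  obtain ⟨h1, h2⟩ := h u
  obtain ⟨h3, h4⟩ := h' u
  rw [← h2, ← h4]

theorem absDirac_eq (hD : IsDiracMatrices α β) (hε : 0 < ε) (hc : 0 < 2 * Real.pi * ε) (φ : H1) :
    absDirac α β ε φ = absR hc (pot α β ε φ) ∘L Jop ε := by
  have h := isRestrictionToH2_absR hD hε hc φ
  have hex : ∃ B, IsRestrictionToH2 B (absOp (dirac α β ε φ)) := ⟨_, h⟩
  rw [absDirac, dif_pos hex]
  exact hex.choose_spec.unique h

theorem isRestrictionToH2_absDirac (hD : IsDiracMatrices α β) (hε : 0 < ε) (φ : H1) :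
    IsRestrictionToH2 (absDirac α β ε φ) (absOp (dirac α β ε φ)) := by
  have hc : 0 < 2 * Real.pi * ε := by positivity
  rw [absDirac_eq hD hε hc]
  exact isRestrictionToH2_absR hD hε hc φ

lemma sqrtMulOneSub_mul_eq_integral {H : Type} [NormedAddCommGroup H] [InnerProductSpace ℂ H]
    [CompleteSpace H] {S X : H →L[ℂ] H} (h0 : 0 ≤ S) (h1 : ‖S‖ ≤ 1) {Y : ℝ → H →L[ℂ] H}
    (hY : ∀ ω : ℝ, ω ≠ 0 → ∃ Q : H →L[ℂ] H, Q * ((1 - S) + ((ω ^ 2 : ℝ) : ℂ) • S) = S ∧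
      (1 - ((ω ^ 2 : ℝ) : ℂ) • Q) * S * X = Y ω) :
    Integrable Y ∧ Real.pi • (sqrtMulOneSub S * X) = ∫ ω, Y ω := by
  obtain ⟨hi, he⟩ := sqrtMulOneSub_eq_integral h0 h1
  have hae : ∀ᵐ ω : ℝ, cfc (sqrtIntegrand ω) S * X = Y ω := by
    filter_upwards [Measure.ae_ne volume 0] with ω hω
    obtain ⟨Q, hQ, hQ'⟩ := hY ω hω
    rw [cfc_sqrtIntegrand h0 h1 hω hQ, hQ']
  refine ⟨(hi.mul_const' X).congr hae, ?_⟩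
  rw [← integral_congr_ae hae, integral_mul_const_of_integrable hi, ← he, smul_mul_assoc]

/-- The integral formula for `|D_φ| (D_0²)⁻¹`. -/
theorem absR_eq_integral (hD : IsDiracMatrices α β) (hε : 0 < ε) (hc : 0 < 2 * Real.pi * ε)
    (φ : H1) :
    Integrable (fun ω : ℝ => (1 - ((ω ^ 2 : ℝ) : ℂ) •
      (R (2 * Real.pi * ε) ω * N hc (pot α β ε φ) ω)) * R (2 * Real.pi * ε) 0) ∧
    Real.pi • absR hc (pot α β ε φ) = ∫ ω : ℝ, (1 - ((ω ^ 2 : ℝ) : ℂ) •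
      (R (2 * Real.pi * ε) ω * N hc (pot α β ε φ) ω)) * R (2 * Real.pi * ε) 0 := by
  have hT := isSelfAdjoint_dirac hD hε hc φ
  refine sqrtMulOneSub_mul_eq_integral ((isSqResolvent_resOne hD hε hc φ).nonneg hT)
    (norm_resOne_le hD hε hc φ) fun ω hω =>
      ⟨R (2 * Real.pi * ε) ω * N hc (pot α β ε φ) ω, ?_, ?_⟩
  -- The resolvent identity between the parameters 1 and ω, rearranged.
  · have hr := isSqResolvent_R_N hD hε hc hω (isUnit_of_ne_zero hD hε hc φ hω)
    have hid := (isSqResolvent_resOne hD hε hc φ).sub_eq hr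
    rw [mul_add, mul_sub, mul_one, mul_smul_comm]
    rw [Complex.ofReal_sub, sub_smul, one_pow, Complex.ofReal_one, one_smul] at hid
    have e := sub_eq_iff_eq_add.1 hid
    conv_rhs => rw [e]
    abel
  · rw [mul_assoc, resOne_mul hD hε hc]

end AbsoluteValue
end DiracVacuum
end

noncomputable section

namespace DiracVacuum

open scoped ContDiff

/-! ### Fourth order Taylor polynomials -/

section Taylor

variable {E F : Type} [NormedAddCommGroup E] [NormedSpace ℝ E] [NormedAddCommGroup F]
  [NormedSpace ℝ F]

/-- The fourth Taylor polynomial of `f` at `0`, evaluated at `1`. -/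
def tay (f : ℝ → E) : E := ∑ j ∈ Finset.range 5, (1 / (j.factorial : ℝ)) • iteratedDeriv j f 0

/-- Differentiation turns s^{m+1}g into s^m((m+1)g + sg'), a remainder of the same shape with a
factor that is still smooth, so induction applies. Derivatives at 0 can thus be read off an
algebraic expansion. -/
lemma iteratedDeriv_zero_of_eventuallyEq (k : ℕ) : ∀ {n : ℕ} {f g : ℝ → E} {c : ℕ → E}, k < n →
    ContDiffAt ℝ ∞ g 0 → (f =ᶠ[𝓝 0] fun s => ∑ j ∈ Finset.range n, s ^ j • c j + s ^ n • g s) →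
      iteratedDeriv k f 0 = (k.factorial : ℝ) • c k := by
  induction k with
  | zero =>
    intro n f g c hn hg hf
    obtain ⟨m, rfl⟩ : ∃ m, n = m + 1 := ⟨n - 1, by omega⟩
    rw [iteratedDeriv_zero, hf.eq_of_nhds, Finset.sum_range_succ']
    simp
  | succ k ih =>
    intro n f g c hn hg hf
    obtain ⟨m, rfl⟩ : ∃ m, n = m + 1 := ⟨n - 1, by omega⟩
    have hd : ContDiffAt ℝ ∞ (deriv g) 0 :=
      (hg.fderiv_right (m := ∞) (by simp)).clm_apply contDiffAt_const
    have hdiff : ∀ᶠ s in 𝓝 (0 : ℝ), DifferentiableAt ℝ g s := by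
      filter_upwards [(hg.of_le (m := 1) (by simp)).eventually (by simp)] with s hs
      exact hs.differentiableAt one_ne_zero
    rw [iteratedDeriv_succ']
    rw [ih (n := m) (g := fun s => ((m + 1 : ℕ) : ℝ) • g s + s • deriv g s)
      (c := fun j => ((j + 1 : ℕ) : ℝ) • c (j + 1)) (by omega)
      ((contDiffAt_const.smul hg).add (contDiffAt_id.smul hd)) ?_]
    · rw [smul_smul, Nat.factorial_succ, Nat.cast_mul, mul_comm]
    · filter_upwards [hf.eventuallyEq_nhds, hdiff] with s hs hgs
      rw [hs.deriv_eq]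
      have h1 : HasDerivAt (fun s : ℝ => ∑ j ∈ Finset.range (m + 1), s ^ j • c j)
          (∑ j ∈ Finset.range (m + 1), ((j : ℝ) * s ^ (j - 1)) • c j) s :=
        HasDerivAt.fun_sum fun j _ => (hasDerivAt_pow j s).smul_const (c j)
      have h2 := (hasDerivAt_pow (m + 1) s).smul hgs.hasDerivAt
      have h3 : HasDerivAt (fun s : ℝ => ∑ j ∈ Finset.range (m + 1), s ^ j • c j + s ^ (m + 1) • g s)
          _ s := h1.add h2
      rw [h3.deriv, Finset.sum_range_succ']
      simp only [Nat.add_sub_cancel, smul_add, smul_smul, pow_succ, mul_comm]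
      simp
      abel

lemma tay_eq {f g : ℝ → E} {c : ℕ → E} (hg : ContDiffAt ℝ ∞ g 0)
    (hf : f =ᶠ[𝓝 0] fun s => ∑ j ∈ Finset.range 5, s ^ j • c j + s ^ 5 • g s) :
    tay f = ∑ j ∈ Finset.range 5, c j := by
  refine Finset.sum_congr rfl fun j hj => ?_
  rw [iteratedDeriv_zero_of_eventuallyEq j (Finset.mem_range.1 hj) hg hf, smul_smul,
    one_div_mul_cancel (by exact_mod_cast j.factorial_ne_zero), one_smul]

lemma tay_clm {f : ℝ → E} (hf : ContDiffAt ℝ 4 f 0) (L : E →L[ℝ] F) :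
    tay (fun s => L (f s)) = L (tay f) := by
  rw [tay, tay, map_sum]
  refine Finset.sum_congr rfl fun j hj => ?_
  have hj' : j ≤ 4 := by have := Finset.mem_range.1 hj; omega
  rw [map_smul]
  congr 1
  have h := L.iteratedFDeriv_comp_left hf (i := j) (by exact_mod_cast hj')
  rw [iteratedDeriv_eq_iteratedFDeriv, iteratedDeriv_eq_iteratedFDeriv]
  change iteratedFDeriv ℝ j (L ∘ f) 0 _ = _
  rw [h]
  rfl

lemma tay_add {f g : ℝ → E} (hf : ContDiffAt ℝ 4 f 0) (hg : ContDiffAt ℝ 4 g 0) :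
    tay (fun s => f s + g s) = tay f + tay g := by
  have h := tay_clm (hf.prodMk hg)
    (ContinuousLinearMap.fst ℝ E E + ContinuousLinearMap.snd ℝ E E)
  have h1 := tay_clm (hf.prodMk hg) (ContinuousLinearMap.fst ℝ E E)
  have h2 := tay_clm (hf.prodMk hg) (ContinuousLinearMap.snd ℝ E E)
  simp only [add_apply, ContinuousLinearMap.coe_fst', ContinuousLinearMap.coe_snd'] at h h1 h2
  rw [h, h1, h2]

lemma tay_const (e : E) : tay (fun _ => e) = e := by
  rw [tay_eq (g := fun _ => 0) (c := fun j => if j = 0 then e else 0) contDiffAt_const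
    (.of_forall fun s => by simp)]
  simp

lemma tay_congr {f g : ℝ → E} (h : f =ᶠ[𝓝 0] g) : tay f = tay g :=
  Finset.sum_congr rfl fun j _ => by rw [h.iteratedDeriv_eq]

end Taylor

section InverseTaylor

variable {𝔄 : Type} [NormedRing 𝔄] [NormedAlgebra ℝ 𝔄] [CompleteSpace 𝔄]

/-- The Taylor coefficients of `(1 + s a₁ + s² a₂)⁻¹`. -/
def invCoef (a₁ a₂ : 𝔄) : ℕ → 𝔄
  | 0 => 1
  | 1 => -a₁
  | n + 2 => -(invCoef a₁ a₂ (n + 1) * a₁ + invCoef a₁ a₂ n * a₂)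

/-- The fourth Taylor polynomial of `(1 + s a₁ + s² a₂)⁻¹` at `s = 1`. -/
def invTay (a₁ a₂ : 𝔄) : 𝔄 := ∑ j ∈ Finset.range 5, invCoef a₁ a₂ j

/-- The remainder factor of the fourth Taylor polynomial. -/
def invRem (a₁ a₂ : 𝔄) : 𝔄 := invCoef a₁ a₂ 4 * (a₁ + a₂) + invCoef a₁ a₂ 3 * a₂

/-- The recursion of `invCoef` cancels the powers s¹ to s⁴; only the overflow of degrees 5 and 6
remains. -/
lemma sum_invCoef_mul (a₁ a₂ : 𝔄) (s : ℝ) :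
    (∑ j ∈ Finset.range 5, s ^ j • invCoef a₁ a₂ j) * (1 + s • a₁ + s ^ 2 • a₂) = 1 +
      s ^ 5 • (invCoef a₁ a₂ 4 * a₁ + invCoef a₁ a₂ 3 * a₂ + s • (invCoef a₁ a₂ 4 * a₂)) := by
  simp only [Finset.sum_range_succ, Finset.sum_range_zero, invCoef, add_mul, mul_add, mul_one,
    smul_mul_assoc, mul_smul_comm, zero_add, neg_mul, one_mul, smul_add, smul_neg, pow_zero, one_smul]
  module

lemma eq_of_isUnit {a₁ a₂ : 𝔄} {s : ℝ} (h : IsUnit (1 + s • a₁ + s ^ 2 • a₂)) :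
    Ring.inverse (1 + s • a₁ + s ^ 2 • a₂) = ∑ j ∈ Finset.range 5, s ^ j • invCoef a₁ a₂ j
      + s ^ 5 • (-((invCoef a₁ a₂ 4 * a₁ + invCoef a₁ a₂ 3 * a₂ + s • (invCoef a₁ a₂ 4 * a₂)) *
        Ring.inverse (1 + s • a₁ + s ^ 2 • a₂))) := by
  have h1 := congrArg (· * Ring.inverse (1 + s • a₁ + s ^ 2 • a₂)) (sum_invCoef_mul a₁ a₂ s)
  rw [mul_assoc, Ring.mul_inverse_cancel _ h, mul_one, add_mul, one_mul, smul_mul_assoc] at h1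
  rw [h1, smul_neg]
  abel

/-- This is the exact expansion at s = 1. It requires no smallness, only invertibility, so it is
available for every φ and every ω ≠ 0. -/
lemma inverse_eq_invTay_sub {a₁ a₂ : 𝔄} (h : IsUnit (1 + (a₁ + a₂))) :
    Ring.inverse (1 + (a₁ + a₂)) = invTay a₁ a₂ - invRem a₁ a₂ * Ring.inverse (1 + (a₁ + a₂)) := by
  have h1 := eq_of_isUnit (a₁ := a₁) (a₂ := a₂) (s := 1) (by simpa [add_assoc] using h)
  simp only [one_pow, one_smul, add_assoc] at h1
  conv_lhs => rw [h1]
  rw [invTay, invRem, sub_eq_add_neg]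
  congr 3
  rw [mul_add]
  abel

lemma contDiffAt_inverse_line (a₁ a₂ : 𝔄) {n : WithTop ℕ∞} :
    ContDiffAt ℝ n (fun s : ℝ => Ring.inverse (1 + s • a₁ + s ^ 2 • a₂)) 0 := by
  have h1 : ContDiffAt ℝ n (fun s : ℝ => 1 + s • a₁ + s ^ 2 • a₂) 0 := by fun_prop
  have h2 : ContDiffAt ℝ n Ring.inverse ((1 : 𝔄ˣ) : 𝔄) := contDiffAt_ringInverse ℝ 1
  have h3 : ContDiffAt ℝ n Ring.inverse (1 + (0 : ℝ) • a₁ + (0 : ℝ) ^ 2 • a₂) := by simpa using h2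
  exact h3.comp (0 : ℝ) h1

lemma eventually_isUnit_line (a₁ a₂ : 𝔄) :
    ∀ᶠ s : ℝ in 𝓝 0, IsUnit (1 + s • a₁ + s ^ 2 • a₂) := by
  have h1 : ContinuousAt (fun s : ℝ => 1 + s • a₁ + s ^ 2 • a₂) 0 := by fun_prop
  exact h1.eventually_mem (Units.isOpen.mem_nhds (by simp))

lemma tay_inverse (a₁ a₂ : 𝔄) :
    tay (fun s : ℝ => Ring.inverse (1 + s • a₁ + s ^ 2 • a₂)) = invTay a₁ a₂ := by
  refine tay_eq ?_ ((eventually_isUnit_line a₁ a₂).mono fun s hs => eq_of_isUnit hs)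
  have := contDiffAt_inverse_line a₁ a₂ (n := ∞)
  fun_prop

/-- The fourth Taylor polynomial of `(1 + s a₁ + s² a₂)⁻¹ (s b₁ + s² b₂)` at `s = 1`. -/
def invMulTay (a₁ a₂ b₁ b₂ : 𝔄) : 𝔄 :=
  b₁ + (invCoef a₁ a₂ 1 * b₁ + b₂) + (invCoef a₁ a₂ 2 * b₁ + invCoef a₁ a₂ 1 * b₂) +
    (invCoef a₁ a₂ 3 * b₁ + invCoef a₁ a₂ 2 * b₂)

/-- After b_i r is replaced by a_i r₀, the terms of degree 1 to 4 are, by the recursion, the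
negatives of the coefficients of `invTay` without the leading 1. -/
lemma invMulTay_mul {a₁ a₂ b₁ b₂ r r₀ : 𝔄} (h1 : b₁ * r = a₁ * r₀) (h2 : b₂ * r = a₂ * r₀) :
    invMulTay a₁ a₂ b₁ b₂ * r = (1 - invTay a₁ a₂) * r₀ := by
  simp only [invMulTay, invTay, add_mul, mul_assoc, h1, h2, Finset.sum_range_succ,
    Finset.sum_range_zero, invCoef, sub_mul, neg_mul, zero_add, one_mul]
  abel

lemma tay_inverse_mul (a₁ a₂ b₁ b₂ : 𝔄) :
    tay (fun s : ℝ => Ring.inverse (1 + s • a₁ + s ^ 2 • a₂) * (s • b₁ + s ^ 2 • b₂))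
      = invMulTay a₁ a₂ b₁ b₂ := by
  have hs := contDiffAt_inverse_line a₁ a₂ (n := ∞)
  rw [tay_eq (c := fun
      | 0 => 0
      | 1 => b₁
      | n + 2 => invCoef a₁ a₂ (n + 1) * b₁ + invCoef a₁ a₂ n * b₂)
    (g := fun s : ℝ => invCoef a₁ a₂ 4 * b₁ + invCoef a₁ a₂ 3 * b₂ + s • (invCoef a₁ a₂ 4 * b₂)
      - ((invCoef a₁ a₂ 4 * a₁ + invCoef a₁ a₂ 3 * a₂ + s • (invCoef a₁ a₂ 4 * a₂)) *
        Ring.inverse (1 + s • a₁ + s ^ 2 • a₂)) * (s • b₁ + s ^ 2 • b₂)) (by fun_prop) ?_]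
  · simp [Finset.sum_range_succ, invMulTay, invCoef]
  · filter_upwards [eventually_isUnit_line a₁ a₂] with s hs
    have h1 := eq_of_isUnit hs
    set n := Ring.inverse (1 + s • a₁ + s ^ 2 • a₂)
    have h2 := congrArg (· * (s • b₁ + s ^ 2 • b₂)) h1
    rw [h2]
    simp only [Finset.sum_range_succ, Finset.sum_range_zero, add_mul, mul_add, smul_mul_assoc,
      mul_smul_comm, neg_mul, smul_neg, smul_add, zero_add, smul_zero, smul_sub]
    simp only [invCoef]
    simp only [one_mul]
    module

end InverseTaylor
end DiracVacuum
end

noncomputable section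

set_option maxSynthPendingDepth 3

namespace DiracVacuum

open scoped BoundedContinuousFunction

/-! ### Abstract perturbation theory -/

/-- A free resolvent `R` together with relatively Hilbert–Schmidt perturbations `A W = W R`. -/
structure FreeData (H 𝒲 : Type) [NormedAddCommGroup H] [InnerProductSpace ℂ H] [CompleteSpace H]
    [NormedAddCommGroup 𝒲] [NormedSpace ℝ 𝒲] where
  R : ℝ → H →L[ℂ] H
  A : 𝒲 → ℝ → H →L[ℂ] H
  κ : ℝ
  κ_nonneg : 0 ≤ κ
  continuous_R : Continuous R
  norm_R_le : ∀ ω, ‖R ω‖ ≤ (1 + ω ^ 2)⁻¹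
  A_add : ∀ V W ω, A (V + W) ω = A V ω + A W ω
  A_smul : ∀ (r : ℝ) W ω, A (r • W) ω = r • A W ω
  continuous_A : ∀ W, Continuous (A W)
  norm_A_le : ∀ W ω, ‖A W ω‖ ≤ κ * ‖W‖ * wt ω
  hsBound_A : ∀ W ω, HSBound (A W ω) (κ * ‖W‖ * wt ω)
  A_mul_R : ∀ W ω τ, A W ω * R τ = A W τ * R ω

namespace FreeData

variable {H 𝒲 : Type} [NormedAddCommGroup H] [InnerProductSpace ℂ H] [CompleteSpace H]
  [NormedAddCommGroup 𝒲] [NormedSpace ℝ 𝒲] (D : FreeData H 𝒲)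

lemma norm_A_le' (W : 𝒲) (ω : ℝ) : ‖D.A W ω‖ ≤ D.κ * ‖W‖ :=
  (D.norm_A_le W ω).trans (mul_le_of_le_one_right (mul_nonneg D.κ_nonneg (norm_nonneg _))
    (wt_le_one ω))

/-- `A` is linear in the potential. -/
def AL (ω : ℝ) : 𝒲 →L[ℝ] (H →L[ℂ] H) :=
  LinearMap.mkContinuous
    { toFun := fun W => D.A W ω
      map_add' := fun V W => D.A_add V W ω
      map_smul' := fun r W => D.A_smul r W ω } D.κ fun W => D.norm_A_le' W ω

lemma one_add_sq_mul_norm_R_le (ω : ℝ) : (1 + ω ^ 2) * ‖D.R ω‖ ≤ 1 :=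
  (mul_le_mul_of_nonneg_left (D.norm_R_le ω) (by positivity)).trans_eq
    (mul_inv_cancel₀ (by positivity))

/-- The normalised operator `(1 + ω²)^{1/4} A`. -/
def Ah (W : 𝒲) (ω : ℝ) : H →L[ℂ] H := (wt ω)⁻¹ • D.A W ω

lemma norm_Ah_le (W : 𝒲) (ω : ℝ) : ‖D.Ah W ω‖ ≤ D.κ * ‖W‖ := by
  have h := wt_pos ω
  rw [Ah, norm_smul, norm_inv, Real.norm_of_nonneg h.le, inv_mul_le_iff₀ h, mul_comm (wt ω)]
  exact D.norm_A_le W ω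

lemma continuous_Ah (W : 𝒲) : Continuous (D.Ah W) :=
  (continuous_wt.inv₀ fun ω => (wt_pos ω).ne').smul (D.continuous_A W)

lemma wt_smul_Ah (W : 𝒲) (ω : ℝ) : wt ω • D.Ah W ω = D.A W ω := by
  rw [Ah, smul_smul, mul_inv_cancel₀ (wt_pos ω).ne', one_smul]

/-! #### The trilinear trace form -/

/-- The integrand of the trace form. -/
def form (V V' : 𝒲) (U : ℝ → H →L[ℂ] H) (ω : ℝ) : H →L[ℂ] H :=
  ((1 + ω ^ 2) * wt ω) • (D.R ω * (D.A V ω * D.A V' ω) * U ω)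

/-- Two Hilbert–Schmidt factors make the product trace class and contribute wt², while R absorbs 1 +
ω². The remaining wt stands for the decay of a third factor A, so the bound is integrable whenever U
is bounded. -/
lemma trBound_form (V V' : 𝒲) (U : ℝ → H →L[ℂ] H) (ω : ℝ) :
    TrBound (D.form V V' U ω) (D.κ ^ 2 * ‖V‖ * ‖V'‖ * (wt ω ^ 3 * ‖U ω‖)) := by
  have h1 := (((D.hsBound_A V ω).mul (D.hsBound_A V' ω)).mul_left (D.R ω)).mul_right (U ω)
  have h2 := h1.smul (((1 + ω ^ 2) * wt ω : ℝ) : ℂ)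
  rw [Complex.coe_smul] at h2
  refine h2.mono ?_
  have hw := wt_pos ω
  have hκ := D.κ_nonneg
  rw [Complex.norm_real, Real.norm_of_nonneg (by positivity)]
  calc _ = ((1 + ω ^ 2) * ‖D.R ω‖) * (D.κ ^ 2 * ‖V‖ * ‖V'‖ * (wt ω ^ 3 * ‖U ω‖)) := by ring
    _ ≤ 1 * (D.κ ^ 2 * ‖V‖ * ‖V'‖ * (wt ω ^ 3 * ‖U ω‖)) :=
      mul_le_mul_of_nonneg_right (D.one_add_sq_mul_norm_R_le ω) (by positivity)
    _ = _ := one_mul _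

lemma norm_form_le (V V' : 𝒲) (U : ℝ → H →L[ℂ] H) (ω : ℝ) :
    ‖D.form V V' U ω‖ ≤ D.κ ^ 2 * ‖V‖ * ‖V'‖ * (wt ω ^ 3 * ‖U ω‖) := by
  have hw := wt_pos ω
  have hκ := D.κ_nonneg
  rw [form, norm_smul, Real.norm_of_nonneg (by positivity)]
  calc _ ≤ (1 + ω ^ 2) * wt ω *
        (‖D.R ω‖ * ((D.κ * ‖V‖ * wt ω) * (D.κ * ‖V'‖ * wt ω)) * ‖U ω‖) := by
        refine mul_le_mul_of_nonneg_left ((norm_mul₃_le).trans ?_) (by positivity)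
        refine mul_le_mul_of_nonneg_right (mul_le_mul_of_nonneg_left ((norm_mul_le _ _).trans ?_)
          (norm_nonneg _)) (norm_nonneg _)
        exact mul_le_mul (D.norm_A_le V ω) (D.norm_A_le V' ω) (norm_nonneg _) (by positivity)
    _ = ((1 + ω ^ 2) * ‖D.R ω‖) * (D.κ ^ 2 * ‖V‖ * ‖V'‖ * (wt ω ^ 3 * ‖U ω‖)) := by ring
    _ ≤ 1 * (D.κ ^ 2 * ‖V‖ * ‖V'‖ * (wt ω ^ 3 * ‖U ω‖)) :=
      mul_le_mul_of_nonneg_right (D.one_add_sq_mul_norm_R_le ω) (by positivity)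
    _ = _ := one_mul _

/-- The operator functions to which the trace form applies. -/
def Adm (U : ℝ → H →L[ℂ] H) : Prop :=
  AEStronglyMeasurable U volume ∧ Integrable fun ω => wt ω ^ 3 * ‖U ω‖

/-- The point ω = 0, where 1 + A need not be invertible, is a null set and is exempt from the bound.
-/
lemma adm_of_bound {U : ℝ → H →L[ℂ] H} {B : ℝ} (hU : AEStronglyMeasurable U volume)
    (hB : ∀ ω, ω ≠ 0 → ‖U ω‖ ≤ B) : Adm U := by
  refine ⟨hU, (integrable_wt_cubed.mul_const B).mono'
    ((continuous_wt.pow 3).aestronglyMeasurable.mul hU.norm) ?_⟩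
  filter_upwards [Measure.ae_ne volume 0] with ω hω
  have hw := wt_pos ω
  rw [Real.norm_of_nonneg (by positivity)]
  exact mul_le_mul_of_nonneg_left (hB ω hω) (by positivity)

lemma Adm.add {U U' : ℝ → H →L[ℂ] H} (h : Adm U) (h' : Adm U') : Adm fun ω => U ω + U' ω := by
  refine ⟨h.1.add h'.1, (h.2.add h'.2).mono'
    ((continuous_wt.pow 3).aestronglyMeasurable.mul (h.1.add h'.1).norm) (.of_forall fun ω => ?_)⟩
  have hw := wt_pos ω
  rw [Real.norm_of_nonneg (by positivity), Pi.add_apply, ← mul_add]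
  exact mul_le_mul_of_nonneg_left (norm_add_le _ _) (by positivity)

lemma Adm.smul {U : ℝ → H →L[ℂ] H} (h : Adm U) (r : ℝ) : Adm fun ω => r • U ω := by
  refine ⟨h.1.const_smul r, (h.2.const_mul |r|).congr (.of_forall fun ω => ?_)⟩
  dsimp only
  rw [norm_smul, Real.norm_eq_abs]
  ring

lemma aestronglyMeasurable_form (V V' : 𝒲) {U : ℝ → H →L[ℂ] H}
    (hU : AEStronglyMeasurable U volume) : AEStronglyMeasurable (D.form V V' U) volume :=
  (((continuous_const.add (continuous_id.pow 2)).mul continuous_wt).aestronglyMeasurable).smul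
    ((D.continuous_R.mul ((D.continuous_A V).mul (D.continuous_A V'))).aestronglyMeasurable.mul hU)

lemma integrable_form (V V' : 𝒲) {U : ℝ → H →L[ℂ] H} (hU : Adm U) :
    Integrable (D.form V V' U) :=
  (hU.2.const_mul (D.κ ^ 2 * ‖V‖ * ‖V'‖)).mono' (D.aestronglyMeasurable_form V V' hU.1)
    (.of_forall (D.norm_form_le V V' U))

/-- The trace form `Tr ∫ (1 + ω²)^{3/4} R A(V) A(V') U dω`. -/
def Tr (V V' : 𝒲) (U : ℝ → H →L[ℂ] H) : ℂ := trace (∫ ω, D.form V V' U ω)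

lemma trBound_integral_form (V V' : 𝒲) {U : ℝ → H →L[ℂ] H} (hU : Adm U) :
    TrBound (∫ ω, D.form V V' U ω) (D.κ ^ 2 * ‖V‖ * ‖V'‖ * ∫ ω, wt ω ^ 3 * ‖U ω‖) := by
  have := TrBound.integral (D.integrable_form V V' hU)
    (hU.2.const_mul (D.κ ^ 2 * ‖V‖ * ‖V'‖)) (.of_forall (D.trBound_form V V' U))
  rwa [integral_const_mul] at this

lemma norm_Tr_le (V V' : 𝒲) {U : ℝ → H →L[ℂ] H} (hU : Adm U) :
    ‖D.Tr V V' U‖ ≤ D.κ ^ 2 * ‖V‖ * ‖V'‖ * ∫ ω, wt ω ^ 3 * ‖U ω‖ :=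
  (D.trBound_integral_form V V' hU).norm_trace_le

lemma Tr_add_left (V₁ V₂ V' : 𝒲) {U : ℝ → H →L[ℂ] H} (hU : Adm U) :
    D.Tr (V₁ + V₂) V' U = D.Tr V₁ V' U + D.Tr V₂ V' U := by
  rw [Tr, Tr, Tr, ← (D.trBound_integral_form V₁ V' hU).trace_add (D.trBound_integral_form V₂ V' hU),
    ← integral_add (D.integrable_form V₁ V' hU) (D.integrable_form V₂ V' hU)]
  congr 2
  funext ω
  simp only [form, D.A_add, add_mul, mul_add, smul_add]

lemma Tr_add_middle (V V₁ V₂ : 𝒲) {U : ℝ → H →L[ℂ] H} (hU : Adm U) :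
    D.Tr V (V₁ + V₂) U = D.Tr V V₁ U + D.Tr V V₂ U := by
  rw [Tr, Tr, Tr, ← (D.trBound_integral_form V V₁ hU).trace_add (D.trBound_integral_form V V₂ hU),
    ← integral_add (D.integrable_form V V₁ hU) (D.integrable_form V V₂ hU)]
  congr 2
  funext ω
  simp only [form, D.A_add, add_mul, mul_add, smul_add]

lemma Tr_add_right (V V' : 𝒲) {U₁ U₂ : ℝ → H →L[ℂ] H} (h₁ : Adm U₁) (h₂ : Adm U₂) :
    D.Tr V V' (fun ω => U₁ ω + U₂ ω) = D.Tr V V' U₁ + D.Tr V V' U₂ := by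
  rw [Tr, Tr, Tr, ← (D.trBound_integral_form V V' h₁).trace_add (D.trBound_integral_form V V' h₂),
    ← integral_add (D.integrable_form V V' h₁) (D.integrable_form V V' h₂)]
  congr 2
  funext ω
  simp only [form, mul_add, smul_add]

lemma trace_integral_smul (r : ℝ) (f : ℝ → H →L[ℂ] H) :
    trace (∫ ω, r • f ω) = r • trace (∫ ω, f ω) := by
  rw [integral_smul, ← Complex.coe_smul, trace_smul]
  rfl

lemma Tr_smul_left (r : ℝ) (V V' : 𝒲) (U : ℝ → H →L[ℂ] H) :
    D.Tr (r • V) V' U = r • D.Tr V V' U := by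
  rw [Tr, Tr, ← trace_integral_smul]
  congr 2
  funext ω
  simp only [form, D.A_smul, smul_mul_assoc, mul_smul_comm, smul_smul, mul_comm r]

lemma Tr_smul_middle (r : ℝ) (V V' : 𝒲) (U : ℝ → H →L[ℂ] H) :
    D.Tr V (r • V') U = r • D.Tr V V' U := by
  rw [Tr, Tr, ← trace_integral_smul]
  congr 2
  funext ω
  simp only [form, D.A_smul, smul_mul_assoc, mul_smul_comm, smul_smul, mul_comm r]

lemma Tr_smul_right (r : ℝ) (V V' : 𝒲) (U : ℝ → H →L[ℂ] H) :
    D.Tr V V' (fun ω => r • U ω) = r • D.Tr V V' U := by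
  rw [Tr, Tr, ← trace_integral_smul]
  congr 2
  funext ω
  simp only [form, mul_smul_comm, smul_smul, mul_comm r]

lemma Tr_sub_left (V₁ V₂ V' : 𝒲) {U : ℝ → H →L[ℂ] H} (hU : Adm U) :
    D.Tr (V₁ - V₂) V' U = D.Tr V₁ V' U - D.Tr V₂ V' U := by
  rw [eq_sub_iff_add_eq, ← D.Tr_add_left _ _ _ hU, sub_add_cancel]

lemma Tr_sub_middle (V V₁ V₂ : 𝒲) {U : ℝ → H →L[ℂ] H} (hU : Adm U) :
    D.Tr V (V₁ - V₂) U = D.Tr V V₁ U - D.Tr V V₂ U := by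
  rw [eq_sub_iff_add_eq, ← D.Tr_add_middle _ _ _ hU, sub_add_cancel]

lemma Adm.sub {U U' : ℝ → H →L[ℂ] H} (h : Adm U) (h' : Adm U') : Adm fun ω => U ω - U' ω := by
  have := h.add (h'.smul (-1))
  simpa only [neg_smul, one_smul, ← sub_eq_add_neg] using this

lemma Tr_sub_right (V V' : 𝒲) {U₁ U₂ : ℝ → H →L[ℂ] H} (h₁ : Adm U₁) (h₂ : Adm U₂) :
    D.Tr V V' (fun ω => U₁ ω - U₂ ω) = D.Tr V V' U₁ - D.Tr V V' U₂ := by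
  rw [eq_sub_iff_add_eq, ← D.Tr_add_right _ _ (h₁.sub h₂) h₂]
  simp only [sub_add_cancel]

/-- Continuity of the trace form. -/
lemma continuousAt_Tr {X : Type} [TopologicalSpace X] {x₀ : X} [(𝓝 x₀).IsCountablyGenerated]
    {V V' : X → 𝒲} {U : X → ℝ → H →L[ℂ] H} (hV : ContinuousAt V x₀) (hV' : ContinuousAt V' x₀)
    {B : ℝ} (hm : ∀ᶠ x in 𝓝 x₀, AEStronglyMeasurable (U x) volume)
    (hB : ∀ᶠ x in 𝓝 x₀, ∀ ω, ω ≠ 0 → ‖U x ω‖ ≤ B)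
    (hU : ∀ ω, ω ≠ 0 → ContinuousAt (fun x => U x ω) x₀) :
    ContinuousAt (fun x => D.Tr (V x) (V' x) (U x)) x₀ := by
  have hadm : ∀ᶠ x in 𝓝 x₀, Adm (U x) := by
    filter_upwards [hm, hB] with x h1 h2
    exact adm_of_bound h1 h2
  have h0 := hadm.self_of_nhds
  have hB0 := hB.self_of_nhds
  have hint : ∀ᶠ x in 𝓝 x₀, ∫ ω, wt ω ^ 3 * ‖U x ω‖ ≤ ∫ ω, wt ω ^ 3 * B := by
    filter_upwards [hadm, hB] with x h1 h2
    refine integral_mono_ae h1.2 (integrable_wt_cubed.mul_const B) ?_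
    filter_upwards [Measure.ae_ne volume 0] with ω hω
    have hw := wt_pos ω
    exact mul_le_mul_of_nonneg_left (h2 ω hω) (by positivity)
  -- Dominated convergence with majorant 2B wt³; pointwise convergence of U is needed only for ω ≠
  -- 0.
  have hlim : Tendsto (fun x => ∫ ω, wt ω ^ 3 * ‖U x ω - U x₀ ω‖) (𝓝 x₀) (𝓝 0) := by
    have : (0 : ℝ) = ∫ ω : ℝ, (0 : ℝ) := by simp
    rw [this]
    refine tendsto_integral_filter_of_dominated_convergence (fun ω => wt ω ^ 3 * (2 * B)) ?_ ?_
      (integrable_wt_cubed.mul_const _) ?_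
    · filter_upwards [hadm] with x hx
      exact (hx.sub h0).2.1
    · filter_upwards [hB] with x hx
      filter_upwards [Measure.ae_ne volume 0] with ω hω
      have hw := wt_pos ω
      rw [Real.norm_of_nonneg (by positivity)]
      refine mul_le_mul_of_nonneg_left ((norm_sub_le _ _).trans ?_) (by positivity)
      linarith [hx ω hω, hB0 ω hω]
    · filter_upwards [Measure.ae_ne volume 0] with ω hω
      have h1 : ContinuousAt (fun x => wt ω ^ 3 * ‖U x ω - U x₀ ω‖) x₀ :=
        continuousAt_const.mul ((hU ω hω).sub continuousAt_const).norm
      simpa [ContinuousAt] using h1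
  rw [ContinuousAt, tendsto_iff_norm_sub_tendsto_zero]
  set I := ∫ ω, wt ω ^ 3 * B
  have hbound : ∀ᶠ x in 𝓝 x₀, ‖D.Tr (V x) (V' x) (U x) - D.Tr (V x₀) (V' x₀) (U x₀)‖ ≤
      D.κ ^ 2 * ‖V x - V x₀‖ * ‖V' x‖ * I + D.κ ^ 2 * ‖V x₀‖ * ‖V' x - V' x₀‖ * I
        + D.κ ^ 2 * ‖V x₀‖ * ‖V' x₀‖ * ∫ ω, wt ω ^ 3 * ‖U x ω - U x₀ ω‖ := by
    filter_upwards [hadm, hint] with x hx hi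
    -- Telescoping of a trilinear form, one argument at a time.
    have e : D.Tr (V x) (V' x) (U x) - D.Tr (V x₀) (V' x₀) (U x₀) =
        D.Tr (V x - V x₀) (V' x) (U x) + D.Tr (V x₀) (V' x - V' x₀) (U x)
          + D.Tr (V x₀) (V' x₀) (fun ω => U x ω - U x₀ ω) := by
      rw [D.Tr_sub_left _ _ _ hx, D.Tr_sub_middle _ _ _ hx, D.Tr_sub_right _ _ hx h0]
      ring
    rw [e]
    have hκ := D.κ_nonneg
    refine (norm_add₃_le).trans (add_le_add_three ?_ ?_ ?_)
    · exact (D.norm_Tr_le _ _ hx).trans (mul_le_mul_of_nonneg_left hi (by positivity))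
    · exact (D.norm_Tr_le _ _ hx).trans (mul_le_mul_of_nonneg_left hi (by positivity))
    · exact D.norm_Tr_le _ _ (hx.sub h0)
  refine squeeze_zero' (.of_forall fun _ => norm_nonneg _) hbound ?_
  have t1 : Tendsto (fun x => ‖V x - V x₀‖) (𝓝 x₀) (𝓝 0) := tendsto_iff_norm_sub_tendsto_zero.1 hV
  have t2 : Tendsto (fun x => ‖V' x - V' x₀‖) (𝓝 x₀) (𝓝 0) :=
    tendsto_iff_norm_sub_tendsto_zero.1 hV'
  have t3 : Tendsto (fun x => ‖V' x‖) (𝓝 x₀) (𝓝 ‖V' x₀‖) := hV'.norm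
  have := (((t1.const_mul (D.κ ^ 2)).mul t3).mul_const I).add
    ((t2.const_mul (D.κ ^ 2 * ‖V x₀‖)).mul_const I) |>.add
    (hlim.const_mul (D.κ ^ 2 * ‖V x₀‖ * ‖V' x₀‖))
  simpa using this

/-- The trace form on bounded continuous operator functions. -/
def TrL : 𝒲 →L[ℝ] 𝒲 →L[ℝ] (ℝ →ᵇ (H →L[ℂ] H)) →L[ℝ] ℂ :=
  have hadm : ∀ U : ℝ →ᵇ (H →L[ℂ] H), Adm U := fun U =>
    adm_of_bound U.continuous.aestronglyMeasurable fun ω _ => U.norm_coe_le_norm ω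
  have hI : ∀ (V V' : 𝒲) (U : ℝ →ᵇ (H →L[ℂ] H)),
      ‖D.Tr V V' U‖ ≤ (D.κ ^ 2 * ∫ ω, wt ω ^ 3) * ‖V‖ * ‖V'‖ * ‖U‖ := fun V V' U => by
    refine (D.norm_Tr_le V V' (hadm U)).trans ?_
    have h1 : ∫ ω, wt ω ^ 3 * ‖U ω‖ ≤ (∫ ω, wt ω ^ 3) * ‖U‖ := by
      rw [← integral_mul_const]
      refine integral_mono (hadm U).2 (integrable_wt_cubed.mul_const _) fun ω => ?_
      have hw := wt_pos ω
      exact mul_le_mul_of_nonneg_left (U.norm_coe_le_norm ω) (by positivity)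
    have hκ := D.κ_nonneg
    exact (mul_le_mul_of_nonneg_left h1 (by positivity)).trans_eq (by ring)
  have hI0 : 0 ≤ ∫ ω, wt ω ^ 3 := integral_nonneg fun ω => by have := wt_pos ω; positivity
  LinearMap.mkContinuous₂ (LinearMap.mk₂ ℝ
    (fun V V' => LinearMap.mkContinuous
      { toFun := fun U : ℝ →ᵇ (H →L[ℂ] H) => D.Tr V V' U
        map_add' := fun U U' => D.Tr_add_right V V' (hadm U) (hadm U')
        map_smul' := fun r U => D.Tr_smul_right r V V' U }
      ((D.κ ^ 2 * ∫ ω, wt ω ^ 3) * ‖V‖ * ‖V'‖) (hI V V'))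
    (fun V₁ V₂ V' => by ext U; exact D.Tr_add_left V₁ V₂ V' (hadm U))
    (fun r V V' => by ext U; exact D.Tr_smul_left r V V' U)
    (fun V V₁ V₂ => by ext U; exact D.Tr_add_middle V V₁ V₂ (hadm U))
    (fun r V V' => by ext U; exact D.Tr_smul_middle r V V' U))
    (D.κ ^ 2 * ∫ ω, wt ω ^ 3) (fun V V' => LinearMap.mkContinuous_norm_le _ (by
      have := D.κ_nonneg
      positivity) (hI V V'))

lemma TrL_apply (V V' : 𝒲) (U : ℝ →ᵇ (H →L[ℂ] H)) : D.TrL V V' U = D.Tr V V' U := rfl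

end FreeData
end DiracVacuum
end

noncomputable section

set_option maxSynthPendingDepth 3

namespace DiracVacuum

open scoped BoundedContinuousFunction

namespace FreeData

variable {H 𝒲 : Type} [NormedAddCommGroup H] [InnerProductSpace ℂ H] [CompleteSpace H]
  [NormedAddCommGroup 𝒲] [NormedSpace ℝ 𝒲] (D : FreeData H 𝒲)

/-! #### The remainder of the fourth order expansion -/

/-- The inverse of `1 + A`. -/
def N (W : 𝒲) (ω : ℝ) : H →L[ℂ] H := Ring.inverse (1 + D.A W ω)

/-- `1 + A` is invertible for `ω ≠ 0`, and `ω² (1 + ω²)⁻¹ (1 + A)⁻¹` is bounded by `C`. -/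
structure Regular (W : 𝒲) (C : ℝ) : Prop where
  isUnit : ∀ ω, ω ≠ 0 → IsUnit (1 + D.A W ω)
  bound : ∀ ω, ω ≠ 0 → ω ^ 2 * ‖D.N W ω‖ ≤ C * (1 + ω ^ 2)

variable {D}

lemma Regular.continuousOn_N {W : 𝒲} {C : ℝ} (h : D.Regular W C) :
    ContinuousOn (D.N W) {0}ᶜ := fun ω hω => by
  obtain ⟨u, hu⟩ := h.isUnit ω hω
  have h1 : ContinuousAt Ring.inverse (1 + D.A W ω) := hu ▸ NormedRing.inverse_continuousAt u
  exact (h1.comp (f := fun ω => 1 + D.A W ω)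
    (continuous_const.add (D.continuous_A W)).continuousAt).continuousWithinAt

lemma Regular.aestronglyMeasurable_N {W : 𝒲} {C : ℝ} (h : D.Regular W C) :
    AEStronglyMeasurable (D.N W) volume := by
  have h1 := h.continuousOn_N.aestronglyMeasurable (μ := volume)
    (measurableSet_singleton (0 : ℝ)).compl
  rwa [Measure.restrict_eq_self_of_ae_mem (s := {0}ᶜ) (Measure.ae_ne volume 0)] at h1

variable (D)

/-- `ω² (1 + ω²)⁻¹ Z (1 + A)⁻¹`. -/
def weightN (W : 𝒲) (Z : ℝ → H →L[ℂ] H) (ω : ℝ) : H →L[ℂ] H :=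
  (ω ^ 2 / (1 + ω ^ 2)) • (Z ω * D.N W ω)

variable {D} in
lemma Regular.aestronglyMeasurable_weightN {W : 𝒲} {C : ℝ} (h : D.Regular W C)
    {Z : ℝ → H →L[ℂ] H} (hZ : Continuous Z) : AEStronglyMeasurable (D.weightN W Z) volume := by
  have h1 : Continuous fun ω : ℝ => ω ^ 2 / (1 + ω ^ 2) :=
    (continuous_id.pow 2).div (by fun_prop) fun ω => by positivity
  exact h1.aestronglyMeasurable.smul (hZ.aestronglyMeasurable.mul h.aestronglyMeasurable_N)

variable {D} in
-- The factor ω²/(1 + ω²) compensates a possible growth of N like ω⁻² at ω = 0.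
lemma Regular.norm_weightN_le {W : 𝒲} {C B : ℝ} (h : D.Regular W C) {Z : ℝ → H →L[ℂ] H}
    {ω : ℝ} (hω : ω ≠ 0) (hZ : ‖Z ω‖ ≤ B) : ‖D.weightN W Z ω‖ ≤ B * C := by
  have hB : 0 ≤ B := (norm_nonneg _).trans hZ
  have hpos : (0 : ℝ) < 1 + ω ^ 2 := by positivity
  rw [weightN, norm_smul, Real.norm_of_nonneg (by positivity), div_mul_eq_mul_div, div_le_iff₀ hpos]
  calc ω ^ 2 * ‖Z ω * D.N W ω‖ ≤ ω ^ 2 * (B * ‖D.N W ω‖) :=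
        mul_le_mul_of_nonneg_left ((norm_mul_le _ _).trans
          (mul_le_mul_of_nonneg_right hZ (norm_nonneg _))) (by positivity)
    _ = B * (ω ^ 2 * ‖D.N W ω‖) := by ring
    _ ≤ B * (C * (1 + ω ^ 2)) := mul_le_mul_of_nonneg_left (h.bound ω hω) hB
    _ = _ := by ring

/-- The normalised last factor multiplying `A₂ A₂`. -/
def Z₂₂ (W₁ W₂ : 𝒲) (ω : ℝ) : H →L[ℂ] H := D.Ah (W₁ + W₂) ω

/-- The normalised last factor multiplying `A₁ A₁`. -/
def Z₁₁ (W₁ W₂ : 𝒲) (ω : ℝ) : H →L[ℂ] H :=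
  D.A W₁ ω * D.A W₁ ω * D.Ah (W₁ + W₂) ω - D.A W₂ ω * D.Ah (W₁ + W₂) ω - D.A W₁ ω * D.Ah W₂ ω

/-- The normalised last factor multiplying `A₁ A₂` and `A₂ A₁`. -/
def Z₁₂ (W₁ W₂ : 𝒲) (ω : ℝ) : H →L[ℂ] H := D.Ah W₂ ω - D.A W₁ ω * D.Ah (W₁ + W₂) ω

lemma continuous_Z₂₂ (W₁ W₂ : 𝒲) : Continuous (D.Z₂₂ W₁ W₂) := D.continuous_Ah _

lemma continuous_Z₁₁ (W₁ W₂ : 𝒲) : Continuous (D.Z₁₁ W₁ W₂) := by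
  have h1 := D.continuous_A W₁
  have h2 := D.continuous_A W₂
  have h3 := D.continuous_Ah (W₁ + W₂)
  have h4 := D.continuous_Ah W₂
  exact (((h1.mul h1).mul h3).sub (h2.mul h3)).sub (h1.mul h4)

lemma continuous_Z₁₂ (W₁ W₂ : 𝒲) : Continuous (D.Z₁₂ W₁ W₂) :=
  (D.continuous_Ah _).sub ((D.continuous_A _).mul (D.continuous_Ah _))

/-- A common bound of the last factors. -/
def zBound (q : ℝ) : ℝ := 2 * q + 3 * q ^ 2 + 2 * q ^ 3

lemma norm_Z_le {W₁ W₂ : 𝒲} {M : ℝ} (h₁ : ‖W₁‖ ≤ M) (h₂ : ‖W₂‖ ≤ M) (ω : ℝ) :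
    ‖D.Z₂₂ W₁ W₂ ω‖ ≤ zBound (D.κ * M) ∧ ‖D.Z₁₁ W₁ W₂ ω‖ ≤ zBound (D.κ * M) ∧
      ‖D.Z₁₂ W₁ W₂ ω‖ ≤ zBound (D.κ * M) := by
  have hκ := D.κ_nonneg
  have hM : 0 ≤ M := (norm_nonneg _).trans h₁
  set q := D.κ * M with hq
  have hq0 : 0 ≤ q := mul_nonneg hκ hM
  have a1 : ‖D.A W₁ ω‖ ≤ q := (D.norm_A_le' _ _).trans (mul_le_mul_of_nonneg_left h₁ hκ)
  have a2 : ‖D.A W₂ ω‖ ≤ q := (D.norm_A_le' _ _).trans (mul_le_mul_of_nonneg_left h₂ hκ)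
  have a3 : ‖D.Ah W₂ ω‖ ≤ q := (D.norm_Ah_le _ _).trans (mul_le_mul_of_nonneg_left h₂ hκ)
  have a4 : ‖D.Ah (W₁ + W₂) ω‖ ≤ 2 * q := by
    refine (D.norm_Ah_le _ _).trans ((mul_le_mul_of_nonneg_left (norm_add_le _ _) hκ).trans ?_)
    rw [hq]; nlinarith
  have m1 : ‖D.A W₁ ω * D.Ah (W₁ + W₂) ω‖ ≤ q * (2 * q) := norm_mul_le_of_le a1 a4
  have m2 : ‖D.A W₂ ω * D.Ah (W₁ + W₂) ω‖ ≤ q * (2 * q) := norm_mul_le_of_le a2 a4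
  have m3 : ‖D.A W₁ ω * D.Ah W₂ ω‖ ≤ q * q := norm_mul_le_of_le a1 a3
  have m4 : ‖D.A W₁ ω * D.A W₁ ω * D.Ah (W₁ + W₂) ω‖ ≤ q * q * (2 * q) :=
    norm_mul_le_of_le (norm_mul_le_of_le a1 a1) a4
  unfold zBound
  have p2 : 0 ≤ q ^ 2 := by positivity
  have p3 : 0 ≤ q ^ 3 := by positivity
  refine ⟨a4.trans (by linarith), ?_, ?_⟩
  · have h := norm_sub_le (D.A W₁ ω * D.A W₁ ω * D.Ah (W₁ + W₂) ω) (D.A W₂ ω * D.Ah (W₁ + W₂) ω)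
    exact (norm_sub_le _ _).trans (by linarith)
  · exact (norm_sub_le _ _).trans (by linarith)

/-- The remainder of the fourth order expansion of `1 - ω² R (1 + A)⁻¹`. -/
def G (W₁ W₂ : 𝒲) (ω : ℝ) : H →L[ℂ] H :=
  ω ^ 2 • (D.R ω * (invRem (D.A W₁ ω) (D.A W₂ ω) * D.N (W₁ + W₂) ω))

/-- Degrees 5 and 6 in letters of degree 1 and 2 force words of at least three letters. They are
sorted by their first two letters, which stay in place as the Hilbert–Schmidt factors, and one
weight wt is drawn out of the last letter. -/
lemma invRem_eq (W₁ W₂ : 𝒲) (ω : ℝ) : invRem (D.A W₁ ω) (D.A W₂ ω) =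
    wt ω • (D.A W₂ ω * D.A W₂ ω * D.Z₂₂ W₁ W₂ ω + D.A W₁ ω * D.A W₁ ω * D.Z₁₁ W₁ W₂ ω
      + D.A W₁ ω * D.A W₂ ω * D.Z₁₂ W₁ W₂ ω + D.A W₂ ω * D.A W₁ ω * D.Z₁₂ W₁ W₂ ω) := by
  simp only [Z₂₂, Z₁₁, Z₁₂, mul_sub, smul_add, smul_sub, ← mul_smul_comm, wt_smul_Ah, D.A_add]
  simp only [invRem, invCoef]
  noncomm_ring

/-- The weight 1 + ω² of `form` cancels the denominator in `weightN`, which leaves the factor ω² wt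
of the remainder. -/
lemma G_eq (W₁ W₂ : 𝒲) (ω : ℝ) : D.G W₁ W₂ ω =
    D.form W₂ W₂ (D.weightN (W₁ + W₂) (D.Z₂₂ W₁ W₂)) ω
    + D.form W₁ W₁ (D.weightN (W₁ + W₂) (D.Z₁₁ W₁ W₂)) ω
    + D.form W₁ W₂ (D.weightN (W₁ + W₂) (D.Z₁₂ W₁ W₂)) ω
    + D.form W₂ W₁ (D.weightN (W₁ + W₂) (D.Z₁₂ W₁ W₂)) ω := by
  have h : (1 + ω ^ 2) * wt ω * (ω ^ 2 / (1 + ω ^ 2)) = ω ^ 2 * wt ω := by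
    have : (1 + ω ^ 2 : ℝ) ≠ 0 := by positivity
    field_simp
  simp only [G, form, weightN, mul_smul_comm, smul_smul, h, ← smul_add, invRem_eq, smul_mul_assoc]
  simp only [mul_add, add_mul, mul_assoc]

variable {D} in
lemma Regular.adm {W : 𝒲} {C B : ℝ} (h : D.Regular W C) {Z : ℝ → H →L[ℂ] H} (hZ : Continuous Z)
    (hB : ∀ ω, ‖Z ω‖ ≤ B) : Adm (D.weightN W Z) :=
  adm_of_bound (h.aestronglyMeasurable_weightN hZ) fun ω hω => h.norm_weightN_le hω (hB ω)

variable {D} in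
lemma Regular.adm_Z {W₁ W₂ : 𝒲} {C : ℝ} (h : D.Regular (W₁ + W₂) C) :
    Adm (D.weightN (W₁ + W₂) (D.Z₂₂ W₁ W₂)) ∧ Adm (D.weightN (W₁ + W₂) (D.Z₁₁ W₁ W₂)) ∧
      Adm (D.weightN (W₁ + W₂) (D.Z₁₂ W₁ W₂)) := by
  have hb := D.norm_Z_le (le_max_left ‖W₁‖ ‖W₂‖) (le_max_right ‖W₁‖ ‖W₂‖)
  exact ⟨h.adm (D.continuous_Z₂₂ _ _) fun ω => (hb ω).1,
    h.adm (D.continuous_Z₁₁ _ _) fun ω => (hb ω).2.1,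
    h.adm (D.continuous_Z₁₂ _ _) fun ω => (hb ω).2.2⟩

/-- The trace of the integrated remainder as a sum of trace forms. -/
def trG (W₁ W₂ : 𝒲) : ℂ :=
  D.Tr W₂ W₂ (D.weightN (W₁ + W₂) (D.Z₂₂ W₁ W₂)) + D.Tr W₁ W₁ (D.weightN (W₁ + W₂) (D.Z₁₁ W₁ W₂))
  + D.Tr W₁ W₂ (D.weightN (W₁ + W₂) (D.Z₁₂ W₁ W₂)) + D.Tr W₂ W₁ (D.weightN (W₁ + W₂) (D.Z₁₂ W₁ W₂))

variable {D} in
lemma Regular.integrable_G {W₁ W₂ : 𝒲} {C : ℝ} (h : D.Regular (W₁ + W₂) C) :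
    Integrable (D.G W₁ W₂) := by
  obtain ⟨h1, h2, h3⟩ := h.adm_Z
  exact ((((D.integrable_form W₂ W₂ h1).add (D.integrable_form W₁ W₁ h2)).add
    (D.integrable_form W₁ W₂ h3)).add (D.integrable_form W₂ W₁ h3)).congr
    (.of_forall fun ω => (D.G_eq W₁ W₂ ω).symm)

variable {D} in
lemma Regular.integral_G {W₁ W₂ : 𝒲} {C : ℝ} (h : D.Regular (W₁ + W₂) C) :
    (∃ c, TrBound (∫ ω, D.G W₁ W₂ ω) c) ∧ trace (∫ ω, D.G W₁ W₂ ω) = D.trG W₁ W₂ := by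
  obtain ⟨h1, h2, h3⟩ := h.adm_Z
  have i1 := D.integrable_form W₂ W₂ h1
  have i2 := D.integrable_form W₁ W₁ h2
  have i3 := D.integrable_form W₁ W₂ h3
  have i4 := D.integrable_form W₂ W₁ h3
  have t1 := D.trBound_integral_form W₂ W₂ h1
  have t2 := D.trBound_integral_form W₁ W₁ h2
  have t3 := D.trBound_integral_form W₁ W₂ h3
  have t4 := D.trBound_integral_form W₂ W₁ h3
  have e : ∫ ω, D.G W₁ W₂ ω = _ := integral_congr_ae (.of_forall (D.G_eq W₁ W₂))
  rw [e, integral_add _ i4, integral_add _ i3, integral_add i1 i2]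
  rotate_left
  · exact i1.add i2
  · exact (i1.add i2).add i3
  refine ⟨⟨_, ((t1.add t2).add t3).add t4⟩, ?_⟩
  rw [((t1.add t2).add t3).trace_add t4, (t1.add t2).trace_add t3, t1.trace_add t2]
  rfl

/-- Continuity of the trace of the integrated remainder. -/
lemma continuousAt_trG {X : Type} [TopologicalSpace X] {x₀ : X} [(𝓝 x₀).IsCountablyGenerated]
    {W₁ W₂ : X → 𝒲} {C : ℝ} (h₁ : ContinuousAt W₁ x₀) (h₂ : ContinuousAt W₂ x₀)
    (hC : ∀ᶠ x in 𝓝 x₀, D.Regular (W₁ x + W₂ x) C) :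
    ContinuousAt (fun x => D.trG (W₁ x) (W₂ x)) x₀ := by
  set M := max ‖W₁ x₀‖ ‖W₂ x₀‖ + 1
  have e1 : ∀ᶠ x in 𝓝 x₀, ‖W₁ x‖ < M :=
    h₁.norm.eventually_lt_const ((le_max_left _ _).trans_lt (lt_add_one _))
  have e2 : ∀ᶠ x in 𝓝 x₀, ‖W₂ x‖ < M :=
    h₂.norm.eventually_lt_const ((le_max_right _ _).trans_lt (lt_add_one _))
  have cA : ∀ ω (V : X → 𝒲), ContinuousAt V x₀ → ContinuousAt (fun x => D.A (V x) ω) x₀ :=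
    fun ω V hV => (D.AL ω).continuous.continuousAt.comp hV
  have cAh : ∀ ω (V : X → 𝒲), ContinuousAt V x₀ → ContinuousAt (fun x => D.Ah (V x) ω) x₀ :=
    fun ω V hV =>
    show ContinuousAt (fun x => (wt ω)⁻¹ • D.A (V x) ω) x₀ from
      (cA ω V hV).const_smul (wt ω)⁻¹
  have cN : ∀ ω, ω ≠ 0 → ContinuousAt (fun x => D.N (W₁ x + W₂ x) ω) x₀ := fun ω hω => by
    obtain ⟨u, hu⟩ := hC.self_of_nhds.isUnit ω hω
    have h1 : ContinuousAt Ring.inverse (1 + D.A (W₁ x₀ + W₂ x₀) ω) :=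
      hu ▸ NormedRing.inverse_continuousAt u
    exact h1.comp (f := fun x => 1 + D.A (W₁ x + W₂ x) ω)
      (continuousAt_const.add (cA ω _ (h₁.add h₂)))
  have key : ∀ (V V' : X → 𝒲) (Z : X → ℝ → H →L[ℂ] H), ContinuousAt V x₀ → ContinuousAt V' x₀ →
      (∀ x, Continuous (Z x)) → (∀ᶠ x in 𝓝 x₀, ∀ ω, ‖Z x ω‖ ≤ zBound (D.κ * M)) →
      (∀ ω, ContinuousAt (fun x => Z x ω) x₀) →
      ContinuousAt (fun x => D.Tr (V x) (V' x) (D.weightN (W₁ x + W₂ x) (Z x))) x₀ := by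
    intro V V' Z hV hV' hZ hb hc
    refine D.continuousAt_Tr hV hV' (B := zBound (D.κ * M) * C) ?_ ?_ ?_
    · filter_upwards [hC] with x hx
      exact hx.aestronglyMeasurable_weightN (hZ x)
    · filter_upwards [hC, hb] with x hx hb ω hω
      exact hx.norm_weightN_le hω (hb ω)
    · exact fun ω hω => show ContinuousAt (fun x => (ω ^ 2 / (1 + ω ^ 2)) •
        (Z x ω * D.N (W₁ x + W₂ x) ω)) x₀ from
        ((hc ω).mul (cN ω hω)).const_smul (ω ^ 2 / (1 + ω ^ 2))
  have eb : ∀ᶠ x in 𝓝 x₀, ∀ ω, ‖D.Z₂₂ (W₁ x) (W₂ x) ω‖ ≤ zBound (D.κ * M) ∧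
      ‖D.Z₁₁ (W₁ x) (W₂ x) ω‖ ≤ zBound (D.κ * M) ∧ ‖D.Z₁₂ (W₁ x) (W₂ x) ω‖ ≤ zBound (D.κ * M) := by
    filter_upwards [e1, e2] with x h1 h2
    exact D.norm_Z_le h1.le h2.le
  have c12 : ∀ ω, ContinuousAt (fun x => D.Z₁₂ (W₁ x) (W₂ x) ω) x₀ := fun ω =>
    (cAh ω _ h₂).sub ((cA ω _ h₁).mul (cAh ω _ (h₁.add h₂)))
  refine (((key _ _ _ h₂ h₂ (fun x => D.continuous_Z₂₂ _ _) (eb.mono fun x h ω => (h ω).1)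
    fun ω => cAh ω _ (h₁.add h₂)).add (key _ _ _ h₁ h₁ (fun x => D.continuous_Z₁₁ _ _)
    (eb.mono fun x h ω => (h ω).2.1) fun ω => ?_)).add (key _ _ _ h₁ h₂
    (fun x => D.continuous_Z₁₂ _ _) (eb.mono fun x h ω => (h ω).2.2) c12)).add
    (key _ _ _ h₂ h₁ (fun x => D.continuous_Z₁₂ _ _) (eb.mono fun x h ω => (h ω).2.2) c12)
  exact ((((cA ω _ h₁).mul (cA ω _ h₁)).mul (cAh ω _ (h₁.add h₂))).sub
    ((cA ω _ h₂).mul (cAh ω _ (h₁.add h₂)))).sub ((cA ω _ h₁).mul (cAh ω _ h₂))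

end FreeData
end DiracVacuum
end

noncomputable section

set_option maxSynthPendingDepth 3

namespace DiracVacuum

open scoped BoundedContinuousFunction

/-! ### Bounded continuous operator functions -/

lemma ringInverse_apply {𝔄 : Type} [NormedRing 𝔄] {x : ℝ →ᵇ 𝔄} (h : IsUnit x) (ω : ℝ) :
    Ring.inverse x ω = Ring.inverse (x ω) := by
  obtain ⟨u, rfl⟩ := h
  have h1 : u.1 ω * u.2 ω = 1 := congrArg (fun y : ℝ →ᵇ 𝔄 => y ω) u.mul_inv
  have h2 : u.2 ω * u.1 ω = 1 := congrArg (fun y : ℝ →ᵇ 𝔄 => y ω) u.inv_mul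
  rw [Ring.inverse_unit]
  exact (Ring.inverse_unit (⟨u.1 ω, u.2 ω, h1, h2⟩ : 𝔄ˣ)).symm

/-- The pointwise inverse is continuous and tends to 1 at infinity, so it is bounded and inverts 1 +
a in the algebra. The decay of a takes the place of a uniform bound on the inverses. -/
lemma isUnit_one_add_of_tendsto_zero {𝔄 : Type} [NormedRing 𝔄] [CompleteSpace 𝔄] (a : ℝ →ᵇ 𝔄)
    (h0 : Tendsto a (cocompact ℝ) (𝓝 0)) (hu : ∀ ω, IsUnit (1 + a ω)) : IsUnit (1 + a) := by
  have hc : Continuous fun ω => Ring.inverse (1 + a ω) := continuous_iff_continuousAt.2 fun ω => by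
    obtain ⟨u, hu⟩ := hu ω
    have h1 : ContinuousAt Ring.inverse (1 + a ω) := hu ▸ NormedRing.inverse_continuousAt u
    exact h1.comp (f := fun ω => 1 + a ω) (continuous_const.add a.continuous).continuousAt
  have ht : Tendsto (fun ω => Ring.inverse (1 + a ω) - 1) (cocompact ℝ) (𝓝 0) := by
    have h1 : Tendsto (fun ω => 1 + a ω) (cocompact ℝ) (𝓝 ((1 : 𝔄ˣ) : 𝔄)) := by
      simpa using h0.const_add 1
    have h2 := ((NormedRing.inverse_continuousAt (1 : 𝔄ˣ)).tendsto.comp h1).sub_const 1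
    simpa using h2
  let n : ℝ →ᵇ 𝔄 := 1 + ZeroAtInftyContinuousMap.toBCF
    (⟨⟨fun ω => Ring.inverse (1 + a ω) - 1, hc.sub continuous_const⟩, ht⟩ :
      ZeroAtInftyContinuousMap ℝ 𝔄)
  have hn : ∀ ω, n ω = Ring.inverse (1 + a ω) := fun ω => add_sub_cancel _ _
  exact ⟨⟨1 + a, n, by
    ext ω
    change (1 + a ω) * n ω = 1
    rw [hn, Ring.mul_inverse_cancel _ (hu ω)], by
    ext ω
    change n ω * (1 + a ω) = 1
    rw [hn, Ring.inverse_mul_cancel _ (hu ω)]⟩, rfl⟩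

lemma tendsto_wt_cocompact : Tendsto wt (cocompact ℝ) (𝓝 0) := by
  have h1 : Tendsto (fun ω : ℝ => 1 + ω ^ 2) (cocompact ℝ) atTop := by
    refine tendsto_atTop_add_const_left _ _ ?_
    have := (tendsto_pow_atTop two_ne_zero).comp (tendsto_norm_cocompact_atTop (E := ℝ))
    simpa [Function.comp_def] using this
  exact (tendsto_rpow_neg_atTop (by norm_num : (0 : ℝ) < 1 / 4)).comp h1

namespace FreeData

variable {H 𝒲 : Type} [NormedAddCommGroup H] [InnerProductSpace ℂ H] [CompleteSpace H]
  [NormedAddCommGroup 𝒲] [NormedSpace ℝ 𝒲] (D : FreeData H 𝒲)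

/-- `W ↦ A W` as a map to bounded continuous operator functions. -/
def AB : 𝒲 →L[ℝ] (ℝ →ᵇ (H →L[ℂ] H)) :=
  LinearMap.mkContinuous
    { toFun := fun W => BoundedContinuousFunction.ofNormedAddCommGroup (D.A W) (D.continuous_A W)
        (D.κ * ‖W‖) (D.norm_A_le' W)
      map_add' := fun V W => by ext1 ω; exact D.A_add V W ω
      map_smul' := fun r W => by ext1 ω; exact D.A_smul r W ω } D.κ fun W =>
    BoundedContinuousFunction.norm_ofNormedAddCommGroup_le _
      (mul_nonneg D.κ_nonneg (norm_nonneg _)) (D.norm_A_le' W)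

/-- `W ↦ Ah W` as a map to bounded continuous operator functions. -/
def AhB : 𝒲 →L[ℝ] (ℝ →ᵇ (H →L[ℂ] H)) :=
  LinearMap.mkContinuous
    { toFun := fun W => BoundedContinuousFunction.ofNormedAddCommGroup (D.Ah W) (D.continuous_Ah W)
        (D.κ * ‖W‖) (D.norm_Ah_le W)
      map_add' := fun V W => by
        ext1 ω
        exact (congrArg ((wt ω)⁻¹ • ·) (D.A_add V W ω)).trans (smul_add _ _ _)
      map_smul' := fun r W => by
        ext1 ω
        exact (congrArg ((wt ω)⁻¹ • ·) (D.A_smul r W ω)).trans (smul_comm _ _ _) } D.κ fun W =>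
    BoundedContinuousFunction.norm_ofNormedAddCommGroup_le _
      (mul_nonneg D.κ_nonneg (norm_nonneg _)) (D.norm_Ah_le W)

lemma isUnit_one_add_AB {W : 𝒲} (h : ∀ ω, IsUnit (1 + D.A W ω)) : IsUnit (1 + D.AB W) := by
  refine isUnit_one_add_of_tendsto_zero _ ?_ h
  refine squeeze_zero_norm (D.norm_A_le W) ?_
  simpa using tendsto_wt_cocompact.const_mul (D.κ * ‖W‖)

variable (H) in
/-- The scalar weight `ω² (1 + ω²)⁻¹`. -/
def weightB : ℝ →ᵇ (H →L[ℂ] H) :=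
  BoundedContinuousFunction.ofNormedAddCommGroup
    (fun ω => (ω ^ 2 / (1 + ω ^ 2)) • (1 : H →L[ℂ] H))
    (Continuous.smul ((continuous_id.pow 2).div (by fun_prop) fun ω => by positivity)
      continuous_const) 1 fun ω => by
    have hpos : (0 : ℝ) < 1 + ω ^ 2 := by positivity
    rw [norm_smul, Real.norm_of_nonneg (by positivity)]
    refine mul_le_one₀ ((div_le_one hpos).2 (by linarith)) (norm_nonneg _)
      ContinuousLinearMap.norm_id_le

lemma weightB_mul (W : 𝒲) (hu : IsUnit (1 + D.AB W)) (Z : ℝ →ᵇ (H →L[ℂ] H)) :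
    ⇑(weightB H * (Z * Ring.inverse (1 + D.AB W))) = D.weightN W Z := by
  funext ω
  change (ω ^ 2 / (1 + ω ^ 2)) • (1 : H →L[ℂ] H) * (Z ω * Ring.inverse (1 + D.AB W) ω) = _
  rw [ringInverse_apply hu, smul_mul_assoc, one_mul]
  rfl

/-- Smoothness of the trace of the integrated remainder. -/
lemma contDiffAt_trG {E : Type} [NormedAddCommGroup E] [NormedSpace ℝ E] {W₁ W₂ : E → 𝒲} {x₀ : E}
    {n : WithTop ℕ∞} (h₁ : ContDiffAt ℝ n W₁ x₀) (h₂ : ContDiffAt ℝ n W₂ x₀)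
    (hu : ∀ ω, IsUnit (1 + D.A (W₁ x₀ + W₂ x₀) ω)) :
    ContDiffAt ℝ n (fun x => D.trG (W₁ x) (W₂ x)) x₀ := by
  have hB : ContDiffAt ℝ n (fun x => 1 + D.AB (W₁ x + W₂ x)) x₀ :=
    contDiffAt_const.add (D.AB.contDiff.contDiffAt.comp x₀ (h₁.add h₂))
  have hunit := D.isUnit_one_add_AB hu
  have hev : ∀ᶠ x in 𝓝 x₀, IsUnit (1 + D.AB (W₁ x + W₂ x)) :=
    hB.continuousAt.eventually_mem (Units.isOpen.mem_nhds hunit)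
  -- Inversion is smooth on the units of the Banach algebra of bounded continuous functions. All ω
  -- are treated at once, so no differentiation under the integral is needed.
  have hinv : ContDiffAt ℝ n (fun x => Ring.inverse (1 + D.AB (W₁ x + W₂ x))) x₀ := by
    obtain ⟨u, hu⟩ := hunit
    have h3 : ContDiffAt ℝ n Ring.inverse (1 + D.AB (W₁ x₀ + W₂ x₀)) :=
      hu ▸ contDiffAt_ringInverse ℝ u
    exact h3.comp x₀ hB
  have key : ∀ {V V' : E → 𝒲} {Z : E → ℝ →ᵇ (H →L[ℂ] H)}, ContDiffAt ℝ n V x₀ →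
      ContDiffAt ℝ n V' x₀ → ContDiffAt ℝ n Z x₀ → ContDiffAt ℝ n (fun x => D.TrL (V x) (V' x)
        (weightB H * (Z x * Ring.inverse (1 + D.AB (W₁ x + W₂ x))))) x₀ := fun hV hV' hZ =>
    ((D.TrL.contDiff.contDiffAt.comp x₀ hV).clm_apply hV').clm_apply
      (contDiffAt_const.mul (hZ.mul hinv))
  have a1 : ContDiffAt ℝ n (fun x => D.AB (W₁ x)) x₀ := D.AB.contDiff.contDiffAt.comp x₀ h₁
  have a2 : ContDiffAt ℝ n (fun x => D.AB (W₂ x)) x₀ := D.AB.contDiff.contDiffAt.comp x₀ h₂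
  have a3 : ContDiffAt ℝ n (fun x => D.AhB (W₂ x)) x₀ := D.AhB.contDiff.contDiffAt.comp x₀ h₂
  have a4 : ContDiffAt ℝ n (fun x => D.AhB (W₁ x + W₂ x)) x₀ :=
    D.AhB.contDiff.contDiffAt.comp x₀ (h₁.add h₂)
  have z11 := ((((a1.mul a1).mul a4)).sub (a2.mul a4)).sub (a1.mul a3)
  have z12 := a3.sub (a1.mul a4)
  refine ((((key h₂ h₂ a4).add (key h₁ h₁ z11)).add (key h₁ h₂ z12)).add
    (key h₂ h₁ z12)).congr_of_eventuallyEq ?_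
  -- Equality is only local: where 1 + A is not a unit of the algebra, `Ring.inverse` there is 0,
  -- while pointwise inverses may still exist.
  filter_upwards [hev] with x hx
  simp only [TrL_apply, weightB_mul _ _ hx]
  rfl

end FreeData
end DiracVacuum
end

noncomputable section

set_option maxSynthPendingDepth 3

namespace DiracVacuum

open scoped BoundedContinuousFunction

namespace FreeData

variable {H 𝒲 : Type} [NormedAddCommGroup H] [InnerProductSpace ℂ H] [CompleteSpace H]
  [NormedAddCommGroup 𝒲] [NormedSpace ℝ 𝒲] (D : FreeData H 𝒲)

lemma N_zero (ω : ℝ) : D.N 0 ω = 1 := by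
  have h := D.A_smul 0 0 ω
  rw [zero_smul, zero_smul] at h
  rw [N, h, add_zero, Ring.inverse_one]

/-! #### Taylor expansion of the quotient -/

/-- The operator `1 - ω² R (1 + A)⁻¹`. -/
def quot (W : 𝒲) (ω : ℝ) : H →L[ℂ] H := 1 - ω ^ 2 • (D.R ω * D.N W ω)

lemma N_line (W₁ W₂ : 𝒲) (ω s : ℝ) : D.N (s • W₁ + s ^ 2 • W₂) ω =
    Ring.inverse (1 + s • D.A W₁ ω + s ^ 2 • D.A W₂ ω) := by
  rw [N, D.A_add, D.A_smul, D.A_smul, add_assoc]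

/-- The map `X ↦ -ω² R X`. -/
def quotL (ω : ℝ) : (H →L[ℂ] H) →L[ℝ] (H →L[ℂ] H) :=
  -(ω ^ 2 • ContinuousLinearMap.mul ℝ (H →L[ℂ] H) (D.R ω))

lemma quot_line (W₁ W₂ : 𝒲) (ω s : ℝ) : D.quot (s • W₁ + s ^ 2 • W₂) ω =
    1 + D.quotL ω (Ring.inverse (1 + s • D.A W₁ ω + s ^ 2 • D.A W₂ ω)) := by
  rw [quot, N_line, sub_eq_add_neg]
  rfl

lemma contDiffAt_quotL_inverse (W₁ W₂ : 𝒲) (ω : ℝ) : ContDiffAt ℝ 4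
    (fun s : ℝ => D.quotL ω (Ring.inverse (1 + s • D.A W₁ ω + s ^ 2 • D.A W₂ ω))) 0 :=
  (D.quotL ω).contDiff.contDiffAt.comp _ (contDiffAt_inverse_line _ _)

lemma contDiffAt_quot (W₁ W₂ : 𝒲) (ω : ℝ) :
    ContDiffAt ℝ 4 (fun s : ℝ => D.quot (s • W₁ + s ^ 2 • W₂) ω) 0 := by
  simp only [quot_line]
  exact contDiffAt_const.add (D.contDiffAt_quotL_inverse W₁ W₂ ω)

lemma tay_quot (W₁ W₂ : 𝒲) (ω : ℝ) : tay (fun s : ℝ => D.quot (s • W₁ + s ^ 2 • W₂) ω) =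
    1 - ω ^ 2 • (D.R ω * invTay (D.A W₁ ω) (D.A W₂ ω)) := by
  simp only [quot_line]
  rw [tay_add contDiffAt_const (D.contDiffAt_quotL_inverse W₁ W₂ ω), tay_const,
    tay_clm (contDiffAt_inverse_line _ _) (D.quotL ω), tay_inverse, sub_eq_add_neg]
  rfl

/-- At ω = 0 both sides vanish through the factor ω², so invertibility is required only for ω ≠ 0.
-/
lemma quot_sub_tay {W₁ W₂ : 𝒲} {ω : ℝ} (h : ω ≠ 0 → IsUnit (1 + D.A (W₁ + W₂) ω)) :
    D.quot (W₁ + W₂) ω - tay (fun s : ℝ => D.quot (s • W₁ + s ^ 2 • W₂) ω) = D.G W₁ W₂ ω := by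
  rw [tay_quot, quot, G]
  rcases eq_or_ne ω 0 with rfl | hω
  · simp
  have h1 := h hω
  rw [N]
  rw [D.A_add] at h1 ⊢
  have h2 := inverse_eq_invTay_sub h1
  rw [← sub_eq_iff_eq_add'.2 (sub_eq_iff_eq_add.1 h2.symm), mul_sub, smul_sub]
  abel

/-- Taking adjoints is real linear and continuous, so it commutes with derivatives in the real
parameter s. -/
lemma isSelfAdjoint_tay {f : ℝ → H →L[ℂ] H} (hf : ContDiffAt ℝ 4 f 0)
    (hs : ∀ s, IsSelfAdjoint (f s)) : IsSelfAdjoint (tay f) := by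
  have h := tay_clm hf ((starL' ℝ : (H →L[ℂ] H) ≃L[ℝ] (H →L[ℂ] H)) : (H →L[ℂ] H) →L[ℝ] (H →L[ℂ] H))
  have e : (fun s => ((starL' ℝ : (H →L[ℂ] H) ≃L[ℝ] (H →L[ℂ] H)) :
      (H →L[ℂ] H) →L[ℝ] (H →L[ℂ] H)) (f s)) = f := funext fun s => (hs s)
  rw [e] at h
  exact h.symm

lemma isSelfAdjoint_integral {f : ℝ → H →L[ℂ] H} (hs : ∀ s, IsSelfAdjoint (f s)) :
    IsSelfAdjoint (∫ ω, f ω) := by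
  have h := (starL' ℝ : (H →L[ℂ] H) ≃L[ℝ] (H →L[ℂ] H)).integral_comp_comm (μ := volume) f
  have e : (fun s => (starL' ℝ : (H →L[ℂ] H) ≃L[ℝ] (H →L[ℂ] H)) (f s)) = f :=
    funext fun s => (hs s)
  rw [e] at h
  exact h.symm

lemma isSelfAdjoint_integral_G {W₁ W₂ : 𝒲} (hu : ∀ ω, ω ≠ 0 → IsUnit (1 + D.A (W₁ + W₂) ω))
    (hs : ∀ (s ω : ℝ), IsSelfAdjoint (D.quot (s • W₁ + s ^ 2 • W₂) ω)) :
    IsSelfAdjoint (∫ ω, D.G W₁ W₂ ω) := by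
  refine isSelfAdjoint_integral fun ω => ?_
  rw [← D.quot_sub_tay (hu ω)]
  refine IsSelfAdjoint.sub ?_ (isSelfAdjoint_tay (D.contDiffAt_quot W₁ W₂ ω) fun s => hs s ω)
  simpa using hs 1 ω

/-! #### Taylor expansion of the absolute value -/

/-- The operator `π⁻¹ ∫ (1 - ω² R (1 + A)⁻¹) dω R₀`. -/
def absM (W : 𝒲) : H →L[ℂ] H := Real.pi⁻¹ • ∫ ω, D.quot W ω * D.R 0

lemma sq_mul_norm_R_le (ω : ℝ) : ω ^ 2 * ‖D.R ω‖ ≤ 1 :=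
  (mul_le_mul_of_nonneg_right (by linarith) (norm_nonneg _)).trans (D.one_add_sq_mul_norm_R_le ω)

/-- The two resolvents give (1 + ω²)⁻², of which one power is spent on ω²X. -/
lemma integrable_R_mul_R {X : ℝ → H →L[ℂ] H} {B : ℝ} (hm : AEStronglyMeasurable X volume)
    (hX : ∀ ω, ω ≠ 0 → ω ^ 2 * ‖X ω‖ ≤ B * (1 + ω ^ 2)) :
    Integrable fun ω => ω ^ 2 • (D.R ω * X ω * D.R ω) := by
  have hR := D.continuous_R.aestronglyMeasurable (μ := volume)
  refine (integrable_inv_one_add_sq.const_mul B).mono'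
    ((continuous_id.pow 2).aestronglyMeasurable.smul ((hR.mul hm).mul hR)) ?_
  filter_upwards [Measure.ae_ne volume 0] with ω hω
  have hpos : (0 : ℝ) < 1 + ω ^ 2 := by positivity
  have hB : 0 ≤ B * (1 + ω ^ 2) := le_trans (by positivity) (hX ω hω)
  rw [norm_smul, Real.norm_of_nonneg (by positivity)]
  calc ω ^ 2 * ‖D.R ω * X ω * D.R ω‖ ≤ ω ^ 2 * (‖D.R ω‖ * ‖X ω‖ * ‖D.R ω‖) :=
        mul_le_mul_of_nonneg_left norm_mul₃_le (by positivity)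
    _ = (ω ^ 2 * ‖X ω‖) * (‖D.R ω‖ * ‖D.R ω‖) := by ring
    _ ≤ (B * (1 + ω ^ 2)) * ((1 + ω ^ 2)⁻¹ * (1 + ω ^ 2)⁻¹) :=
      mul_le_mul (hX ω hω) (mul_le_mul (D.norm_R_le ω) (D.norm_R_le ω) (norm_nonneg _)
        (by positivity)) (by positivity) hB
    _ = B * (1 + ω ^ 2)⁻¹ := by field_simp

lemma integrable_R_mul_R_of_bound {X : ℝ → H →L[ℂ] H} {B : ℝ}
    (hm : AEStronglyMeasurable X volume) (hX : ∀ ω, ‖X ω‖ ≤ B) :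
    Integrable fun ω => ω ^ 2 • (D.R ω * X ω * D.R ω) := by
  refine D.integrable_R_mul_R hm (B := B) fun ω _ => ?_
  have hB := (norm_nonneg _).trans (hX ω)
  nlinarith [mul_le_mul_of_nonneg_left (hX ω) (sq_nonneg ω)]

/-- `X ↦ ∫ ω² R X R dω` on bounded continuous operator functions. -/
def sandwich : (ℝ →ᵇ (H →L[ℂ] H)) →L[ℝ] (H →L[ℂ] H) :=
  have hi : ∀ X : ℝ →ᵇ (H →L[ℂ] H), Integrable fun ω => ω ^ 2 • (D.R ω * X ω * D.R ω) := fun X =>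
    D.integrable_R_mul_R_of_bound X.continuous.aestronglyMeasurable X.norm_coe_le_norm
  LinearMap.mkContinuous
    { toFun := fun X => ∫ ω, ω ^ 2 • (D.R ω * X ω * D.R ω)
      map_add' := fun X Y => by
        rw [← integral_add (hi X) (hi Y)]
        refine integral_congr_ae (.of_forall fun ω => ?_)
        change ω ^ 2 • (D.R ω * (X ω + Y ω) * D.R ω) = _
        rw [mul_add, add_mul, smul_add]
      map_smul' := fun r X => by
        rw [RingHom.id_apply, ← integral_smul]
        refine integral_congr_ae (.of_forall fun ω => ?_)
        change ω ^ 2 • (D.R ω * (r • X ω) * D.R ω) = r • ω ^ 2 • (D.R ω * X ω * D.R ω)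
        rw [mul_smul_comm, smul_mul_assoc, smul_comm] }
    (∫ ω : ℝ, (1 + ω ^ 2)⁻¹) fun X => by
      change ‖∫ ω, ω ^ 2 • (D.R ω * X ω * D.R ω)‖ ≤ _
      rw [← integral_mul_const]
      refine norm_integral_le_of_norm_le (integrable_inv_one_add_sq.mul_const _)
        (.of_forall fun ω => ?_)
      rw [norm_smul, Real.norm_of_nonneg (by positivity)]
      calc ω ^ 2 * ‖D.R ω * X ω * D.R ω‖ ≤ ω ^ 2 * (‖D.R ω‖ * ‖X ω‖ * ‖D.R ω‖) :=
            mul_le_mul_of_nonneg_left norm_mul₃_le (by positivity)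
        _ = (ω ^ 2 * ‖D.R ω‖) * (‖D.R ω‖ * ‖X ω‖) := by ring
        _ ≤ 1 * ((1 + ω ^ 2)⁻¹ * ‖X‖) := mul_le_mul (D.sq_mul_norm_R_le ω)
          (mul_le_mul (D.norm_R_le ω) (X.norm_coe_le_norm ω) (norm_nonneg _) (by positivity))
          (by positivity) zero_le_one
        _ = _ := one_mul _

lemma sandwich_apply (X : ℝ →ᵇ (H →L[ℂ] H)) :
    D.sandwich X = ∫ ω, ω ^ 2 • (D.R ω * X ω * D.R ω) := rfl

variable {D} in
lemma Regular.integrable_sandwich {W : 𝒲} {C : ℝ} (h : D.Regular W C) :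
    Integrable fun ω => ω ^ 2 • (D.R ω * (D.N W ω * D.A W 0) * D.R ω) := by
  refine D.integrable_R_mul_R (h.aestronglyMeasurable_N.mul_const (D.A W 0))
    (B := C * ‖D.A W 0‖) fun ω hω => ?_
  calc ω ^ 2 * ‖D.N W ω * D.A W 0‖ ≤ ω ^ 2 * (‖D.N W ω‖ * ‖D.A W 0‖) :=
        mul_le_mul_of_nonneg_left (norm_mul_le _ _) (by positivity)
    _ = (ω ^ 2 * ‖D.N W ω‖) * ‖D.A W 0‖ := by ring
    _ ≤ (C * (1 + ω ^ 2)) * ‖D.A W 0‖ := mul_le_mul_of_nonneg_right (h.bound ω hω) (norm_nonneg _)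
    _ = _ := by ring

/-- A_0 R_ω = A_ω R_0 and N A_ω = 1 − N. Read from right to left, R_0 is exchanged for R_ω; this
extra decay makes ω²R_ω(1 − N)R_0 integrable in norm, although 1 − N alone is only known to be
O(|ω|^{-1/2}). This is the use of R_0, that is, of restricting to H². -/
lemma N_mul_A_mul_R {W : 𝒲} {ω : ℝ} (h : IsUnit (1 + D.A W ω)) :
    D.N W ω * D.A W 0 * D.R ω = (1 - D.N W ω) * D.R 0 := by
  have h1 := Ring.inverse_mul_cancel _ h
  rw [mul_add, mul_one] at h1
  rw [mul_assoc, ← D.A_mul_R W ω 0, ← mul_assoc]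
  congr 1
  exact eq_sub_of_add_eq' h1

variable {D} in
-- The free part, independent of W, is split off. The rest is an absolutely convergent integral that
-- depends on N and A_0 through a continuous linear map, so its Taylor polynomial can be taken
-- inside.
lemma Regular.absM_eq {W : 𝒲} {C : ℝ} (h : D.Regular W C)
    (h0 : Integrable fun ω => (1 - ω ^ 2 • D.R ω) * D.R 0) :
    D.absM W = Real.pi⁻¹ • (∫ ω, (1 - ω ^ 2 • D.R ω) * D.R 0) +
      Real.pi⁻¹ • ∫ ω, ω ^ 2 • (D.R ω * (D.N W ω * D.A W 0) * D.R ω) := by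
  rw [absM, ← smul_add, ← integral_add h0 h.integrable_sandwich]
  congr 1
  refine integral_congr_ae ?_
  filter_upwards [Measure.ae_ne volume 0] with ω hω
  rw [mul_assoc (D.R ω), D.N_mul_A_mul_R (h.isUnit ω hω), quot, ← mul_assoc,
    ← smul_mul_assoc (ω ^ 2) (D.R ω * (1 - D.N W ω)), ← add_mul, mul_sub, mul_one, smul_sub]
  congr 1
  abel

/-- The Taylor expansion of the absolute value, with remainder `-π⁻¹ (∫ G) R₀`. -/
theorem contDiffAt_absM {W₁ W₂ : 𝒲} (hreg : ∀ s : ℝ, ∃ C, D.Regular (s • W₁ + s ^ 2 • W₂) C)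
    (h0 : Integrable fun ω => (1 - ω ^ 2 • D.R ω) * D.R 0) :
    ContDiffAt ℝ 4 (fun s : ℝ => D.absM (s • W₁ + s ^ 2 • W₂)) 0 ∧
    tay (fun s : ℝ => D.absM (s • W₁ + s ^ 2 • W₂)) - D.absM (W₁ + W₂) =
      (-((Real.pi⁻¹ : ℝ) : ℂ)) • ((∫ ω, D.G W₁ W₂ ω) * D.R 0) := by
  set a₁ := D.AB W₁
  set a₂ := D.AB W₂
  set b₁ : ℝ →ᵇ (H →L[ℂ] H) := BoundedContinuousFunction.const ℝ (D.A W₁ 0)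
  set b₂ : ℝ →ᵇ (H →L[ℂ] H) := BoundedContinuousFunction.const ℝ (D.A W₂ 0)
  set c := Real.pi⁻¹ • (∫ ω, (1 - ω ^ 2 • D.R ω) * D.R 0)
  set X : ℝ → ℝ →ᵇ (H →L[ℂ] H) := fun s =>
    Ring.inverse (1 + s • a₁ + s ^ 2 • a₂) * (s • b₁ + s ^ 2 • b₂) with hX
  have hev : (fun s : ℝ => D.absM (s • W₁ + s ^ 2 • W₂)) =ᶠ[𝓝 0]
      fun s => c + (Real.pi⁻¹ • D.sandwich) (X s) := by
    filter_upwards [eventually_isUnit_line a₁ a₂] with s hs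
    obtain ⟨C, hC⟩ := hreg s
    rw [hC.absM_eq h0, smul_apply, sandwich_apply]
    congr 3
    funext ω
    have e : X s ω = D.N (s • W₁ + s ^ 2 • W₂) ω * D.A (s • W₁ + s ^ 2 • W₂) 0 := by
      rw [N_line, D.A_add, D.A_smul, D.A_smul]
      change Ring.inverse (1 + s • a₁ + s ^ 2 • a₂) ω * _ = _
      rw [ringInverse_apply hs]
      rfl
    rw [e]
  have hXd : ContDiffAt ℝ 4 X 0 := by
    refine (contDiffAt_inverse_line a₁ a₂).mul ?_
    fun_prop
  have hd : ContDiffAt ℝ 4 (fun s => (Real.pi⁻¹ • D.sandwich) (X s)) 0 :=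
    (Real.pi⁻¹ • D.sandwich).contDiff.contDiffAt.comp _ hXd
  refine ⟨(contDiffAt_const.add hd).congr_of_eventuallyEq hev, ?_⟩
  obtain ⟨C, hC⟩ : ∃ C, D.Regular (W₁ + W₂) C := by simpa using hreg 1
  rw [neg_smul, Complex.coe_smul]
  rw [tay_congr hev, tay_add contDiffAt_const hd, tay_const, tay_clm hXd, hX, tay_inverse_mul,
    hC.absM_eq h0, smul_apply, sandwich_apply, add_sub_add_left_eq_sub, ← smul_sub,
    ← integral_sub ?_ hC.integrable_sandwich, ← smul_neg]
  · congr 1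
    have hG : (∫ ω, D.G W₁ W₂ ω) * D.R 0 = ∫ ω, D.G W₁ W₂ ω * D.R 0 :=
      (((ContinuousLinearMap.mul ℝ (H →L[ℂ] H)).flip (D.R 0)).integral_comp_comm
        hC.integrable_G).symm
    rw [hG, ← integral_neg]
    refine integral_congr_ae ?_
    filter_upwards [Measure.ae_ne volume 0] with ω hω
    have hu := hC.isUnit ω hω
    -- On the right, R_ω turns the Taylor polynomial into (1 − invTay)R_0 and the full sandwich into
    -- (1 − N)R_0; their difference is the remainder of N times R_0.
    have e : invMulTay a₁ a₂ b₁ b₂ ω * D.R ω = (1 - invTay (D.A W₁ ω) (D.A W₂ ω)) * D.R 0 :=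
      invMulTay_mul (b₁ := D.A W₁ 0) (b₂ := D.A W₂ 0) (r := D.R ω) (D.A_mul_R W₁ 0 ω)
        (D.A_mul_R W₂ 0 ω)
    rw [mul_assoc (D.R ω), mul_assoc (D.R ω), e, D.N_mul_A_mul_R hu, G, ← smul_sub, ← mul_sub,
      ← sub_mul, smul_mul_assoc, ← smul_neg, mul_assoc (D.R ω), ← mul_neg, ← neg_mul]
    have h2 := inverse_eq_invTay_sub (D.A_add W₁ W₂ ω ▸ hu)
    congr 3
    rw [N, D.A_add]
    rw [sub_sub_sub_cancel_left]
    exact sub_eq_of_eq_add' (by rw [← sub_eq_add_neg]; exact h2)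
  · exact D.integrable_R_mul_R_of_bound (BoundedContinuousFunction.continuous _).aestronglyMeasurable
      (BoundedContinuousFunction.norm_coe_le_norm _)

end FreeData
end DiracVacuum
end

noncomputable section

set_option maxSynthPendingDepth 3

namespace DiracVacuum

/-! ### The vacuum operator and the vacuum energy -/

section VacuumEnergy

variable {α : Fin 3 → Matrix (Fin 4) (Fin 4) ℂ} {β : Matrix (Fin 4) (Fin 4) ℂ} {ε : ℝ}

/-- The free Dirac resolvent with matrix valued potentials. -/
def freeData (hc : 0 < 2 * Real.pi * ε) : FreeData (L2 C4) (L2 M4) where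
  R := R (2 * Real.pi * ε)
  A := A hc
  κ := 2 * resConst (2 * Real.pi * ε)
  κ_nonneg := mul_nonneg zero_le_two (resConst_nonneg _)
  continuous_R := continuous_R _
  norm_R_le := norm_R_le _
  A_add := A_add hc
  A_smul := A_smul hc
  continuous_A := continuous_A hc
  norm_A_le W ω := (norm_A_le hc W ω).trans_eq (by ring)
  hsBound_A W ω := by
    have h := hsBound_A hc W ω
    rwa [show 2 * ‖W‖ * (resConst (2 * Real.pi * ε) * wt ω) =
      2 * resConst (2 * Real.pi * ε) * ‖W‖ * wt ω by ring] at h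
  A_mul_R := A_mul_R hc

lemma pot_smul (φ : H1) (s : ℝ) :
    pot α β ε (s • φ) = s • linPot α β ε φ + s ^ 2 • quadPot φ φ := by
  rw [pot, map_smul, map_smul, map_smul, smul_apply, smul_smul, sq]

/-- The constant depends on K alone and thus serves for all φ near a given one;
`continuous_vacuumEnergy` relies on this. -/
lemma regular_pot (hD : IsDiracMatrices α β) (hε : 0 < ε) (hc : 0 < 2 * Real.pi * ε) {φ : H1} {K : ℝ}
    (hK : ‖pot α β ε φ‖ ≤ K) : (freeData hc).Regular (pot α β ε φ)
      (2 * (1 + thr (2 * Real.pi * ε) K ^ 2) ^ 2) where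
  isUnit _ hω := isUnit_of_ne_zero hD hε hc φ hω
  bound _ hω := sq_mul_norm_N_le hD hε hc hK hω

lemma regular_line (hD : IsDiracMatrices α β) (hε : 0 < ε) (hc : 0 < 2 * Real.pi * ε) (φ : H1)
    (s : ℝ) : ∃ C, (freeData hc).Regular (s • linPot α β ε φ + s ^ 2 • quadPot φ φ) C :=
  ⟨_, pot_smul (α := α) (β := β) (ε := ε) φ s ▸ regular_pot hD hε hc le_rfl⟩

lemma quotientOp_eq_quot (hD : IsDiracMatrices α β) (hε : 0 < ε) (hc : 0 < 2 * Real.pi * ε) (φ : H1)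
    (ω : ℝ) : quotientOp α β ε φ ω = (freeData hc).quot (pot α β ε φ) ω := by
  rw [quotientOp_eq hD hε hc, Complex.coe_smul]
  rfl

lemma isSelfAdjoint_quotientOp (hD : IsDiracMatrices α β) (hε : 0 < ε) (φ : H1) (ω : ℝ) :
    IsSelfAdjoint (quotientOp α β ε φ ω) := by
  have hc : 0 < 2 * Real.pi * ε := by positivity
  rw [quotientOp_eq hD hε hc]
  rcases eq_or_ne ω 0 with rfl | hω
  · simp
  · refine (IsSelfAdjoint.one _).sub (IsSelfAdjoint.smul (Complex.conj_ofReal _) ?_)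
    exact (isSqResolvent_R_N hD hε hc hω (isUnit_of_ne_zero hD hε hc φ hω)).isSelfAdjoint
      (isSelfAdjoint_dirac hD hε hc φ)

lemma quotientOp_line (hD : IsDiracMatrices α β) (hε : 0 < ε) (hc : 0 < 2 * Real.pi * ε) (φ : H1)
    (ω s : ℝ) : quotientOp α β ε (s • φ) ω =
      (freeData hc).quot (s • linPot α β ε φ + s ^ 2 • quadPot φ φ) ω := by
  rw [quotientOp_eq_quot hD hε hc, pot_smul]

theorem contDiffAt_quotientOp (hD : IsDiracMatrices α β) (hε : 0 < ε) (φ : H1) (ω : ℝ) :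
    ContDiffAt ℝ 4 (fun s : ℝ => quotientOp α β ε (s • φ) ω) 0 := by
  have hc : 0 < 2 * Real.pi * ε := by positivity
  simp only [quotientOp_line hD hε hc]
  exact (freeData hc).contDiffAt_quot _ _ ω

lemma vacuumIntegrand_eq (hD : IsDiracMatrices α β) (hε : 0 < ε) (hc : 0 < 2 * Real.pi * ε)
    (φ : H1) : vacuumIntegrand α β ε φ = (freeData hc).G (linPot α β ε φ) (quadPot φ φ) := by
  funext ω
  rw [← (freeData hc).quot_sub_tay fun hω => isUnit_of_ne_zero hD hε hc φ hω]
  simp only [← quotientOp_line hD hε hc]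
  rw [vacuumIntegrand, quotientOp_eq_quot hD hε hc]
  rfl

theorem integrable_vacuumIntegrand (hD : IsDiracMatrices α β) (hε : 0 < ε) (φ : H1) :
    Integrable (vacuumIntegrand α β ε φ) := by
  have hc : 0 < 2 * Real.pi * ε := by positivity
  rw [vacuumIntegrand_eq hD hε hc]
  exact (regular_pot hD hε hc le_rfl : (freeData hc).Regular (pot α β ε φ) _).integrable_G

lemma trBound_integral_vacuumIntegrand (hD : IsDiracMatrices α β) (hε : 0 < ε)
    (hc : 0 < 2 * Real.pi * ε) (φ : H1) :
    (∃ c, TrBound (∫ ω, vacuumIntegrand α β ε φ ω) c) ∧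
      trace (∫ ω, vacuumIntegrand α β ε φ ω) =
        (freeData hc).trG (linPot α β ε φ) (quadPot φ φ) := by
  rw [vacuumIntegrand_eq hD hε hc]
  exact (regular_pot hD hε hc le_rfl : (freeData hc).Regular (pot α β ε φ) _).integral_G

lemma isSelfAdjoint_integral_vacuumIntegrand (hD : IsDiracMatrices α β) (hε : 0 < ε) (φ : H1) :
    IsSelfAdjoint (∫ ω, vacuumIntegrand α β ε φ ω) := by
  have hc : 0 < 2 * Real.pi * ε := by positivity
  rw [vacuumIntegrand_eq hD hε hc]
  refine (freeData hc).isSelfAdjoint_integral_G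
    (fun ω hω => isUnit_of_ne_zero hD hε hc φ hω) fun s ω => ?_
  rw [← quotientOp_line hD hε hc]
  exact isSelfAdjoint_quotientOp hD hε _ ω

/-! ### The vacuum operator -/

lemma absR_eq_absM (hD : IsDiracMatrices α β) (hε : 0 < ε) (hc : 0 < 2 * Real.pi * ε) (φ : H1) :
    Integrable (fun ω => (freeData hc).quot (pot α β ε φ) ω * R (2 * Real.pi * ε) 0) ∧
      absR hc (pot α β ε φ) = (freeData hc).absM (pot α β ε φ) := by
  obtain ⟨h1, h2⟩ := absR_eq_integral hD hε hc φ
  simp only [← quotientOp_eq hD hε hc, quotientOp_eq_quot hD hε hc] at h1 h2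
  exact ⟨h1, (eq_inv_smul_iff₀ Real.pi_ne_zero).2 h2⟩

/-- The case φ = 0 of the integral formula for |D_φ|, where N = 1. -/
lemma integrable_free (hD : IsDiracMatrices α β) (hε : 0 < ε) (hc : 0 < 2 * Real.pi * ε) :
    Integrable fun ω => (1 - ω ^ 2 • (freeData hc).R ω) * (freeData hc).R 0 := by
  have h := (absR_eq_absM hD hε hc 0).1
  refine h.congr (.of_forall fun ω => ?_)
  have e : (freeData hc).N (pot α β ε 0) ω = 1 := by
    have h0 := pot_smul (α := α) (β := β) (ε := ε) 0 0
    rw [zero_smul, zero_smul, zero_pow two_ne_zero, zero_smul, add_zero] at h0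
    rw [h0, FreeData.N_zero]
  simp only [FreeData.quot, e, mul_one]
  rfl

/-- Composition with `D_0² : H² → L²`. -/
def compJop (ε : ℝ) : (L2 C4 →L[ℂ] L2 C4) →L[ℝ] (H2 →L[ℂ] L2 C4) :=
  ((ContinuousLinearMap.compL ℂ H2 (L2 C4) (L2 C4)).flip (Jop ε)).restrictScalars ℝ

lemma absDirac_line (hD : IsDiracMatrices α β) (hε : 0 < ε) (hc : 0 < 2 * Real.pi * ε) (φ : H1)
    (s : ℝ) : absDirac α β ε (s • φ) =
      compJop ε ((freeData hc).absM (s • linPot α β ε φ + s ^ 2 • quadPot φ φ)) := by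
  rw [absDirac_eq hD hε hc, (absR_eq_absM hD hε hc _).2, pot_smul]
  rfl

theorem contDiffAt_absDirac (hD : IsDiracMatrices α β) (hε : 0 < ε) (φ : H1) :
    ContDiffAt ℝ 4 (fun s : ℝ => absDirac α β ε (s • φ)) 0 := by
  have hc : 0 < 2 * Real.pi * ε := by positivity
  simp only [absDirac_line hD hε hc]
  exact (compJop ε).contDiff.contDiffAt.comp _
    ((freeData hc).contDiffAt_absM (regular_line hD hε hc φ) (integrable_free hD hε hc)).1

/-- The Taylor remainder in 𝓛(H², L²) is a bounded operator on L² followed on the right by R_0 D_0²,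
and R_0 D_0² u = u. The factor R_0 disappears, which is what allows the extension to L². -/
lemma vacuumH2_eq (hD : IsDiracMatrices α β) (hε : 0 < ε) (φ : H1) (u : H2) :
    vacuumH2 α β ε φ u = ((-((Real.pi⁻¹ : ℝ) : ℂ)) • ∫ ω, vacuumIntegrand α β ε φ ω) u.fn := by
  have hc : 0 < 2 * Real.pi * ε := by positivity
  obtain ⟨h1, h2⟩ :=
    (freeData hc).contDiffAt_absM (regular_line hD hε hc φ) (integrable_free hD hε hc)
  have e : vacuumH2 α β ε φ =
      -absDirac α β ε φ + tay fun s : ℝ => absDirac α β ε (s • φ) := rfl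
  have e1 := absDirac_line hD hε hc φ 1
  rw [one_smul, one_smul, one_pow, one_smul] at e1
  have h3 : (tay fun s : ℝ => absDirac α β ε (s • φ)) = _ :=
    (congrArg tay (funext (absDirac_line hD hε hc φ))).trans (tay_clm h1 (compJop ε))
  have k1 : absDirac α β ε φ u = _ := DFunLike.congr_fun e1 u
  have k3 : (tay fun s : ℝ => absDirac α β ε (s • φ)) u = _ := DFunLike.congr_fun h3 u
  rw [e, add_apply, neg_apply, k1, k3, neg_add_eq_sub, vacuumIntegrand_eq hD hε hc, ← R_Jop ε u]
  exact DFunLike.congr_fun h2 (Jop ε u)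

/-- H² contains the range of R_0, which is dense because R_0 is symmetric and injective. -/
lemma IsExtension.unique (hε : 0 < ε) {K K' : L2 C4 →L[ℂ] L2 C4} {B : H2 →L[ℂ] L2 C4}
    (h : IsExtension K B) (h' : IsExtension K' B) : K = K' := by
  have key : ∀ f, (K - K') (R (2 * Real.pi * ε) 0 f) = 0 := fun f => by
    obtain ⟨u, hu, -⟩ := exists_H2 hε f
    rw [← hu, sub_apply, h u, h' u, sub_self]
  have hadj : ContinuousLinearMap.adjoint (K - K') = 0 := by
    ext1 g
    refine R_injective (2 * Real.pi * ε) 0 (ext_inner_left ℂ fun f => ?_)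
    rw [← inner_R_left, ContinuousLinearMap.adjoint_inner_right, key, inner_zero_left,
      inner_zero_right]
  rw [← sub_eq_zero, ← ContinuousLinearMap.adjoint_adjoint (K - K'), hadj, map_zero]

theorem vacuumOp_eq (hD : IsDiracMatrices α β) (hε : 0 < ε) (φ : H1) :
    vacuumOp α β ε φ = ((-((Real.pi⁻¹ : ℝ) : ℂ)) • ∫ ω, vacuumIntegrand α β ε φ ω) := by
  have h : IsExtension (((-((Real.pi⁻¹ : ℝ) : ℂ)) • ∫ ω, vacuumIntegrand α β ε φ ω)) (vacuumH2 α β ε φ) :=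
    fun u => (vacuumH2_eq hD hε φ u).symm
  have hex : ∃ K, IsExtension K (vacuumH2 α β ε φ) := ⟨_, h⟩
  rw [vacuumOp, dif_pos hex]
  exact hex.choose_spec.unique hε h

theorem isExtension_vacuumOp (hD : IsDiracMatrices α β) (hε : 0 < ε) (φ : H1) :
    IsExtension (vacuumOp α β ε φ) (vacuumH2 α β ε φ) := fun u => by
  rw [vacuumOp_eq hD hε, vacuumH2_eq hD hε]

theorem isTraceClass_integral_vacuumIntegrand (hD : IsDiracMatrices α β) (hε : 0 < ε) (φ : H1) :
    IsTraceClass (∫ ω, vacuumIntegrand α β ε φ ω) := by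
  have hc : 0 < 2 * Real.pi * ε := by positivity
  obtain ⟨⟨c, h⟩, -⟩ := trBound_integral_vacuumIntegrand hD hε hc φ
  exact h.isTraceClass

theorem isTraceClass_vacuumOp (hD : IsDiracMatrices α β) (hε : 0 < ε) (φ : H1) :
    IsTraceClass (vacuumOp α β ε φ) := by
  have hc : 0 < 2 * Real.pi * ε := by positivity
  obtain ⟨⟨c, h⟩, -⟩ := trBound_integral_vacuumIntegrand hD hε hc φ
  rw [vacuumOp_eq hD hε]
  exact (h.smul _).isTraceClass

lemma trace_vacuumOp (hD : IsDiracMatrices α β) (hε : 0 < ε) (φ : H1) :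
    trace (vacuumOp α β ε φ) =
      -((Real.pi⁻¹ : ℝ) : ℂ) * trace (∫ ω, vacuumIntegrand α β ε φ ω) := by
  rw [vacuumOp_eq hD hε, trace_smul]

lemma im_trace_integral_vacuumIntegrand (hD : IsDiracMatrices α β) (hε : 0 < ε) (φ : H1) :
    (trace (∫ ω, vacuumIntegrand α β ε φ ω)).im = 0 := by
  have hc : 0 < 2 * Real.pi * ε := by positivity
  obtain ⟨⟨c, h⟩, -⟩ := trBound_integral_vacuumIntegrand hD hε hc φ
  exact h.trace_im_eq_zero (isSelfAdjoint_integral_vacuumIntegrand hD hε φ)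

theorem vacuumEnergy_eq_trace (hD : IsDiracMatrices α β) (hε : 0 < ε) (φ : H1) :
    (vacuumEnergy α β ε φ : ℂ) = 1 / 2 * trace (vacuumOp α β ε φ) := by
  have him : (trace (vacuumOp α β ε φ)).im = 0 := by
    rw [trace_vacuumOp hD hε, ← Complex.ofReal_neg, Complex.im_ofReal_mul,
      im_trace_integral_vacuumIntegrand hD hε, mul_zero]
  have hre : ((trace (vacuumOp α β ε φ)).re : ℂ) = trace (vacuumOp α β ε φ) :=
    Complex.ext (Complex.ofReal_re _) (by rw [Complex.ofReal_im, him])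
  rw [vacuumEnergy, Complex.ofReal_mul, hre]
  norm_num

theorem vacuumEnergy_eq_integral (hD : IsDiracMatrices α β) (hε : 0 < ε) (φ : H1) :
    (vacuumEnergy α β ε φ : ℂ) =
      -(1 / (2 * Real.pi)) * trace (∫ ω, vacuumIntegrand α β ε φ ω) := by
  rw [vacuumEnergy_eq_trace hD hε, trace_vacuumOp hD hε, Complex.ofReal_inv]
  ring

lemma vacuumEnergy_eq_trG (hD : IsDiracMatrices α β) (hε : 0 < ε) (hc : 0 < 2 * Real.pi * ε) :
    vacuumEnergy α β ε = fun φ => 1 / 2 * (-Real.pi⁻¹ *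
      Complex.reCLM ((freeData hc).trG (linPot α β ε φ) (quadPot φ φ))) := by
  funext φ
  rw [vacuumEnergy, trace_vacuumOp hD hε, (trBound_integral_vacuumIntegrand hD hε hc φ).2,
    ← Complex.ofReal_neg, Complex.re_ofReal_mul]
  rfl

lemma contDiff_quadPot : ContDiff ℝ (⊤ : ℕ∞) fun φ : H1 => quadPot φ φ :=
  quadPot.contDiff.clm_apply contDiff_id

theorem continuous_vacuumEnergy (hD : IsDiracMatrices α β) (hε : 0 < ε) :
    Continuous (vacuumEnergy α β ε) := by
  have hc : 0 < 2 * Real.pi * ε := by positivity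
  rw [vacuumEnergy_eq_trG hD hε hc]
  refine continuous_iff_continuousAt.2 fun φ₀ => continuousAt_const.mul (continuousAt_const.mul
    (Complex.reCLM.continuous.continuousAt.comp ?_))
  have hp : ∀ᶠ φ in 𝓝 φ₀, ‖pot α β ε φ‖ < ‖pot α β ε φ₀‖ + 1 :=
    (contDiff_pot α β ε (n := 0)).continuous.norm.continuousAt.eventually_lt_const (lt_add_one _)
  exact (freeData hc).continuousAt_trG (linPot α β ε).continuous.continuousAt
    contDiff_quadPot.continuous.continuousAt (hp.mono fun φ h => regular_pot hD hε hc h.le)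

theorem contDiffOn_vacuumEnergy (hD : IsDiracMatrices α β) (hε : 0 < ε) :
    ContDiffOn ℝ (⊤ : ℕ∞) (vacuumEnergy α β ε) (gapSet α β ε) := by
  have hc : 0 < 2 * Real.pi * ε := by positivity
  rw [vacuumEnergy_eq_trG hD hε hc]
  refine fun φ₀ hφ => (contDiffAt_const.mul (contDiffAt_const.mul
    (Complex.reCLM.contDiff.contDiffAt.comp φ₀ ?_))).contDiffWithinAt
  refine (freeData hc).contDiffAt_trG (linPot α β ε).contDiff.contDiffAt
    contDiff_quadPot.contDiffAt fun ω => ?_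
  -- The gap hypothesis enters only at ω = 0.
  rcases eq_or_ne ω 0 with rfl | hω
  · exact (mem_gapSet_iff hD hε hc φ₀).1 hφ
  · exact isUnit_of_ne_zero hD hε hc φ₀ hω

end VacuumEnergy
end DiracVacuum
end

open DiracVacuum
theorem mainTheorem3
    (α : Fin 3 → Matrix (Fin 4) (Fin 4) ℂ) (β : Matrix (Fin 4) (Fin 4) ℂ)
    (hD : IsDiracMatrices α β) (ε : ℝ) (hε : 0 < ε) :
    -- the vacuum energy is well defined
    (∀ φ : H1,
      (IsSelfAdjoint (dirac α β ε φ) ∧ ((dirac α β ε φ).domain : Set (L2 C4)) = spinorH1) ∧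
      IsAbs (absOp (dirac α β ε φ)) (dirac α β ε φ) ∧
      IsRestrictionToH2 (absDirac α β ε φ) (absOp (dirac α β ε φ)) ∧
      ContDiffAt ℝ 4 (fun s : ℝ => absDirac α β ε (s • φ)) 0 ∧
      IsExtension (vacuumOp α β ε φ) (vacuumH2 α β ε φ) ∧
      IsTraceClass (vacuumOp α β ε φ) ∧
      (vacuumEnergy α β ε φ : ℂ) = 1 / 2 * trace (vacuumOp α β ε φ)) ∧
    -- it is continuous
    Continuous (vacuumEnergy α β ε) ∧
    -- the integral formula
    (∀ φ : H1,
      (∀ ω : ℝ, ω ≠ 0 → IsBoundedInverse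
        (boundedInverse (addConst (pcomp (dirac α β ε φ) (dirac α β ε φ)) ((ω ^ 2 : ℝ) : ℂ)))
        (addConst (pcomp (dirac α β ε φ) (dirac α β ε φ)) ((ω ^ 2 : ℝ) : ℂ))) ∧
      (∀ ω : ℝ, ContDiffAt ℝ 4 (fun s : ℝ => quotientOp α β ε (s • φ) ω) 0) ∧
      Integrable (vacuumIntegrand α β ε φ) ∧
      IsTraceClass (∫ ω, vacuumIntegrand α β ε φ ω) ∧
      (vacuumEnergy α β ε φ : ℂ) =
        -(1 / (2 * Real.pi)) * trace (∫ ω, vacuumIntegrand α β ε φ ω)) ∧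
    -- it is smooth on the open set where zero is not in the spectrum
    IsOpen (gapSet α β ε) ∧
    ContDiffOn ℝ (⊤ : ℕ∞) (vacuumEnergy α β ε) (gapSet α β ε) := by
  have hc : 0 < 2 * Real.pi * ε := by positivity
  refine ⟨fun φ => ⟨⟨isSelfAdjoint_dirac hD hε hc φ, domain_dirac φ⟩, isAbs_absOp hD hε φ,
    isRestrictionToH2_absDirac hD hε φ, contDiffAt_absDirac hD hε φ, isExtension_vacuumOp hD hε φ,
    isTraceClass_vacuumOp hD hε φ, vacuumEnergy_eq_trace hD hε φ⟩, continuous_vacuumEnergy hD hε,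
    fun φ => ⟨fun ω hω => ?_, contDiffAt_quotientOp hD hε φ, integrable_vacuumIntegrand hD hε φ,
      isTraceClass_integral_vacuumIntegrand hD hε φ, vacuumEnergy_eq_integral hD hε φ⟩,
    isOpen_gapSet hD hε, contDiffOn_vacuumEnergy hD hε⟩
  have h := isSqResolvent_R_N hD hε hc hω (isUnit_of_ne_zero hD hε hc φ hω)
  rw [h.boundedInverse_eq]
  exact h
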